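/- **Setting.** Let $M$ be a smooth (Hausdorff) $n$-manifold with a smooth Riemannian metric $g$ and two smooth, torsion-free affine connections $\nabla,\nabla^*$ of zero curvature that are dual with respect to $g$: $v\langle X,Y\rangle=\langle\nabla_vX,Y\rangle+\langle X,\nabla^*_vY\rangle$ (a dually flat statistical manifold). The Monge–Ampère operator is $\varphi\mapsto\det\mathrm{Hess}\,\varphi$. **Statement.** Every $x\in M$ has an open neighbourhood $U$ with two smooth coordinate systems $\eta:U\to V\subset\mathbb R^n$, $\eta^*:U\to V^*\subset\mathbb R^n$ (diffeomorphisms onto $V$, $V^*$) and functions $\psi:V\to\mathbb R$, $\psi^*:V^*\to\mathbb R$ such that the following hold. 1. *(Dual coordinates and potentials.)* The coordinate vector fields $\partial_i=\partial/\partial\eta^i$ are $\nabla$-parallel, the fields $\partial^i=\partial/\partial\eta^*_i$ are $\nabla^*$-parallel, and $g(\partial_i,\partial^j)=\delta_i^j$. With $g_{ij}=g(\partial_i,\partial_j)$ and $(g^{ij})=(g_{ij})^{-1}$, one has on $U$ $$g_{ij}=\partial_i\partial_j\psi(\eta),\quad g^{ij}=\partial^i\partial^j\psi^*(\eta^*),\quad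 \eta^*=\nabla\psi(\eta),\quad \eta=\nabla\psi^*(\eta^*),\quad \psi(\eta)+\psi^*(\eta^*)=\langle\eta,\eta^*\rangle .$$ 2. *(Pair of Monge–Ampère equations.)* $V$ and $V^*$ are bounded, open, convex, with strictly convex closures; $\psi,\psi^*$ are smooth and strictly convex; and $\det\mathrm{Hess}\,\psi=\det(g_{ij})>0$ on $V$, $\det\mathrm{Hess}\,\psi^*=\det(g(\partial^i,\partial^j))>0$ on $V^*$. Moreover $\nabla\psi$ is an optimal transport map for the quadratic cost $|x-Tx|^2$ from Lebesgue measure on $V$ to the measure $\det\mathrm{Hess}\,\psi^*(y)\,dy$ on $V^*$, and $\nabla\psi^*$ is one from Lebesgue measure on $V^*$ to $\det\mathrm{Hess}\,\psi(x)\,dx$ on $V$. 3. *(Loss.)* The function $D(r,q)=\psi(\eta(r))+\psi^*(\eta^*(q))-\langle\eta(r),\eta^*(q)\rangle$ on $U\times U$ is nonnegative and vanishes exactly when $r=q$. 4. *(Optimal learning.)* For all $p,q\in U$ there is an optimal learning procedure from $p$ to $q$ for the loss $L=D(q,\cdot)$ with respect to the coordinates $e=\eta$, and one for the loss $L=D(\cdot,q)$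 with respect to $e=\eta^*$. Here an *optimal learning procedure* from $p$ to $q$ for $L$ with respect to $e$ is a smooth curve $\gamma:[0,1]\to U$ with $\gamma(0)=p$, $\gamma(1)=q$ such that (a) for every $t\in[0,1)$ the velocity $\dot\gamma(t)$ is a direction of steepest descent of $L$ for $g$: $dL(\dot\gamma(t))\le dL(v)$ for every tangent vector $v$ at $\gamma(t)$ with $g(v,v)\le g(\dot\gamma(t),\dot\gamma(t))$, and $dL(\dot\gamma(t))<0$ if $p\neq q$; (b) $\gamma$ minimizes the flat energy $\int_0^1|\tfrac{d}{dt}\,e(c(t))|^2\,dt$ among all $C^1$ curves $c:[0,1]\to U$ from $p$ to $q$. 5. *(Link with Kullback information.)* Whenever the points of $M$ are realized as probability distributions $P_r$ on a measurable space with densities $\exp(\langle\theta(r),T\rangle-\Psi(r))$ with respect to a fixed measure, where $T$ is a measurable $\mathbb R^n$-valued statistic, $\theta:M\to\mathbb R^n$ is a local diffeomorphism, $\nabla$-affine (its differential is $\nabla$-parallel), and $g$ is the Fisher metric of the family, the loss is the Kullback information: $D(r,q)=I(P_q,P_r)=\int\log\frac{dP_q}{dP_r}\,dP_q$ for all $r,q\in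 U$. -/

import Mathlib

open Set Filter MeasureTheory Bundle
open scoped Manifold ContDiff Topology ENNReal

noncomputable section

namespace DuallyFlat

/-- Coordinate space `ℝⁿ` with its Euclidean structure. -/
abbrev Coord (n : ℕ) : Type := EuclideanSpace ℝ (Fin n)

/-- The `i`-th standard basis vector of `ℝⁿ`. -/
def stdVec {n : ℕ} (i : Fin n) : Coord n := EuclideanSpace.single i (1 : ℝ)

/-! ### Monge–Ampère operators and optimal transport on `ℝⁿ` -/

/-- The Hessian matrix `(∂ᵢ∂ⱼ φ)(x)`. -/
def hessian {n : ℕ} (φ : Coord n → ℝ) (x : Coord n) : Matrix (Fin n) (Fin n) ℝ :=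
  Matrix.of fun i j => fderiv ℝ (fderiv ℝ φ) x (stdVec i) (stdVec j)

/-- The Monge–Ampère operator `φ ↦ det Hess φ`. -/
def mongeAmpere {n : ℕ} (φ : Coord n → ℝ) (x : Coord n) : ℝ := (hessian φ x).det

/-- `(V, φ)` is the geometric datum of the elliptic Monge–Ampère equation `det Hess φ = f`:
`V` is a bounded strictly convex domain, `φ` is a smooth strictly convex function on `V`,
`f` is positive on `V`, and the equation holds in `V`. For an open set, strict convexity is
a condition on the closed domain `closure V`. -/
structure SolvesMongeAmpere {n : ℕ} (V : Set (Coord n)) (φ f : Coord n → ℝ) : Prop where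
  isOpen : IsOpen V
  bounded : Bornology.IsBounded V
  convex : Convex ℝ V
  strictConvex_closure : StrictConvex ℝ (closure V)
  smooth : ContDiffOn ℝ ∞ φ V
  strictConvexOn : StrictConvexOn ℝ V φ
  pos : ∀ x ∈ V, 0 < f x
  equation : ∀ x ∈ V, mongeAmpere φ x = f x

/-- `T` is an optimal solution of the Monge problem between the mass distributions `μ` and `ν`
for the quadratic cost: it pushes `μ` forward to `ν`, and no other transport map is cheaper. -/
structure IsOptimalTransport {n : ℕ} (μ ν : Measure (Coord n)) (T : Coord n → Coord n) :
    Prop where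
  aemeasurable : AEMeasurable T μ
  map_eq : μ.map T = ν
  optimal : ∀ S : Coord n → Coord n, AEMeasurable S μ → μ.map S = ν →
    ∫⁻ x, ‖x - T x‖ₑ ^ 2 ∂μ ≤ ∫⁻ x, ‖x - S x‖ₑ ^ 2 ∂μ

/-! ### Dually flat manifolds -/

section Manifold

variable {n : ℕ} {M : Type*} [TopologicalSpace M] [ChartedSpace (Coord n) M]
  [IsManifold (𝓡 n) ∞ M]

/-- Smooth Riemannian metrics on `M`. -/
abbrev Metric (n : ℕ) (M : Type*) [TopologicalSpace M] [ChartedSpace (Coord n) M]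
    [IsManifold (𝓡 n) ∞ M] : Type _ :=
  ContMDiffRiemannianMetric (𝓡 n) ∞ (Coord n) (fun x : M => TangentSpace (𝓡 n) x)

/-- Affine connections on `M`, i.e. covariant derivatives on the tangent bundle;
`D σ x v` is `(∇_v σ)(x)`. -/
abbrev Connection (n : ℕ) (M : Type*) [TopologicalSpace M] [ChartedSpace (Coord n) M]
    [IsManifold (𝓡 n) ∞ M] : Type _ :=
  CovariantDerivative (𝓡 n) (Coord n) (fun x : M => TangentSpace (𝓡 n) x)

/-- A (not necessarily continuous) vector field on `M`. -/
abbrev VField (n : ℕ) (M : Type*) [TopologicalSpace M] [ChartedSpace (Coord n) M] : Type _ :=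
  ∀ x : M, TangentSpace (𝓡 n) x

/-- Smoothness of a vector field on `M`. -/
def SmoothField (X : VField n M) : Prop :=
  ContMDiff (𝓡 n) (𝓡 n).tangent ∞ (fun x => (⟨x, X x⟩ : TangentBundle (𝓡 n) M))

/-- The curvature `∇_X ∇_Y Z - ∇_Y ∇_X Z - ∇_[X,Y] Z`. -/
def curvature (D : Connection n M) (X Y Z : VField n M) : VField n M := fun x =>
  D (fun y => D Z y (Y y)) x (X x) - D (fun y => D Z y (X y)) x (Y x)
    - D Z x (VectorField.mlieBracket (𝓡 n) X Y x)

/-- A smooth torsion-free affine connection with vanishing curvature. -/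
structure IsFlatTorsionFree (D : Connection n M) : Prop where
  smooth : CovariantDerivative.ContMDiffCovariantDerivative D ∞
  torsion_eq_zero : D.torsion = 0
  curvature_eq_zero : ∀ X Y Z : VField n M, SmoothField X → SmoothField Y → SmoothField Z →
    curvature D X Y Z = 0

/-- `(M, g, ∇, ∇*)` is dually flat: `∇` and `∇*` are flat and torsion-free, and they are dual to
each other, `v ⟨X, Y⟩ = ⟨∇_v X, Y⟩ + ⟨X, ∇*_v Y⟩`. -/
structure IsDuallyFlat (g : Metric n M) (D Ds : Connection n M) : Prop where
  flat : IsFlatTorsionFree D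
  flat_star : IsFlatTorsionFree Ds
  dual : ∀ X Y : VField n M, SmoothField X → SmoothField Y →
    ∀ (x : M) (v : TangentSpace (𝓡 n) x),
      mvfderiv (𝓡 n) (fun y => g.inner y (X y) (Y y)) x v
        = g.inner x (D X x v) (Y x) + g.inner x (X x) (Ds Y x v)

/-! ### Dual coordinates and their potentials -/

/-- The coordinate vector field `∑ vⁱ ∂/∂eⁱ` of a coordinate system `e`. -/
def coordField (e : OpenPartialHomeomorph M (Coord n)) (v : Coord n) : VField n M :=
  fun y => mfderiv 𝓘(ℝ, Coord n) (𝓡 n) e.symm (e y) v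

/-- `e` is a smooth coordinate system whose coordinate vector fields are parallel for `∇`. -/
structure IsAffineCoord (D : Connection n M) (e : OpenPartialHomeomorph M (Coord n)) :
    Prop where
  mem_maximalAtlas : e ∈ IsManifold.maximalAtlas (𝓡 n) ∞ M
  parallel : ∀ v : Coord n, ∀ y ∈ e.source, D (coordField e v) y = 0

/-- The matrix `(g_ij)` of the metric in the coordinates `e`, at the point `y`. -/
def gram (g : Metric n M) (e : OpenPartialHomeomorph M (Coord n)) (y : M) :
    Matrix (Fin n) (Fin n) ℝ :=
  Matrix.of fun i j => g.inner y (coordField e (stdVec i) y) (coordField e (stdVec j) y)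

/-- Two coordinate systems `η`, `η*` on a domain of `M`, with functions `ψ(η)` and `ψ*(η*)`. -/
structure CoordPair (n : ℕ) (M : Type*) [TopologicalSpace M] where
  η : OpenPartialHomeomorph M (Coord n)
  ηs : OpenPartialHomeomorph M (Coord n)
  ψ : Coord n → ℝ
  ψs : Coord n → ℝ

/-- The common domain of the two coordinate systems. -/
def CoordPair.dom (C : CoordPair n M) : Set M := C.η.source

/-- `C` is a pair of mutually dual affine coordinate systems with Legendre dual potentials, and
these potentials solve a pair of elliptic Monge–Ampère equations whose right-hand sides are the
determinants of the metric. The two gradient maps are the optimal transports between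
the coordinate domains that the two Monge–Ampère operators prescribe. -/
structure IsDualMongeAmperePair (g : Metric n M) (D Ds : Connection n M) (C : CoordPair n M) :
    Prop where
  source_eq : C.ηs.source = C.dom
  affine : IsAffineCoord D C.η
  affine_star : IsAffineCoord Ds C.ηs
  biorthogonal : ∀ y ∈ C.dom, ∀ i j : Fin n,
    g.inner y (coordField C.η (stdVec i) y) (coordField C.ηs (stdVec j) y)
      = if i = j then 1 else 0
  hessian_eq : ∀ y ∈ C.dom, hessian C.ψ (C.η y) = gram g C.η y
  hessian_star_eq : ∀ y ∈ C.dom, hessian C.ψs (C.ηs y) = (gram g C.η y)⁻¹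
  gradient_eq : ∀ y ∈ C.dom, HasGradientAt C.ψ (C.ηs y) (C.η y)
  gradient_star_eq : ∀ y ∈ C.dom, HasGradientAt C.ψs (C.η y) (C.ηs y)
  legendre : ∀ y ∈ C.dom, C.ψ (C.η y) + C.ψs (C.ηs y) = inner ℝ (C.η y) (C.ηs y)
  solves : SolvesMongeAmpere C.η.target C.ψ fun z => (gram g C.η (C.η.symm z)).det
  solves_star : SolvesMongeAmpere C.ηs.target C.ψs fun z => (gram g C.ηs (C.ηs.symm z)).det
  transport : IsOptimalTransport (volume.restrict C.η.target)
    ((volume.restrict C.ηs.target).withDensity fun z => ENNReal.ofReal (mongeAmpere C.ψs z))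
    (gradient C.ψ)
  transport_star : IsOptimalTransport (volume.restrict C.ηs.target)
    ((volume.restrict C.η.target).withDensity fun z => ENNReal.ofReal (mongeAmpere C.ψ z))
    (gradient C.ψs)

/-- The canonical divergence `ψ(η(r)) + ψ*(η*(q)) - ⟨η(r), η*(q)⟩`. -/
def divergence (C : CoordPair n M) (r q : M) : ℝ :=
  C.ψ (C.η r) + C.ψs (C.ηs q) - inner ℝ (C.η r) (C.ηs q)

/-! ### Learning curves -/

/-- `γ` restricted to `[0, 1]` is a curve of class `C^k` from `p` to `q` in `U`. -/
structure IsCurve (k : ℕ∞ω) (U : Set M) (p q : M) (γ : ℝ → M) : Prop where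
  contMDiffOn : ContMDiffOn 𝓘(ℝ, ℝ) (𝓡 n) k γ (Icc 0 1)
  mapsTo : MapsTo γ (Icc 0 1) U
  start : γ 0 = p
  finish : γ 1 = q

/-- The velocity of a curve parametrised by `[0, 1]`. -/
def velocity (γ : ℝ → M) (t : ℝ) : TangentSpace (𝓡 n) (γ t) :=
  mfderivWithin 𝓘(ℝ, ℝ) (𝓡 n) γ (Icc 0 1) t (1 : ℝ)

/-- The energy of a curve for the flat metric `∑ (d eⁱ)²` of a coordinate system `e`. -/
def flatEnergy (e : OpenPartialHomeomorph M (Coord n)) (γ : ℝ → M) : ℝ :=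
  ∫ t in (0 : ℝ)..1, ‖derivWithin (fun s => e (γ s)) (Icc 0 1) t‖ ^ 2

/-- `γ` is an optimal learning procedure from `p` to `q` for the loss function `L`, in the domain
of the flat coordinate system `e`: it is a smooth curve from `p` to `q` that at each time moves
in the direction of steepest descent of `L` with respect to `g` (among all tangent vectors that
are not longer, the velocity decreases `L` fastest), along which `L` decreases strictly as long as
there is something to learn, and whose flat energy is minimal among all curves from `p` to `q`. -/
structure IsOptimalLearning (g : Metric n M) (e : OpenPartialHomeomorph M (Coord n))
    (L : M → ℝ) (p q : M) (γ : ℝ → M) : Prop where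
  curve : IsCurve (n := n) ∞ e.source p q γ
  steepest : ∀ t ∈ Ico (0 : ℝ) 1, ∀ v : TangentSpace (𝓡 n) (γ t),
    g.inner (γ t) v v ≤ g.inner (γ t) (velocity γ t) (velocity γ t) →
      mvfderiv (𝓡 n) L (γ t) (velocity γ t) ≤ mvfderiv (𝓡 n) L (γ t) v
  descent : p ≠ q → ∀ t ∈ Ico (0 : ℝ) 1, mvfderiv (𝓡 n) L (γ t) (velocity γ t) < 0
  energy_min : ∀ c : ℝ → M, IsCurve (n := n) 1 e.source p q c → flatEnergy e γ ≤ flatEnergy e c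

/-! ### Exponential families -/

/-- The measure with density `exp(⟨θ, T⟩ - a)` with respect to `ν`. -/
def expMeasure {Ω : Type*} [MeasurableSpace Ω] (ν : Measure Ω) (T : Ω → Coord n)
    (θ : Coord n) (a : ℝ) : Measure Ω :=
  ν.withDensity fun z => ENNReal.ofReal (Real.exp (inner ℝ θ (T z) - a))

/-- The points of `(M, g, ∇)` are the members of an exponential family: the point `r` is the
probability distribution with density `exp(⟨θ(r), T⟩ - Ψ(r))` with respect to `ν`, the canonical
parameters `θ` are local `∇`-affine coordinates of `M` (their differentials are parallel), and
`g` is the Fisher metric. -/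
structure IsExponentialFamily {Ω : Type*} [MeasurableSpace Ω] (g : Metric n M)
    (D : Connection n M) (ν : Measure Ω) (T : Ω → Coord n) (θ : M → Coord n) (Ψ : M → ℝ) :
    Prop where
  measurable : Measurable T
  normalized : ∀ r, IsProbabilityMeasure (expMeasure ν T (θ r) (Ψ r))
  coord : IsLocalDiffeomorph (𝓡 n) 𝓘(ℝ, Coord n) ∞ θ
  affine : ∀ X : VField n M, SmoothField X → ∀ (r : M) (v : TangentSpace (𝓡 n) r),
    mvfderiv (𝓡 n) (fun y => mvfderiv (𝓡 n) θ y (X y)) r v = mvfderiv (𝓡 n) θ r (D X r v)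
  fisher : ∀ (r : M) (v w : TangentSpace (𝓡 n) r),
    g.inner r v w = ∫ z, mvfderiv (𝓡 n) (fun s => inner ℝ (θ s) (T z) - Ψ s) r v
      * mvfderiv (𝓡 n) (fun s => inner ℝ (θ s) (T z) - Ψ s) r w ∂(expMeasure ν T (θ r) (Ψ r))

end Manifold

end DuallyFlat

end

noncomputable section

/-! ### Linear total differential equations and their Frobenius theorem -/

section TotalODE

set_option maxSynthPendingDepth 3

variable {E F : Type*} [NormedAddCommGroup E] [NormedSpace ℝ E]
  [NormedAddCommGroup F] [NormedSpace ℝ F]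

/-! Flatness produces the coordinates, duality produces the potential, and convexity yields the
rest. In a chart, ∇-affine coordinates together with their differential solve a linear total
differential equation f' v = B v f, whose integrability condition is exactly the vanishing of
torsion and curvature (`exists_hasFDerivAt_of_integrable`, `exists_flat_coordinates`). In these
coordinates the Christoffel symbols of ∇ vanish and the duality identity becomes ∂_u g(v, w) = g(v,
Γ*(w, u)). Since ∇* has no torsion, ∂g is totally symmetric (`fderiv_coordMetric_symm`), and the
same Frobenius theorem integrates g twice: g = Hess ψ (`exists_potential`).

Positivity of g makes h = ∇ψ a local diffeomorphism. Put η* = h(η) and let ψ* be the Legendre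
transform of ψ. The domain V is a small ball around z₀ = η(x). Its image V* is, near h(z₀), a
sublevel set of w ↦ |h⁻¹(w) − z₀|², which is strictly convex there; this gives convexity of both
domains and strict convexity of their closures (`exists_legendrePair`). The fields ∂^j have constant
products with the ∇-parallel fields ∂_i, so duality forces them to be ∇*-parallel
(`IsLegendreChart.affine_star`).

The Fenchel–Young inequality, strict off the graph of h, gives positivity of the loss and also
optimality of the transport, with |x|² − 2ψ and |y|² − 2ψ* as Kantorovich potentials. The g-gradient
of D(q, ·) at r is minus the vector with η-coordinates η(q) − η(r), so η-segments descend steepest,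
while Cauchy–Schwarz makes them energy minimizing. The other loss is the mirror case in η*.

For an exponential family, the log-partition function along an η-segment is a cumulant generating
function. Its second derivative is a variance, hence the Fisher metric, hence (ψ ∘ segment)''. The
two functions differ by an affine one, which does not contribute to the Bregman divergence
(`IsLegendreChart.klDiv_eq_divergence`). -/

theorem exists_solution_linear_ode [CompleteSpace F] (A : ℝ → F →L[ℝ] F)
    (hA : ContinuousOn A (Icc 0 1)) (hb : ∀ t ∈ Icc (0 : ℝ) 1, ‖A t‖ ≤ 1 / 2) (y₀ : F) :
    ∃ Y : ℝ → F, Y 0 = y₀ ∧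
      ∀ t ∈ Icc (0 : ℝ) 1, HasDerivWithinAt Y (A t (Y t)) (Icc 0 1) t := by
  -- Radius and speed bound are both ‖y₀‖: on that ball ‖y‖ ≤ 2‖y₀‖, so the operator bound 1/2 gives
  -- speed at most ‖y₀‖ and the solution cannot leave the ball within unit time.
  have hp : IsPicardLindelof (fun t y => A t y) (tmin := 0) (tmax := 1) ⟨0, by simp⟩ y₀
      (‖y₀‖₊) 0 (‖y₀‖₊) 1 := by
    refine ⟨fun t ht => ?_, fun y _ => hA.clm_apply continuousOn_const, fun t ht y hy => ?_, ?_⟩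
    · refine ((A t).lipschitz.weaken ?_).lipschitzOnWith
      rw [← NNReal.coe_le_coe]
      simpa using (hb t ht).trans (by norm_num)
    · have h1 : ‖y‖ ≤ 2 * ‖y₀‖ := by
        rw [mem_closedBall_iff_norm] at hy
        calc ‖y‖ = ‖(y - y₀) + y₀‖ := by simp
          _ ≤ ‖y - y₀‖ + ‖y₀‖ := norm_add_le _ _
          _ ≤ 2 * ‖y₀‖ := by simp at hy; linarith
      calc ‖A t y‖ ≤ ‖A t‖ * ‖y‖ := (A t).le_opNorm y
        _ ≤ 1 / 2 * (2 * ‖y₀‖) := by gcongr; exact hb t ht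
        _ = ‖y₀‖ := by ring
        _ = _ := by simp
    · simp
  obtain ⟨Y, hY0, hY⟩ := hp.exists_eq_forall_mem_Icc_hasDerivWithinAt₀
  exact ⟨Y, hY0, hY⟩

theorem norm_sub_sub_fderiv_le_of_lipschitz {G : Type*} [NormedAddCommGroup G] [NormedSpace ℝ G]
    {B : E → G} {s : Set E} (hs : Convex ℝ s) {C : ℝ}
    (hB : ∀ x ∈ s, DifferentiableAt ℝ B x)
    (hL : ∀ x ∈ s, ∀ y ∈ s, ‖fderiv ℝ B x - fderiv ℝ B y‖ ≤ C * ‖x - y‖) (hC : 0 ≤ C)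
    {x w : E} (hx : x ∈ s) (hw : x + w ∈ s) :
    ‖B (x + w) - B x - fderiv ℝ B x w‖ ≤ C * ‖w‖ ^ 2 := by
  have hseg : segment ℝ x (x + w) ⊆ s := hs.segment_subset hx hw
  have h := (convex_segment x (x + w)).norm_image_sub_le_of_norm_fderiv_le'
    (f := B) (φ := fderiv ℝ B x) (C := C * ‖w‖) (x := x) (y := x + w) (𝕜 := ℝ)
    (fun y hy => hB y (hseg hy)) (fun y hy => ?_) (left_mem_segment ℝ _ _)
    (right_mem_segment ℝ _ _)
  · simp only [add_sub_cancel_left] at h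
    calc _ ≤ C * ‖w‖ * ‖w‖ := h
      _ = _ := by ring
  · refine (hL y (hseg hy) x hx).trans ?_
    gcongr
    rw [segment_eq_image'] at hy
    obtain ⟨θ, hθ, rfl⟩ := hy
    simp only [add_sub_cancel_left, norm_smul, Real.norm_eq_abs, abs_of_nonneg hθ.1]
    exact mul_le_of_le_one_left (norm_nonneg _) hθ.2

/-- The solutions of `Y' = B (x₀ + t h) h Y` along the rays through `x₀` depend differentiably on
`h` when `B` is integrable, because `Y + t B v Y` solves the equation of the ray `h + v` up to
an error of second order. -/
theorem norm_ray_solution_sub_le {B : E → E →L[ℝ] F →L[ℝ] F} {x₀ : E} {r K K' C N : ℝ}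
    (hr1 : r ≤ 1) (hK0 : 0 ≤ K) (hK'0 : 0 ≤ K') (hC : 0 ≤ C) (hN0 : 0 ≤ N)
    (hB : ∀ x ∈ Metric.ball x₀ r, DifferentiableAt ℝ B x)
    (hK : ∀ x ∈ Metric.ball x₀ r, ‖B x‖ ≤ K)
    (hKr : K * r ≤ 1)
    (hK' : ∀ x ∈ Metric.ball x₀ r, ‖fderiv ℝ B x‖ ≤ K')
    (hL : ∀ x ∈ Metric.ball x₀ r, ∀ y ∈ Metric.ball x₀ r,
      ‖fderiv ℝ B x - fderiv ℝ B y‖ ≤ C * ‖x - y‖)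
    (sym : ∀ x ∈ Metric.ball x₀ r, ∀ u v y,
      fderiv ℝ B x u v y + B x v (B x u y) = fderiv ℝ B x v u y + B x u (B x v y))
    {h v : E} {Y Y' : ℝ → F} (hh : ‖h‖ < r) (hv : ‖h + v‖ < r)
    (hY : ∀ t ∈ Icc (0 : ℝ) 1, HasDerivWithinAt Y (B (x₀ + t • h) h (Y t)) (Icc 0 1) t)
    (hY' : ∀ t ∈ Icc (0 : ℝ) 1,
      HasDerivWithinAt Y' (B (x₀ + t • (h + v)) (h + v) (Y' t)) (Icc 0 1) t)
    (h0 : Y' 0 = Y 0) (hN : ∀ t ∈ Icc (0 : ℝ) 1, ‖Y t‖ ≤ N) :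
    ‖Y' 1 - Y 1 - B (x₀ + h) v (Y 1)‖
      ≤ (K * K * N + K' * N + K' * K * N + C * (N + 2 * K * N)) * (Real.exp 1 - 1) * ‖v‖ ^ 2 := by
  set M := K * K * N + K' * N + K' * K * N + C * (N + 2 * K * N)
  have hv2 : ‖v‖ ≤ 2 := by
    have : ‖v‖ ≤ ‖h + v‖ + ‖h‖ := by
      calc ‖v‖ = ‖(h + v) - h‖ := by simp
        _ ≤ _ := norm_sub_le _ _
    linarith
  have mem : ∀ (k : E), ‖k‖ < r → ∀ t ∈ Icc (0 : ℝ) 1, x₀ + t • k ∈ Metric.ball x₀ r := by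
    intro k hk t ht
    simp only [mem_ball_iff_norm, add_sub_cancel_left, norm_smul, Real.norm_eq_abs,
      abs_of_nonneg ht.1]
    exact (mul_le_of_le_one_left (norm_nonneg _) ht.2).trans_lt hk
  -- `W` is the error of the first-order guess Y + t B v Y for the solution on the perturbed ray.
  let W : ℝ → F := fun t => Y' t - (Y t + t • B (x₀ + t • h) v (Y t))
  let W' : ℝ → F := fun t => B (x₀ + t • (h + v)) (h + v) (Y' t) -
    (B (x₀ + t • h) h (Y t) + (t • (B (x₀ + t • h) v (B (x₀ + t • h) h (Y t))
      + fderiv ℝ B (x₀ + t • h) h v (Y t)) + B (x₀ + t • h) v (Y t)))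
  have hW : ∀ t ∈ Icc (0 : ℝ) 1, HasDerivWithinAt W (W' t) (Icc 0 1) t := by
    intro t ht
    have h1 : HasDerivAt (fun s : ℝ => x₀ + s • h) h t := by
      simpa using ((hasDerivAt_id t).smul_const h).const_add x₀
    have h2 : HasDerivAt (fun s : ℝ => B (x₀ + s • h)) (fderiv ℝ B (x₀ + t • h) h) t :=
      (hB _ (mem h hh t ht)).hasFDerivAt.comp_hasDerivAt t h1
    have h3 : HasDerivAt (fun s : ℝ => B (x₀ + s • h) v) (fderiv ℝ B (x₀ + t • h) h v) t := by
      simpa using h2.clm_apply (hasDerivAt_const t v)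
    have h4 := h3.hasDerivWithinAt.clm_apply (hY t ht)
    have h5 := (hasDerivWithinAt_id t (Icc 0 1)).smul h4
    refine ((hY' t ht).sub ((hY t ht).add h5)).congr_deriv ?_
    simp only [W', id, one_smul]
    abel_nf
  have key : ∀ t ∈ Icc (0 : ℝ) 1, ‖W' t‖ ≤ 1 * ‖W t‖ + M * ‖v‖ ^ 2 := by
    intro t ht
    have hp := mem h hh t ht
    have hq := mem (h + v) hv t ht
    set p := x₀ + t • h with hpdef
    set q := x₀ + t • (h + v) with hqdef
    have hqp : q = p + t • v := by simp [hpdef, hqdef, smul_add, add_assoc]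
    set Q := B q - B p - fderiv ℝ B p (t • v) with hQ
    have hQn : ‖Q‖ ≤ C * ‖v‖ ^ 2 := by
      have := norm_sub_sub_fderiv_le_of_lipschitz (convex_ball x₀ r) hB hL hC hp
        (w := t • v) (hqp ▸ hq)
      rw [← hqp] at this
      refine this.trans ?_
      gcongr
      rw [norm_smul, Real.norm_eq_abs, abs_of_nonneg ht.1]
      exact mul_le_of_le_one_left (norm_nonneg _) ht.2
    set b := B p v (Y t) with hb
    have hbn : ‖b‖ ≤ K * ‖v‖ * N := by
      calc ‖b‖ ≤ ‖B p v‖ * ‖Y t‖ := (B p v).le_opNorm _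
        _ ≤ (‖B p‖ * ‖v‖) * ‖Y t‖ := by gcongr; exact (B p).le_opNorm _
        _ ≤ _ := by gcongr; exacts [hK p hp, hN t ht]
    have hZ : ‖Y t + t • b‖ ≤ N + 2 * K * N := by
      calc _ ≤ ‖Y t‖ + ‖t • b‖ := norm_add_le _ _
        _ ≤ N + 1 * (K * 2 * N) := by
            rw [norm_smul, Real.norm_eq_abs, abs_of_nonneg ht.1]
            have : K * ‖v‖ * N ≤ K * 2 * N := by gcongr
            gcongr
            exacts [hN t ht, ht.2, hbn.trans this]
        _ = _ := by ring
    have hBq : B q = B p + t • fderiv ℝ B p v + Q := by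
      rw [hQ, map_smul]; abel
    have hs := sym p hp h v (Y t)
    -- `W` solves the equation of the ray h + v up to terms quadratic in v. The guess produces
    -- B'(h)v while the Taylor expansion of B at q produces B'(v)h; integrability exchanges them,
    -- and the commutator cancels the remaining first-order terms.
    have e1 : W' t = B q (h + v) (W t) + (t • B p v b + t • fderiv ℝ B p v v (Y t)
        + (t * t) • fderiv ℝ B p v (h + v) b + Q (h + v) (Y t + t • b)) := by
      have hWt : Y' t = W t + (Y t + t • b) := by simp [W, b, p]
      simp only [W']
      rw [← hpdef, ← hqdef, hWt, map_add, add_sub_assoc]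
      congr 1
      rw [← hb]
      have hs' : fderiv ℝ B p h v (Y t) = fderiv ℝ B p v h (Y t) + B p h (B p v (Y t))
        - B p v (B p h (Y t)) := by rw [← hs]; abel
      rw [hBq, hs', ← hb]
      simp only [add_apply, smul_apply, map_add, map_smul,
        smul_add, smul_sub, mul_smul]
      abel
    have n1 : ‖B q (h + v) (W t)‖ ≤ 1 * ‖W t‖ := by
      refine ((B q (h + v)).le_opNorm _).trans ?_
      gcongr
      calc ‖B q (h + v)‖ ≤ ‖B q‖ * ‖h + v‖ := (B q).le_opNorm _
        _ ≤ K * r := by gcongr; exact hK q hq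
        _ ≤ 1 := hKr
    have hD : ∀ u, ‖fderiv ℝ B p v u‖ ≤ K' * ‖v‖ * ‖u‖ := fun u =>
      ((fderiv ℝ B p v).le_opNorm u).trans (by
        gcongr
        exact ((fderiv ℝ B p).le_opNorm v).trans (by gcongr; exact hK' p hp))
    have tn : ‖t‖ ≤ 1 := by rw [Real.norm_eq_abs, abs_of_nonneg ht.1]; exact ht.2
    have n2 : ‖t • B p v b‖ ≤ K * K * N * ‖v‖ ^ 2 := by
      rw [norm_smul]
      calc ‖t‖ * ‖B p v b‖ ≤ 1 * ((K * ‖v‖) * (K * ‖v‖ * N)) := by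
            gcongr
            refine ((B p v).le_opNorm _).trans ?_
            gcongr
            exact ((B p).le_opNorm _).trans (by gcongr; exact hK p hp)
        _ = _ := by ring
    have n3 : ‖t • fderiv ℝ B p v v (Y t)‖ ≤ K' * N * ‖v‖ ^ 2 := by
      rw [norm_smul]
      calc ‖t‖ * ‖fderiv ℝ B p v v (Y t)‖ ≤ 1 * ((K' * ‖v‖ * ‖v‖) * N) := by
            gcongr
            refine ((fderiv ℝ B p v v).le_opNorm _).trans ?_
            gcongr
            exacts [hD v, hN t ht]
        _ = _ := by ring
    have n4 : ‖(t * t) • fderiv ℝ B p v (h + v) b‖ ≤ K' * K * N * ‖v‖ ^ 2 := by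
      rw [norm_smul, norm_mul]
      calc ‖t‖ * ‖t‖ * ‖fderiv ℝ B p v (h + v) b‖
            ≤ 1 * 1 * ((K' * ‖v‖ * 1) * (K * ‖v‖ * N)) := by
            gcongr
            refine ((fderiv ℝ B p v (h + v)).le_opNorm _).trans ?_
            gcongr
            refine (hD _).trans ?_
            gcongr
            linarith
        _ = _ := by ring
    have n5 : ‖Q (h + v) (Y t + t • b)‖ ≤ C * (N + 2 * K * N) * ‖v‖ ^ 2 := by
      calc _ ≤ ‖Q (h + v)‖ * ‖Y t + t • b‖ := (Q (h + v)).le_opNorm _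
        _ ≤ (C * ‖v‖ ^ 2 * 1) * (N + 2 * K * N) := by
            gcongr
            exact (Q.le_opNorm _).trans (by gcongr; linarith)
        _ = _ := by ring
    rw [e1]
    refine (norm_add_le _ _).trans (add_le_add n1 ?_)
    refine (norm_add_le _ _).trans ?_
    refine (add_le_add (norm_add₃_le) le_rfl).trans ?_
    calc _ ≤ _ := add_le_add (add_le_add (add_le_add n2 n3) n4) n5
      _ = _ := by simp only [M]; ring
  -- Grönwall with zero initial error and rate 1, which bounds ‖B q (h + v)‖ because K r ≤ 1.
  have hg := norm_le_gronwallBound_of_norm_deriv_right_le (f := W) (f' := W') (δ := 0) (K := 1)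
    (ε := M * ‖v‖ ^ 2) (a := 0) (b := 1) (fun t ht => (hW t ht).continuousWithinAt)
    (fun t ht => (hW t (Ico_subset_Icc_self ht)).mono_of_mem_nhdsWithin
      (Icc_mem_nhdsGE_of_mem ht)) (by simp [W, h0])
    (fun t ht => key t (Ico_subset_Icc_self ht)) 1 (by simp)
  have hW1 : W 1 = Y' 1 - Y 1 - B (x₀ + h) v (Y 1) := by simp [W, sub_sub]
  rw [← hW1]
  refine hg.trans (le_of_eq ?_)
  rw [gronwallBound_of_K_ne_0 one_ne_zero]
  simp
  ring

/-- Frobenius theorem for linear total differential equations `f' v = B v f`. -/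
theorem exists_hasFDerivAt_of_integrable [CompleteSpace F] {B : E → E →L[ℝ] F →L[ℝ] F} {x₀ : E}
    (hB : ContDiffAt ℝ 2 B x₀)
    (sym : ∀ᶠ x in 𝓝 x₀, ∀ u v y,
      fderiv ℝ B x u v y + B x v (B x u y) = fderiv ℝ B x v u y + B x u (B x v y)) :
    ∃ r > 0, ∀ y₀ : F, ∃ f : E → F, f x₀ = y₀ ∧
      ∀ x ∈ Metric.ball x₀ r, HasFDerivAt f ((B x).flip (f x)) x := by
  have hB1 : ContDiffAt ℝ 1 (fderiv ℝ B) x₀ := hB.fderiv_right (by norm_num)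
  obtain ⟨C, s, hs, hL⟩ := hB1.exists_lipschitzOnWith
  have hdiff : ∀ᶠ x in 𝓝 x₀, DifferentiableAt ℝ B x :=
    (hB.eventually (by simp)).mono fun x hx => hx.differentiableAt (by simp)
  have hKb : ∀ᶠ x in 𝓝 x₀, ‖B x‖ < ‖B x₀‖ + 1 :=
    hB.continuousAt.norm.eventually_lt continuousAt_const (by simp)
  have hK'b : ∀ᶠ x in 𝓝 x₀, ‖fderiv ℝ B x‖ < ‖fderiv ℝ B x₀‖ + 1 :=
    hB1.continuousAt.norm.eventually_lt continuousAt_const (by simp)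
  obtain ⟨R, hR, hball⟩ := Metric.eventually_nhds_iff_ball.1
    (hdiff.and (hKb.and (hK'b.and (sym.and hs))))
  set K := ‖B x₀‖ + 1
  have hK0 : 0 < K := by positivity
  -- The bound 1/(2K) makes ‖B (x₀ + t h) h‖ ≤ 1/2, as the ray equation needs for existence up to
  -- time 1.
  set r := min R (min 1 (1 / (2 * K))) with hr
  have hr0 : 0 < r := by positivity
  have hrR : Metric.ball x₀ r ⊆ Metric.ball x₀ R := Metric.ball_subset_ball (min_le_left _ _)
  have hr1 : r ≤ 1 := (min_le_right _ _).trans (min_le_left _ _)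
  have hKr : K * r ≤ 1 / 2 := by
    have : r ≤ 1 / (2 * K) := (min_le_right _ _).trans (min_le_right _ _)
    calc K * r ≤ K * (1 / (2 * K)) := by gcongr
      _ = 1 / 2 := by field_simp
  refine ⟨r, hr0, fun y₀ => ?_⟩
  have mem : ∀ (k : E), ‖k‖ < r → ∀ t ∈ Icc (0 : ℝ) 1, x₀ + t • k ∈ Metric.ball x₀ r := by
    intro k hk t ht
    simp only [mem_ball_iff_norm, add_sub_cancel_left, norm_smul, Real.norm_eq_abs,
      abs_of_nonneg ht.1]
    exact (mul_le_of_le_one_left (norm_nonneg _) ht.2).trans_lt hk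
  have hex : ∀ h : E, ∃ Y : ℝ → F, ‖h‖ < r → Y 0 = y₀ ∧ ∀ t ∈ Icc (0 : ℝ) 1,
      HasDerivWithinAt Y (B (x₀ + t • h) h (Y t)) (Icc 0 1) t := by
    intro h
    by_cases hh : ‖h‖ < r
    swap
    · exact ⟨0, fun h' => absurd h' hh⟩
    obtain ⟨Y, hY0, hY⟩ := exists_solution_linear_ode (fun t => B (x₀ + t • h) h) (fun t ht => by
        have h1 : ContinuousAt B (x₀ + t • h) :=
          (hball _ (hrR (mem h hh t ht))).1.continuousAt
        have h2 : ContinuousAt (fun t : ℝ => x₀ + t • h) t := by fun_prop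
        exact ((ContinuousAt.comp (f := fun t : ℝ => x₀ + t • h) (g := B) h1 h2).clm_apply
          continuousAt_const).continuousWithinAt) (fun t ht => by
        calc ‖B (x₀ + t • h) h‖ ≤ ‖B (x₀ + t • h)‖ * ‖h‖ := ContinuousLinearMap.le_opNorm _ _
          _ ≤ K * r := by gcongr; exact (hball _ (hrR (mem h hh t ht))).2.1.le
          _ ≤ _ := hKr) y₀
    exact ⟨Y, fun _ => ⟨hY0, hY⟩⟩
  choose Y hY using hex
  -- The candidate is the value at time 1 of the solution along the ray from x₀ to x.
  refine ⟨fun x => Y (x - x₀) 1, ?_, fun x hx => ?_⟩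
  · have h0 := hY 0 (by simpa using hr0)
    have := constant_of_has_deriv_right_zero (f := Y 0) (a := 0) (b := 1)
      (fun t ht => (h0.2 t ht).continuousWithinAt)
      (fun t ht => by
        simpa using (h0.2 t (Ico_subset_Icc_self ht)).mono_of_mem_nhdsWithin
          (Icc_mem_nhdsGE_of_mem ht)) 1 (by simp)
    simp [this, h0.1]
  · set h := x - x₀ with hh
    have hhr : ‖h‖ < r := by rwa [mem_ball_iff_norm] at hx
    obtain ⟨hY0, hYd⟩ := hY h hhr
    have hcont : ContinuousOn (Y h) (Icc 0 1) := fun t ht => (hYd t ht).continuousWithinAt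
    obtain ⟨N, hN⟩ := isCompact_Icc.exists_bound_of_continuousOn hcont
    have hN0 : 0 ≤ N := (norm_nonneg _).trans (hN 0 (by simp))
    rw [hasFDerivAt_iff_isLittleO_nhds_zero]
    refine Asymptotics.IsBigO.trans_isLittleO (g := fun v : E => ‖v‖ ^ 2) ?_ ?_
    · refine Asymptotics.IsBigO.of_bound ((K * K * N + (‖fderiv ℝ B x₀‖ + 1) * N
        + (‖fderiv ℝ B x₀‖ + 1) * K * N + C * (N + 2 * K * N)) * (Real.exp 1 - 1)) ?_
      have hev : ∀ᶠ v in 𝓝 (0 : E), ‖h + v‖ < r := by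
        refine ContinuousAt.eventually_lt (by fun_prop) continuousAt_const (by simpa using hhr)
      filter_upwards [hev] with v hv
      have hxv : x + v - x₀ = h + v := by rw [hh]; abel
      have hxh : x₀ + h = x := by rw [hh]; abel
      have := norm_ray_solution_sub_le (B := B) (x₀ := x₀) (K := K)
        (K' := ‖fderiv ℝ B x₀‖ + 1) (C := C) (N := N) hr1 hK0.le (by positivity) C.2 hN0
        (fun x hx => (hball x (hrR hx)).1) (fun x hx => (hball x (hrR hx)).2.1.le)
        (by linarith) (fun x hx => (hball x (hrR hx)).2.2.1.le)
        (fun x hx y hy => by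
          simpa [dist_eq_norm] using hL.dist_le_mul x (hball x (hrR hx)).2.2.2.2 y
            (hball y (hrR hy)).2.2.2.2)
        (fun x hx => (hball x (hrR hx)).2.2.2.1) hhr hv hYd (hY _ hv).2
        (by rw [hY0, (hY _ hv).1]) hN
      rw [hxv]
      simpa [hxh] using this
    · simpa using Asymptotics.isLittleO_norm_pow_id one_lt_two

/-- Bootstrapping: if f is of class C^n, then f' = B f is too, so f is of class C^(n+1). -/
theorem contDiffOn_of_hasFDerivAt_flip {B : E → E →L[ℝ] F →L[ℝ] F} {s : Set E} (hs : IsOpen s)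
    (hB : ContDiffOn ℝ ∞ B s) {f : E → F}
    (hf : ∀ x ∈ s, HasFDerivAt f ((B x).flip (f x)) x) : ContDiffOn ℝ ∞ f s := by
  rw [contDiffOn_infty]
  intro n
  induction n with
  | zero => exact contDiffOn_zero.2 fun x hx => (hf x hx).continuousAt.continuousWithinAt
  | succ n ih =>
    rw [show ((n + 1 : ℕ) : ℕ∞ω) = (n : ℕ∞ω) + 1 by norm_cast, contDiffOn_succ_iff_fderiv_of_isOpen hs]
    refine ⟨fun x hx => (hf x hx).differentiableAt.differentiableWithinAt, by simp, ?_⟩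
    have h1 : ContDiffOn ℝ n (fun x => (B x).flip (f x)) s := by
      refine ContDiffOn.clm_apply ?_ ih
      exact ((ContinuousLinearMap.flipₗᵢ ℝ E F F).contDiff.comp_contDiffOn
        (hB.of_le (by exact_mod_cast le_top)))
    exact h1.congr fun x hx => (hf x hx).fderiv

end TotalODE

namespace DuallyFlat

/-! ### Coordinate fields and covariant derivatives in a chart -/

section CoordFields

set_option maxSynthPendingDepth 3
set_option linter.unusedSectionVars false

variable {n : ℕ} {M : Type*} [TopologicalSpace M] [ChartedSpace (Coord n) M]
  [IsManifold (𝓡 n) ∞ M]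

/-- The frame of coordinate vector fields, as a linear map. -/
def coordFrame (e : OpenPartialHomeomorph M (Coord n)) (y : M) :
    Coord n →L[ℝ] TangentSpace (𝓡 n) y :=
  mfderiv 𝓘(ℝ, Coord n) (𝓡 n) e.symm (e y)

theorem coordField_eq (e : OpenPartialHomeomorph M (Coord n)) (v : Coord n) (y : M) :
    coordField e v y = coordFrame e y v := rfl

variable {e : OpenPartialHomeomorph M (Coord n)}

theorem contMDiffOn_coordField (he : e ∈ IsManifold.maximalAtlas (𝓡 n) ∞ M) (v : Coord n) :
    ContMDiffOn (𝓡 n) (𝓡 n).tangent ∞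
      (fun y => (⟨y, coordField e v y⟩ : TangentBundle (𝓡 n) M)) e.source := by
  have h1 : ContMDiffOn (𝓡 n).tangent (𝓡 n).tangent ∞
      (tangentMapWithin 𝓘(ℝ, Coord n) (𝓡 n) e.symm e.target)
      (TotalSpace.proj ⁻¹' e.target) :=
    (contMDiffOn_symm_of_mem_maximalAtlas he).contMDiffOn_tangentMapWithin (by simp)
      e.open_target.uniqueMDiffOn
  have h2 : ContMDiff 𝓘(ℝ, Coord n) (𝓡 n).tangent ∞
      (fun z => (⟨z, v⟩ : TangentBundle 𝓘(ℝ, Coord n) (Coord n))) :=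
    contMDiff_vectorSpace_iff_contDiff.2 contDiff_const
  have h3 := h1.comp (h2.comp_contMDiffOn (contMDiffOn_of_mem_maximalAtlas he))
    (fun y hy => e.map_source hy)
  refine h3.congr fun y hy => ?_
  simp only [Function.comp, tangentMapWithin, mfderivWithin_of_isOpen e.open_target
    (e.map_source hy)]
  apply TotalSpace.ext
  · simp [hy]
  · exact HEq.rfl

theorem mdifferentiable_of_mem_maximalAtlas (he : e ∈ IsManifold.maximalAtlas (𝓡 n) ∞ M) :
    e.MDifferentiable (𝓡 n) 𝓘(ℝ, Coord n) :=
  ⟨(contMDiffOn_of_mem_maximalAtlas he).mdifferentiableOn (by simp),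
    (contMDiffOn_symm_of_mem_maximalAtlas he).mdifferentiableOn (by simp)⟩

theorem mvfderiv_coordFrame (he : e ∈ IsManifold.maximalAtlas (𝓡 n) ∞ M) {y : M}
    (hy : y ∈ e.source) (v : Coord n) : mvfderiv (𝓡 n) e y (coordFrame e y v) = v := by
  have h := (mdifferentiable_of_mem_maximalAtlas he).comp_symm_deriv (e.map_source hy)
  have h' := DFunLike.congr_fun h v
  rw [e.left_inv hy] at h'
  exact h'

theorem coordFrame_mvfderiv (he : e ∈ IsManifold.maximalAtlas (𝓡 n) ∞ M) {y : M}
    (hy : y ∈ e.source) (v : TangentSpace (𝓡 n) y) :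
    coordFrame e y (mvfderiv (𝓡 n) e y v) = v := by
  have h := (mdifferentiable_of_mem_maximalAtlas he).symm_comp_deriv hy
  exact DFunLike.congr_fun h v

/-- Derivatives in the direction of coordinate fields are derivatives in coordinates. -/
theorem mvfderiv_coordFrame_apply {F : Type*} [NormedAddCommGroup F] [NormedSpace ℝ F]
    (he : e ∈ IsManifold.maximalAtlas (𝓡 n) ∞ M) {y : M} (hy : y ∈ e.source) {f : M → F}
    (hf : MDifferentiableAt (𝓡 n) 𝓘(ℝ, F) f y) (v : Coord n) :
    mvfderiv (𝓡 n) f y (coordFrame e y v) = fderiv ℝ (f ∘ e.symm) (e y) v := by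
  have h1 : mfderiv 𝓘(ℝ, Coord n) 𝓘(ℝ, F) (f ∘ e.symm) (e y)
      = (mfderiv (𝓡 n) 𝓘(ℝ, F) f (e.symm (e y))).comp
        (mfderiv 𝓘(ℝ, Coord n) (𝓡 n) e.symm (e y)) := by
    refine mfderiv_comp (e y) ?_ ?_
    · rwa [e.left_inv hy]
    · exact (mdifferentiable_of_mem_maximalAtlas he).mdifferentiableAt_symm (e.map_source hy)
  rw [← mfderiv_eq_fderiv, h1]
  rw [e.left_inv hy]
  rfl

theorem mvfderiv_eq_fderiv_comp_symm {F : Type*} [NormedAddCommGroup F] [NormedSpace ℝ F]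
    (he : e ∈ IsManifold.maximalAtlas (𝓡 n) ∞ M) {y : M} (hy : y ∈ e.source) {f : M → F}
    (hf : MDifferentiableAt (𝓡 n) 𝓘(ℝ, F) f y) (v : TangentSpace (𝓡 n) y) :
    mvfderiv (𝓡 n) f y v = fderiv ℝ (f ∘ e.symm) (e y) (mvfderiv (𝓡 n) e y v) := by
  rw [← mvfderiv_coordFrame_apply he hy hf, coordFrame_mvfderiv he hy]

/-- The components of a smooth vector field in a chart are smooth. -/
theorem contMDiffAt_mvfderiv_field (he : e ∈ IsManifold.maximalAtlas (𝓡 n) ∞ M) {y : M}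
    (hy : y ∈ e.source) {X : VField n M}
    (hX : ContMDiffAt (𝓡 n) (𝓡 n).tangent ∞ (fun x => (⟨x, X x⟩ : TangentBundle (𝓡 n) M)) y) :
    ContMDiffAt (𝓡 n) 𝓘(ℝ, Coord n) ∞ (fun x => mvfderiv (𝓡 n) e x (X x)) y := by
  have h1 : ContMDiffOn (𝓡 n).tangent (𝓡 n).tangent ∞
      (tangentMapWithin (𝓡 n) 𝓘(ℝ, Coord n) e e.source)
      (TotalSpace.proj ⁻¹' e.source) :=
    (contMDiffOn_of_mem_maximalAtlas he).contMDiffOn_tangentMapWithin (by simp)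
      e.open_source.uniqueMDiffOn
  have h2 := (h1.contMDiffAt (x := (⟨y, X y⟩ : TangentBundle (𝓡 n) M))
    ((e.open_source.preimage (FiberBundle.continuous_proj (Coord n)
      (TangentSpace (𝓡 n) : M → Type _))).mem_nhds hy))
  have h3 := (contMDiff_snd_tangentBundle_modelSpace (Coord n) 𝓘(ℝ, Coord n) (n := ∞)).contMDiffAt.comp
    y (h2.comp y hX)
  refine h3.congr_of_eventuallyEq ?_
  filter_upwards [e.open_source.mem_nhds hy] with x hx
  simp only [Function.comp, tangentMapWithin, mfderivWithin_of_isOpen e.open_source hx]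
  rfl

/-- Curvature and duality are hypotheses on global smooth fields, whereas coordinate fields are
local. Multiplying by a bump function bridges the two; M being Hausdorff makes the extension by zero
smooth. -/
theorem exists_smoothField_eventuallyEq [T2Space M] {U : Set M} (hU : IsOpen U) {y : M}
    (hy : y ∈ U) {σ : VField n M} (hσ : ContMDiffOn (𝓡 n) (𝓡 n).tangent ∞
      (fun x => (⟨x, σ x⟩ : TangentBundle (𝓡 n) M)) U) :
    ∃ X : VField n M, SmoothField X ∧ ∀ᶠ x in 𝓝 y, X x = σ x := by
  obtain ⟨f, -, hf⟩ := (SmoothBumpFunction.nhds_basis_tsupport (I := 𝓡 n) y).mem_iff.1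
    (hU.mem_nhds hy)
  refine ⟨(f : M → ℝ) • σ, ContMDiffOn.smul_section_of_tsupport f.contMDiff.contMDiffOn hU hf hσ,
    ?_⟩
  filter_upwards [f.eventuallyEq_one] with x hx
  simp [hx]

theorem mdifferentiableAt_coordField (he : e ∈ IsManifold.maximalAtlas (𝓡 n) ∞ M) {y : M}
    (hy : y ∈ e.source) (v : Coord n) : MDifferentiableAt (𝓡 n) (𝓡 n).tangent
      (fun y => (⟨y, coordField e v y⟩ : TangentBundle (𝓡 n) M)) y :=
  ((contMDiffOn_coordField he v).contMDiffAt (e.open_source.mem_nhds hy)).mdifferentiableAt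
    (by simp)

theorem connection_congr (D : Connection n M) {X Y : VField n M} {y : M}
    (hX : MDifferentiableAt (𝓡 n) (𝓡 n).tangent (fun x => (⟨x, X x⟩ : TangentBundle (𝓡 n) M)) y)
    (h : ∀ᶠ x in 𝓝 y, X x = Y x) : D X y = D Y y := by
  refine D.isCovariantDerivativeOnUniv.congr_of_eventuallyEq hX ?_ univ_mem h
  refine hX.congr_of_eventuallyEq ?_
  filter_upwards [h] with x hx
  rw [hx]

theorem connection_sum_smul (D : Connection n M) {ι : Type*} (s : Finset ι) {f : ι → M → ℝ}
    {σ : ι → VField n M} {y : M} (hf : ∀ i, MDifferentiableAt (𝓡 n) 𝓘(ℝ, ℝ) (f i) y)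
    (hσ : ∀ i, MDifferentiableAt (𝓡 n) (𝓡 n).tangent
      (fun x => (⟨x, σ i x⟩ : TangentBundle (𝓡 n) M)) y) :
    MDifferentiableAt (𝓡 n) (𝓡 n).tangent
      (fun x => (⟨x, (∑ i ∈ s, f i • σ i : VField n M) x⟩ : TangentBundle (𝓡 n) M)) y ∧
    D (∑ i ∈ s, f i • σ i : VField n M) y
      = ∑ i ∈ s, (f i y • D (σ i) y + (mvfderiv (𝓡 n) (f i) y).smulRight (σ i y)) := by
  classical
  induction s using Finset.induction_on with
  | empty =>
    refine ⟨mdifferentiableAt_zeroSection .., ?_⟩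
    simp
  | insert i s hi ih =>
    have h1 : MDifferentiableAt (𝓡 n) (𝓡 n).tangent
      (fun x => (⟨x, (f i • σ i : VField n M) x⟩ : TangentBundle (𝓡 n) M)) y :=
      (hf i).smul_section (hσ i)
    rw [Finset.sum_insert hi, Finset.sum_insert hi]
    refine ⟨mdifferentiableAt_add_section h1 ih.1, ?_⟩
    rw [D.isCovariantDerivativeOnUniv.add h1 ih.1, ih.2,
      D.isCovariantDerivativeOnUniv.leibniz (hσ i) (hf i)]

/-- The Christoffel symbol of a connection in a chart: `christoffel D e z w u` represents
the derivative of the coordinate field of `w` in the direction of `u`. -/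
def christoffel (D : Connection n M) (e : OpenPartialHomeomorph M (Coord n)) (z : Coord n) :
    Coord n →L[ℝ] Coord n →L[ℝ] Coord n :=
  ∑ j, (EuclideanSpace.proj j : Coord n →L[ℝ] ℝ).smulRight
    ((mvfderiv (𝓡 n) e (e.symm z)) ∘L (D (coordField e (stdVec j)) (e.symm z)) ∘L
      (coordFrame e (e.symm z)))

theorem sum_smul_stdVec (v : Coord n) : ∑ j, v j • stdVec j = v := by
  simpa [stdVec] using (EuclideanSpace.basisFun (Fin n) ℝ).sum_repr v

/-- Expand c in the standard basis and apply the Leibniz rule: differentiating the coefficients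
gives c', differentiating the basis fields gives Γ. Covariant derivatives are computed from this
formula from here on. -/
theorem connection_coordFrame (D : Connection n M)
    (he : e ∈ IsManifold.maximalAtlas (𝓡 n) ∞ M) {y : M} (hy : y ∈ e.source)
    {c : Coord n → Coord n} (hc : DifferentiableAt ℝ c (e y)) (w : TangentSpace (𝓡 n) y) :
    D (fun x => coordFrame e x (c (e x))) y w
      = coordFrame e y (fderiv ℝ c (e y) (mvfderiv (𝓡 n) e y w)
        + christoffel D e (e y) (c (e y)) (mvfderiv (𝓡 n) e y w)) := by
  have h0 : (fun x => coordFrame e x (c (e x)) : VField n M)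
      = ∑ j, (fun x => c (e x) j) • coordField e (stdVec j) := by
    funext x
    conv_lhs => rw [← sum_smul_stdVec (c (e x))]
    simp [coordField_eq]
  have hme : MDifferentiableAt (𝓡 n) 𝓘(ℝ, Coord n) e y :=
    (mdifferentiable_of_mem_maximalAtlas he).mdifferentiableAt hy
  have hcj : ∀ j, DifferentiableAt ℝ (fun z => c z j) (e y) := fun j =>
    (EuclideanSpace.proj j : Coord n →L[ℝ] ℝ).differentiableAt.comp _ hc
  have hf : ∀ j, MDifferentiableAt (𝓡 n) 𝓘(ℝ, ℝ) (fun x => c (e x) j) y := fun j =>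
    (hcj j).mdifferentiableAt.comp y hme
  have hd : ∀ j, mvfderiv (𝓡 n) (fun x => c (e x) j) y w
      = (fderiv ℝ c (e y) (mvfderiv (𝓡 n) e y w)) j := by
    intro j
    rw [mvfderiv_eq_fderiv_comp_symm he hy (hf j)]
    have h1 : (fun x => c (e x) j) ∘ e.symm =ᶠ[𝓝 (e y)] fun z => c z j := by
      filter_upwards [e.open_target.mem_nhds (e.map_source hy)] with z hz
      simp [e.right_inv hz]
    rw [h1.fderiv_eq]
    have h2 : HasFDerivAt (fun z => c z j)
        ((EuclideanSpace.proj j : Coord n →L[ℝ] ℝ) ∘L fderiv ℝ c (e y)) (e y) :=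
      (EuclideanSpace.proj j : Coord n →L[ℝ] ℝ).hasFDerivAt.comp _ hc.hasFDerivAt
    rw [h2.fderiv]
    rfl
  rw [h0, (connection_sum_smul D Finset.univ hf fun j => mdifferentiableAt_coordField he hy _).2]
  have hD : ∀ j, D (coordField e (stdVec j)) y w = coordFrame e y (mvfderiv (𝓡 n) e y
      (D (coordField e (stdVec j)) y (coordFrame e y (mvfderiv (𝓡 n) e y w)))) := by
    intro j
    rw [coordFrame_mvfderiv he hy, coordFrame_mvfderiv he hy]
  rw [map_add, sum_apply, christoffel, e.left_inv hy]
  conv_rhs => rw [← sum_smul_stdVec (fderiv ℝ c (e y) (mvfderiv (𝓡 n) e y w))]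
  simp only [add_apply, smul_apply, Finset.sum_add_distrib, sum_apply, map_sum,
    map_smul, ContinuousLinearMap.smulRight_apply, hd]
  rw [add_comm]
  congr 1
  refine Finset.sum_congr rfl fun j _ => ?_
  rw [hD j]
  rfl

theorem connection_coordField (D : Connection n M)
    (he : e ∈ IsManifold.maximalAtlas (𝓡 n) ∞ M) {y : M} (hy : y ∈ e.source) (v : Coord n)
    (w : TangentSpace (𝓡 n) y) :
    D (coordField e v) y w
      = coordFrame e y (christoffel D e (e y) v (mvfderiv (𝓡 n) e y w)) := by
  have := connection_coordFrame D he hy (c := fun _ => v) (by fun_prop) w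
  simp only [fderiv_fun_const, Pi.zero_apply, zero_apply, zero_add] at this
  exact this

end CoordFields

end DuallyFlat

namespace DuallyFlat

/-! ### Torsion, curvature and duality in terms of Christoffel symbols -/

section Christoffel

set_option maxSynthPendingDepth 3
set_option linter.unusedSectionVars false

variable {n : ℕ} {M : Type*} [TopologicalSpace M] [ChartedSpace (Coord n) M]
  [IsManifold (𝓡 n) ∞ M] {e : OpenPartialHomeomorph M (Coord n)}

theorem contDiffAt_comp_symm {F : Type*} [NormedAddCommGroup F] [NormedSpace ℝ F]
    (he : e ∈ IsManifold.maximalAtlas (𝓡 n) ∞ M) {z : Coord n} (hz : z ∈ e.target) {f : M → F}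
    (hf : ContMDiffAt (𝓡 n) 𝓘(ℝ, F) ∞ f (e.symm z)) : ContDiffAt ℝ ∞ (f ∘ e.symm) z :=
  (hf.comp z (contMDiffAt_symm_of_mem_maximalAtlas he hz)).contDiffAt

theorem contDiffOn_of_forall_stdVec {F : Type*} [NormedAddCommGroup F] [NormedSpace ℝ F]
    {s : Set (Coord n)} {A : Coord n → Coord n →L[ℝ] F}
    (h : ∀ j, ContDiffOn ℝ ∞ (fun z => A z (stdVec j)) s) : ContDiffOn ℝ ∞ A s := by
  have : A = fun z => ∑ j, (ContinuousLinearMap.smulRightL ℝ (Coord n) F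
      (EuclideanSpace.proj j : Coord n →L[ℝ] ℝ)) (A z (stdVec j)) := by
    funext z
    ext v
    conv_lhs => rw [← sum_smul_stdVec v]
    simp
  rw [this]
  exact ContDiffOn.sum fun j _ =>
    (ContinuousLinearMap.contDiff _).comp_contDiffOn (h j)

theorem contMDiffAt_connection {D : Connection n M}
    (hD : CovariantDerivative.ContMDiffCovariantDerivative D ∞) {X Y : VField n M}
    (hX : SmoothField X) (hY : SmoothField Y) :
    SmoothField (fun x => D X x (Y x)) := by
  intro y
  have h1 := (hD.contMDiff.contMDiff (σ := X) (by simpa using hX.contMDiffOn)).contMDiffAt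
    (univ_mem (f := 𝓝 y))
  exact h1.clm_bundle_apply (hY y)

theorem christoffel_stdVec (D : Connection n M) (he : e ∈ IsManifold.maximalAtlas (𝓡 n) ∞ M)
    {z : Coord n} (hz : z ∈ e.target) (v u : Coord n) :
    christoffel D e z v u
      = mvfderiv (𝓡 n) e (e.symm z) (D (coordField e v) (e.symm z) (coordField e u (e.symm z))) := by
  have h := connection_coordField D he (e.map_target hz) v (coordField e u (e.symm z))
  rw [h, mvfderiv_coordFrame he (e.map_target hz), coordField_eq,
    mvfderiv_coordFrame he (e.map_target hz), e.right_inv hz]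

/-- It suffices to treat basis vectors, whose coordinate fields agree near each point with global
smooth fields, to which smoothness of the connection applies. -/
theorem contDiffOn_christoffel [T2Space M] {D : Connection n M}
    (hD : CovariantDerivative.ContMDiffCovariantDerivative D ∞)
    (he : e ∈ IsManifold.maximalAtlas (𝓡 n) ∞ M) :
    ContDiffOn ℝ ∞ (christoffel D e) e.target := by
  refine contDiffOn_of_forall_stdVec fun i => contDiffOn_of_forall_stdVec fun j => ?_
  intro z hz
  refine ContDiffAt.contDiffWithinAt ?_
  have hy := e.map_target hz
  obtain ⟨X, hX, hXe⟩ := exists_smoothField_eventuallyEq e.open_source hy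
    (contMDiffOn_coordField he (stdVec i))
  obtain ⟨Y, hY, hYe⟩ := exists_smoothField_eventuallyEq e.open_source hy
    (contMDiffOn_coordField he (stdVec j))
  have h1 := contDiffAt_comp_symm he hz
    (contMDiffAt_mvfderiv_field he hy (contMDiffAt_connection hD hX hY (e.symm z)))
  refine h1.congr_of_eventuallyEq ?_
  have hc : ContinuousAt e.symm z := e.symm.continuousAt hz
  filter_upwards [e.open_target.mem_nhds hz, hc.eventually hXe.eventually_nhds,
    hc.eventually hYe] with w hw hXw hYw
  rw [christoffel_stdVec D he hw, Function.comp, hYw,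
    connection_congr D (mdifferentiableAt_coordField he (e.map_target hw) _)
      (hXw.mono fun _ h => h.symm)]

/-- Pulled back by `e.symm`, both fields are constant and have zero bracket; the bracket commutes
with pullback and the derivative is invertible. -/
theorem mlieBracket_coordField (he : e ∈ IsManifold.maximalAtlas (𝓡 n) ∞ M) {y : M}
    (hy : y ∈ e.source) (u v : Coord n) :
    VectorField.mlieBracket (𝓡 n) (coordField e u) (coordField e v) y = 0 := by
  have hz := e.map_source hy
  have hmd := mdifferentiable_of_mem_maximalAtlas he
  have hinv : ∀ z ∈ e.target, (mfderiv 𝓘(ℝ, Coord n) (𝓡 n) e.symm z).IsInvertible :=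
    fun z hz => ⟨hmd.symm.mfderiv hz, rfl⟩
  have hpull : ∀ v : Coord n, ∀ᶠ z in 𝓝 (e y),
      VectorField.mpullback 𝓘(ℝ, Coord n) (𝓡 n) e.symm (coordField e v) z = v := by
    intro v
    filter_upwards [e.open_target.mem_nhds hz] with z hz
    rw [VectorField.mpullback_apply]
    have : coordField e v (e.symm z) = mfderiv 𝓘(ℝ, Coord n) (𝓡 n) e.symm z v := by
      simp only [coordField]
      rw [e.right_inv hz]
    rw [this]
    exact (hinv z hz).inverse_apply_self v
  have h2 : (2 : ℕ∞ω) ≤ (∞ : ℕ∞ω) := WithTop.coe_le_coe.2 (le_top : (2 : ℕ∞) ≤ ⊤)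
  have : IsManifold (𝓡 n) (minSmoothness ℝ 2) M := by
    rw [minSmoothness_of_isRCLikeNormedField]
    exact IsManifold.of_le (n := ∞) h2
  have h := VectorField.mpullback_mlieBracket (I := 𝓘(ℝ, Coord n)) (I' := 𝓡 n) (n := ∞)
    (f := e.symm) (x₀ := e y) (V := coordField e u) (W := coordField e v)
    (mdifferentiableAt_coordField he (e.map_target hz) u)
    (mdifferentiableAt_coordField he (e.map_target hz) v)
    (contMDiffAt_symm_of_mem_maximalAtlas he hz)
    (by rwa [minSmoothness_of_isRCLikeNormedField])
  let U : ∀ x : Coord n, TangentSpace 𝓘(ℝ, Coord n) x := fun _ => u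
  let V : ∀ x : Coord n, TangentSpace 𝓘(ℝ, Coord n) x := fun _ => v
  have h0 : VectorField.mlieBracket 𝓘(ℝ, Coord n) U V (e y) = 0 := by
    rw [← VectorField.mlieBracketWithin_univ, VectorField.mlieBracketWithin_eq_lieBracketWithin]
    change VectorField.lieBracketWithin ℝ (fun _ => u) (fun _ => v) univ (e y) = 0
    simp [VectorField.lieBracketWithin]
  rw [Filter.EventuallyEq.mlieBracket_vectorField_eq (W := V) (V := U) (hpull u) (hpull v), h0,
    VectorField.mpullback_apply] at h
  have h3 := (hinv _ hz).inverse.injective (h.trans (map_zero _).symm)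
  rwa [e.left_inv hy] at h3

theorem christoffel_symm [T2Space M] {D : Connection n M} (hD : D.torsion = 0)
    (he : e ∈ IsManifold.maximalAtlas (𝓡 n) ∞ M) {z : Coord n} (hz : z ∈ e.target)
    (u v : Coord n) : christoffel D e z u v = christoffel D e z v u := by
  have hy := e.map_target hz
  have h := D.torsion_eq_zero_iff.1 hD (mdifferentiableAt_coordField he hy u)
    (mdifferentiableAt_coordField he hy v)
  rw [mlieBracket_coordField he hy, sub_eq_zero] at h
  rw [christoffel_stdVec D he hz, christoffel_stdVec D he hz, h]

/-- Coordinate fields commute, so the bracket term of the curvature drops out. The two sides are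
∇_u∇_v ∂_w and ∇_v∇_u ∂_w read in the chart. -/
theorem christoffel_curvature [T2Space M] {D : Connection n M} (hD : IsFlatTorsionFree D)
    (he : e ∈ IsManifold.maximalAtlas (𝓡 n) ∞ M) {z : Coord n} (hz : z ∈ e.target)
    (u v w : Coord n) :
    fderiv ℝ (christoffel D e) z u w v + christoffel D e z (christoffel D e z w v) u
      = fderiv ℝ (christoffel D e) z v w u + christoffel D e z (christoffel D e z w u) v := by
  have hy := e.map_target hz
  have hΓ : DifferentiableAt ℝ (christoffel D e) z :=
    ((contDiffOn_christoffel hD.smooth he).contDiffAt (e.open_target.mem_nhds hz)).differentiableAt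
      (by simp)
  have hext := fun v => exists_smoothField_eventuallyEq e.open_source hy
    (contMDiffOn_coordField he v)
  obtain ⟨X, hX, hXe⟩ := hext u
  obtain ⟨Y, hY, hYe⟩ := hext v
  obtain ⟨Z, hZ, hZe⟩ := hext w
  have key : ∀ {Y : VField n M} {v u : Coord n}, (∀ᶠ x in 𝓝 (e.symm z), Y x = coordField e v x) →
      SmoothField Y →
      D (fun y => D Z y (Y y)) (e.symm z) (coordField e u (e.symm z))
        = coordFrame e (e.symm z) (fderiv ℝ (christoffel D e) z u w v
          + christoffel D e z (christoffel D e z w v) u) := by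
    intro Y v u hYe hY
    have h1 : ∀ᶠ x in 𝓝 (e.symm z),
        D Z x (Y x) = coordFrame e x (christoffel D e (e x) w v) := by
      filter_upwards [hYe, hZe.eventually_nhds, e.open_source.mem_nhds hy] with x hYx hZx hx
      rw [hYx, connection_congr D (hZ.mdifferentiableAt (by simp)) hZx,
        connection_coordField D he hx, coordField_eq, mvfderiv_coordFrame he hx]
    have h2 : HasFDerivAt (fun z => christoffel D e z w v)
        ((fderiv ℝ (christoffel D e) z).flip w |>.flip v) z := by
      have := (hΓ.hasFDerivAt.clm_apply (hasFDerivAt_const w z)).clm_apply (hasFDerivAt_const v z)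
      refine this.congr_fderiv ?_
      ext1 u
      simp
    have hez : e (e.symm z) = z := e.right_inv hz
    rw [connection_congr D ((contMDiffAt_connection hD.smooth hZ hY).mdifferentiableAt (by simp)) h1,
      connection_coordFrame D he hy (c := fun z => christoffel D e z w v)
        (by rw [hez]; exact h2.differentiableAt), coordField_eq, mvfderiv_coordFrame he hy, hez,
      h2.fderiv]
    rfl
  have hc := congrFun (hD.curvature_eq_zero X Y Z hX hY hZ) (e.symm z)
  rw [curvature, hXe.self_of_nhds, hYe.self_of_nhds, key hYe hY, key hXe hX,
    Filter.EventuallyEq.mlieBracket_vectorField_eq hXe hYe, mlieBracket_coordField he hy, map_zero, sub_zero,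
    Pi.zero_apply, sub_eq_zero] at hc
  have := congrArg (mvfderiv (𝓡 n) e (e.symm z)) hc
  rwa [mvfderiv_coordFrame he hy, mvfderiv_coordFrame he hy] at this

/-- The matrix of the metric in a chart, as a bilinear form. -/
def coordMetric (g : Metric n M) (e : OpenPartialHomeomorph M (Coord n)) (z : Coord n) :
    Coord n →L[ℝ] Coord n →L[ℝ] ℝ :=
  let B : Coord n →L[ℝ] Coord n →L[ℝ] ℝ := g.inner (e.symm z)
  let L : Coord n →L[ℝ] Coord n := coordFrame e (e.symm z)
  B.bilinearComp L L

theorem coordMetric_apply (g : Metric n M) (e : OpenPartialHomeomorph M (Coord n)) (z u v : Coord n) :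
    coordMetric g e z u v
      = g.inner (e.symm z) (coordField e u (e.symm z)) (coordField e v (e.symm z)) := rfl

theorem coordMetric_symm (g : Metric n M) (e : OpenPartialHomeomorph M (Coord n)) (z u v : Coord n) :
    coordMetric g e z u v = coordMetric g e z v u :=
  g.symm _ _ _

theorem coordMetric_pos (g : Metric n M) (he : e ∈ IsManifold.maximalAtlas (𝓡 n) ∞ M)
    {z : Coord n} (hz : z ∈ e.target) {v : Coord n} (hv : v ≠ 0) : 0 < coordMetric g e z v v := by
  refine g.pos _ _ fun h => hv ?_
  rw [← mvfderiv_coordFrame he (e.map_target hz) v]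
  exact (congrArg (mvfderiv (𝓡 n) e (e.symm z)) h).trans (map_zero _)

theorem contMDiff_inner (g : Metric n M) {X Y : VField n M} (hX : SmoothField X)
    (hY : SmoothField Y) : ContMDiff (𝓡 n) 𝓘(ℝ, ℝ) ∞ (fun x => g.inner x (X x) (Y x)) := by
  intro y
  have h := (g.contMDiff y).clm_bundle_apply₂ (F₃ := ℝ) (E₃ := fun _ => ℝ) (hX y) (hY y)
  exact (Bundle.contMDiffAt_section (E := Bundle.Trivial M ℝ) y).1 h

theorem contDiffOn_coordMetric [T2Space M] (g : Metric n M)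
    (he : e ∈ IsManifold.maximalAtlas (𝓡 n) ∞ M) : ContDiffOn ℝ ∞ (coordMetric g e) e.target := by
  refine contDiffOn_of_forall_stdVec fun i => contDiffOn_of_forall_stdVec fun j => ?_
  intro z hz
  refine ContDiffAt.contDiffWithinAt ?_
  have hy := e.map_target hz
  obtain ⟨X, hX, hXe⟩ := exists_smoothField_eventuallyEq e.open_source hy
    (contMDiffOn_coordField he (stdVec i))
  obtain ⟨Y, hY, hYe⟩ := exists_smoothField_eventuallyEq e.open_source hy
    (contMDiffOn_coordField he (stdVec j))
  refine (contDiffAt_comp_symm he hz (contMDiff_inner g hX hY _)).congr_of_eventuallyEq ?_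
  have hc : ContinuousAt e.symm z := e.symm.continuousAt hz
  filter_upwards [hc.eventually hXe, hc.eventually hYe] with w hXw hYw
  rw [coordMetric_apply, Function.comp, hXw, hYw]

theorem fderiv_coordMetric [T2Space M] {g : Metric n M} {D Ds : Connection n M}
    (h : IsDuallyFlat g D Ds) (he : e ∈ IsManifold.maximalAtlas (𝓡 n) ∞ M) {z : Coord n}
    (hz : z ∈ e.target) (u v w : Coord n) :
    fderiv ℝ (coordMetric g e) z u v w = coordMetric g e z (christoffel D e z v u) w
      + coordMetric g e z v (christoffel Ds e z w u) := by
  have hy := e.map_target hz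
  have hez : e (e.symm z) = z := e.right_inv hz
  have hd : DifferentiableAt ℝ (coordMetric g e) z :=
    ((contDiffOn_coordMetric g he).contDiffAt (e.open_target.mem_nhds hz)).differentiableAt
      (by simp)
  obtain ⟨X, hX, hXe⟩ := exists_smoothField_eventuallyEq e.open_source hy
    (contMDiffOn_coordField he v)
  obtain ⟨Y, hY, hYe⟩ := exists_smoothField_eventuallyEq e.open_source hy
    (contMDiffOn_coordField he w)
  have h1 := h.dual X Y hX hY (e.symm z) (coordFrame e (e.symm z) u)
  rw [mvfderiv_coordFrame_apply he hy
      ((contMDiff_inner g hX hY).mdifferentiableAt (by simp)), hez,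
    connection_congr D (hX.mdifferentiableAt (by simp)) hXe,
    connection_congr Ds (hY.mdifferentiableAt (by simp)) hYe, hXe.self_of_nhds, hYe.self_of_nhds,
    connection_coordField D he hy, connection_coordField Ds he hy,
    mvfderiv_coordFrame he hy, hez] at h1
  have h2 : HasFDerivAt (fun z => coordMetric g e z v w)
      ((fderiv ℝ (coordMetric g e) z).flip v |>.flip w) z := by
    have := (hd.hasFDerivAt.clm_apply (hasFDerivAt_const v z)).clm_apply (hasFDerivAt_const w z)
    refine this.congr_fderiv ?_
    ext1 u
    simp
  have h3 : (fun x => g.inner x (X x) (Y x)) ∘ e.symm =ᶠ[𝓝 z] fun z => coordMetric g e z v w := by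
    have hc : ContinuousAt e.symm z := e.symm.continuousAt hz
    filter_upwards [hc.eventually hXe, hc.eventually hYe] with w hXw hYw
    rw [coordMetric_apply, Function.comp, hXw, hYw]
  rw [h3.fderiv_eq, h2.fderiv] at h1
  exact h1

end Christoffel

end DuallyFlat

/-! ### Smooth inverse function theorem -/

section InverseFunction

set_option maxSynthPendingDepth 3

variable {E : Type*} [NormedAddCommGroup E] [NormedSpace ℝ E] [CompleteSpace E]

/-- Inverse function theorem for smooth maps, with a smooth inverse on the whole target. -/
theorem exists_openPartialHomeomorph_of_contDiffOn {f : E → E} {U : Set E} (hU : IsOpen U)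
    (hf : ContDiffOn ℝ ∞ f U) {x : E} (hx : x ∈ U) (hi : (fderiv ℝ f x).IsInvertible) :
    ∃ h : OpenPartialHomeomorph E E, (h : E → E) = f ∧ x ∈ h.source ∧ h.source ⊆ U ∧
      ContDiffOn ℝ ∞ h.symm h.target ∧ ∀ z ∈ h.source, (fderiv ℝ f z).IsInvertible := by
  have hd : ∀ z ∈ U, ContDiffAt ℝ ∞ f z := fun z hz => hf.contDiffAt (hU.mem_nhds hz)
  have hfd : ∀ z ∈ U, HasFDerivAt f (fderiv ℝ f z) z := fun z hz =>
    ((hd z hz).differentiableAt (by simp)).hasFDerivAt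
  obtain ⟨f', hf'⟩ := hi
  let h₀ := (hd x hx).toOpenPartialHomeomorph f (f' := f') (by rw [hf']; exact hfd x hx) (by simp)
  have hx₀ : x ∈ h₀.source := (hd x hx).mem_toOpenPartialHomeomorph_source
    (by rw [hf']; exact hfd x hx) (by simp)
  have hco : ContinuousOn (fderiv ℝ f) U := hf.continuousOn_fderiv_of_isOpen hU (by simp)
  -- Invertible operators form an open set, so the source can be cut down until the derivative is
  -- invertible everywhere; the inverse is then smooth on the whole target and not only at one
  -- point.
  have hV : IsOpen (U ∩ fderiv ℝ f ⁻¹' range ((↑) : (E ≃L[ℝ] E) → E →L[ℝ] E)) :=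
    hco.isOpen_inter_preimage hU ContinuousLinearEquiv.isOpen
  refine ⟨h₀.restrOpen _ hV, rfl, ⟨hx₀, hx, f', hf'⟩, fun z hz => hz.2.1, ?_, fun z hz => hz.2.2⟩
  intro z hz
  have hz' := (h₀.restrOpen _ hV).map_target hz
  obtain ⟨f'', hf''⟩ := hz'.2.2
  refine ContDiffAt.contDiffWithinAt (OpenPartialHomeomorph.contDiffAt_symm _ hz
    (f₀' := f'') ?_ (hd _ hz'.2.1))
  rw [hf'']
  exact hfd _ hz'.2.1

end InverseFunction

/-! ### Flat coordinates from Christoffel symbols -/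

section FlatFrame

set_option maxSynthPendingDepth 3

variable {E : Type*} [NormedAddCommGroup E] [NormedSpace ℝ E] [FiniteDimensional ℝ E]

/-- Affine coordinates of a flat torsion-free connection with Christoffel symbols `Γ`. -/
theorem exists_flat_coordinates {Γ : E → E →L[ℝ] E →L[ℝ] E} {U : Set E} (hU : IsOpen U)
    (hΓ : ContDiffOn ℝ ∞ Γ U) (symm : ∀ z ∈ U, ∀ u v, Γ z u v = Γ z v u)
    (curv : ∀ z ∈ U, ∀ u v w, fderiv ℝ Γ z u w v + Γ z (Γ z w v) u
      = fderiv ℝ Γ z v w u + Γ z (Γ z w u) v) {z₀ : E} (hz₀ : z₀ ∈ U) :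
    ∃ (h : OpenPartialHomeomorph E E) (α : E → E →L[ℝ] E), z₀ ∈ h.source ∧ h.source ⊆ U ∧
      ContDiffOn ℝ ∞ h h.source ∧ ContDiffOn ℝ ∞ h.symm h.target ∧ ContDiffOn ℝ ∞ α h.source ∧
      ∀ z ∈ h.source, HasFDerivAt h (α z) z ∧ (α z).IsInvertible ∧
        ∀ u w, fderiv ℝ α z u w = α z (Γ z w u) := by
  have := FiniteDimensional.complete ℝ E
  -- The unknown is a pair (f, α) of coordinates and their differential. `L₁` encodes f' u = α u,
  -- and `Φ`, built from `L₂`, encodes α' u = α ∘ Γ(·, u). Integrability of the first component is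
  -- symmetry of Γ, that of the second is vanishing curvature.
  let L₁ : E →L[ℝ] (E × (E →L[ℝ] E)) →L[ℝ] (E × (E →L[ℝ] E)) := LinearMap.toContinuousLinearMap
    { toFun := fun u => ContinuousLinearMap.inl ℝ E (E →L[ℝ] E) ∘L
        (ContinuousLinearMap.apply ℝ E u) ∘L ContinuousLinearMap.snd ℝ E (E →L[ℝ] E)
      map_add' := fun u v => ContinuousLinearMap.ext fun p => by simp
      map_smul' := fun c u => ContinuousLinearMap.ext fun p => by simp }
  let L₂ : (E →L[ℝ] E) →L[ℝ] (E × (E →L[ℝ] E)) →L[ℝ] (E × (E →L[ℝ] E)) :=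
    LinearMap.toContinuousLinearMap
    { toFun := fun T => ContinuousLinearMap.inr ℝ E (E →L[ℝ] E) ∘L
        ((ContinuousLinearMap.compL ℝ E E E).flip T) ∘L ContinuousLinearMap.snd ℝ E (E →L[ℝ] E)
      map_add' := fun u v => ContinuousLinearMap.ext fun p => by simp
      map_smul' := fun c u => ContinuousLinearMap.ext fun p => by simp }
  have hL₁ : ∀ u p, L₁ u p = (p.2 u, 0) := fun u p => by simp [L₁]
  have hL₂ : ∀ T p, L₂ T p = (0, p.2 ∘L T) := fun T p => by simp [L₂]
  let Φ : (E →L[ℝ] E →L[ℝ] E) →L[ℝ] E →L[ℝ] (E × (E →L[ℝ] E)) →L[ℝ] (E × (E →L[ℝ] E)) :=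
    (ContinuousLinearMap.compL ℝ E (E →L[ℝ] E) ((E × (E →L[ℝ] E)) →L[ℝ] (E × (E →L[ℝ] E))) L₂) ∘L
      (ContinuousLinearMap.flipₗᵢ ℝ E E E).toContinuousLinearEquiv.toContinuousLinearMap
  have hΦ : ∀ G u p, Φ G u p = (0, p.2 ∘L G.flip u) := fun G u p => by
    simp [Φ, hL₂]
  let B : E → E →L[ℝ] (E × (E →L[ℝ] E)) →L[ℝ] (E × (E →L[ℝ] E)) := fun z => L₁ + Φ (Γ z)
  have hB : ContDiffOn ℝ ∞ B U := contDiffOn_const.add (Φ.contDiff.comp_contDiffOn hΓ)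
  have hBv : ∀ z u p, B z u p = (p.2 u, p.2 ∘L (Γ z).flip u) := fun z u p => by
    simp [B, hL₁, hΦ]
  have hΓd : ∀ z ∈ U, HasFDerivAt Γ (fderiv ℝ Γ z) z := fun z hz =>
    ((hΓ.contDiffAt (hU.mem_nhds hz)).differentiableAt (by simp)).hasFDerivAt
  have hBd : ∀ z ∈ U, fderiv ℝ B z = Φ ∘L fderiv ℝ Γ z := fun z hz =>
    ((Φ.hasFDerivAt.comp z (hΓd z hz)).const_add L₁).fderiv
  obtain ⟨r, hr, hsol⟩ := exists_hasFDerivAt_of_integrable (B := B) (x₀ := z₀)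
    ((hB.contDiffAt (hU.mem_nhds hz₀)).of_le (WithTop.coe_le_coe.2 (le_top : (2 : ℕ∞) ≤ ⊤))) (by
      filter_upwards [hU.mem_nhds hz₀] with z hz u v p
      rw [hBd z hz]
      simp only [ContinuousLinearMap.comp_apply, hΦ, hBv]
      refine Prod.ext ?_ ?_
      · simp [symm z hz u v]
      · ext w
        simp only [Prod.snd_add, add_apply, ContinuousLinearMap.comp_apply,
          ContinuousLinearMap.flip_apply, ← map_add]
        rw [curv z hz])
  -- The identity as initial differential makes the coordinates locally invertible at z₀.
  obtain ⟨f, hf0, hf⟩ := hsol (0, ContinuousLinearMap.id ℝ E)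
  have hop : IsOpen (Metric.ball z₀ r ∩ U) := Metric.isOpen_ball.inter hU
  have hz₀' : z₀ ∈ Metric.ball z₀ r ∩ U := ⟨Metric.mem_ball_self hr, hz₀⟩
  have hfs : ContDiffOn ℝ ∞ f (Metric.ball z₀ r ∩ U) :=
    contDiffOn_of_hasFDerivAt_flip hop (hB.mono inter_subset_right) fun x hx => hf x hx.1
  have h1 : ∀ z ∈ Metric.ball z₀ r ∩ U, HasFDerivAt (fun z => (f z).1) (f z).2 z := by
    intro z hz
    refine (hf z hz.1).fst.congr_fderiv ?_
    ext u
    simp [hBv]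
  have h2 : ∀ z ∈ Metric.ball z₀ r ∩ U, ∀ u w,
      fderiv ℝ (fun z => (f z).2) z u w = (f z).2 (Γ z w u) := by
    intro z hz u w
    rw [(hf z hz.1).snd.fderiv]
    simp [hBv]
  obtain ⟨h, hh, hz, hsub, hsymm, hinv⟩ := exists_openPartialHomeomorph_of_contDiffOn hop
    (f := fun z => (f z).1) hfs.fst hz₀' (by
      rw [(h1 z₀ hz₀').fderiv, hf0]
      exact ⟨ContinuousLinearEquiv.refl ℝ E, rfl⟩)
  refine ⟨h, fun z => (f z).2, hz, hsub.trans inter_subset_right, ?_, hsymm, hfs.snd.mono hsub,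
    fun z hz => ⟨?_, ?_, h2 z (hsub hz)⟩⟩
  · rw [hh]; exact hfs.fst.mono hsub
  · rw [hh]; exact h1 z (hsub hz)
  · have h3 := hinv z hz
    rwa [(h1 z (hsub hz)).fderiv] at h3

end FlatFrame

namespace DuallyFlat

/-! ### Existence of affine coordinates -/

section Affine

set_option maxSynthPendingDepth 3

variable {n : ℕ} {M : Type*} [TopologicalSpace M] [ChartedSpace (Coord n) M]
  [IsManifold (𝓡 n) ∞ M]

theorem trans_mem_maximalAtlas {e : OpenPartialHomeomorph M (Coord n)}
    (he : e ∈ IsManifold.maximalAtlas (𝓡 n) ∞ M) {h : OpenPartialHomeomorph (Coord n) (Coord n)}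
    (hh : ContDiffOn ℝ ∞ h h.source) (hs : ContDiffOn ℝ ∞ h.symm h.target) :
    e.trans h ∈ IsManifold.maximalAtlas (𝓡 n) ∞ M := by
  rw [IsManifold.mem_maximalAtlas_iff_contMDiffOn]
  constructor
  · refine hh.contMDiffOn.comp ((contMDiffOn_of_mem_maximalAtlas he).mono ?_) ?_
    · intro y hy; simp at hy; exact hy.1
    · intro y hy; simp at hy; exact hy.2
  · refine (contMDiffOn_symm_of_mem_maximalAtlas he).comp (hs.contMDiffOn.mono ?_) ?_
    · intro y hy; simp at hy; exact hy.1
    · intro y hy; simp at hy; exact hy.2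

theorem mvfderiv_trans {e : OpenPartialHomeomorph M (Coord n)}
    (he : e ∈ IsManifold.maximalAtlas (𝓡 n) ∞ M) {h : OpenPartialHomeomorph (Coord n) (Coord n)}
    {y : M} (hy : y ∈ e.source) {h' : Coord n →L[ℝ] Coord n} (hd : HasFDerivAt h h' (e y))
    (w : TangentSpace (𝓡 n) y) :
    mvfderiv (𝓡 n) (e.trans h) y w = h' (mvfderiv (𝓡 n) e y w) := by
  have hme : MDifferentiableAt (𝓡 n) 𝓘(ℝ, Coord n) e y :=
    (mdifferentiable_of_mem_maximalAtlas he).mdifferentiableAt hy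
  rw [mvfderiv_eq_fderiv_comp_symm he hy (f := e.trans h)
    (hd.differentiableAt.mdifferentiableAt.comp y hme)]
  have : (e.trans h) ∘ e.symm =ᶠ[𝓝 (e y)] h := by
    filter_upwards [e.open_target.mem_nhds (e.map_source hy)] with z hz
    simp [e.right_inv hz]
  rw [this.fderiv_eq, hd.fderiv]

/-- A chart is followed by the flat coordinates h with differential α. The new coordinate field of v
reads z ↦ α(z)⁻¹ v in the old chart, and α' = α ∘ Γ says precisely that it is parallel. -/
theorem exists_isAffineCoord [T2Space M] {D : Connection n M} (hD : IsFlatTorsionFree D) (x : M) :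
    ∃ e : OpenPartialHomeomorph M (Coord n), x ∈ e.source ∧ IsAffineCoord D e := by
  let e₀ := chartAt (Coord n) x
  have he₀ : e₀ ∈ IsManifold.maximalAtlas (𝓡 n) ∞ M := IsManifold.chart_mem_maximalAtlas x
  have hx : x ∈ e₀.source := mem_chart_source _ x
  obtain ⟨h, α, hz, hsub, hs, hsymm, hαs, hα⟩ := exists_flat_coordinates e₀.open_target
    (contDiffOn_christoffel hD.smooth he₀)
    (fun z hz => christoffel_symm hD.torsion_eq_zero he₀ hz)
    (fun z hz => christoffel_curvature hD he₀ hz) (e₀.map_source hx)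
  have he := trans_mem_maximalAtlas he₀ hs hsymm
  refine ⟨e₀.trans h, by simp [hx, hz], he, fun v y hy => ?_⟩
  have hsrc : ∀ y ∈ (e₀.trans h).source, y ∈ e₀.source ∧ e₀ y ∈ h.source := fun y hy => by
    simpa using hy
  have hcd : ∀ z ∈ h.source, DifferentiableAt ℝ (fun z => (α z).inverse v) z := by
    intro z hz
    have h1 := (hα z hz).2.1.contDiffAt_map_inverse (n := ∞)
    have h2 : ContDiffAt ℝ ∞ α z := hαs.contDiffAt (h.open_source.mem_nhds hz)
    exact ((ContDiffAt.comp z h1 h2).differentiableAt (by simp)).clm_apply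
      (differentiableAt_const v)
  have hfield : ∀ᶠ y' in 𝓝 y,
      coordField (e₀.trans h) v y' = coordFrame e₀ y' ((α (e₀ y')).inverse v) := by
    filter_upwards [(e₀.trans h).open_source.mem_nhds hy] with y' hy'
    obtain ⟨h1, h2⟩ := hsrc y' hy'
    have h3 := mvfderiv_trans he₀ h1 (hα _ h2).1 (coordField (e₀.trans h) v y')
    rw [coordField_eq, mvfderiv_coordFrame he hy'] at h3
    have h4 := congrArg (α (e₀ y')).inverse h3
    rw [(hα _ h2).2.1.inverse_apply_self] at h4
    rw [h4, coordFrame_mvfderiv he₀ h1, coordField_eq]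
  obtain ⟨hy1, hy2⟩ := hsrc y hy
  ext w
  rw [connection_congr D (mdifferentiableAt_coordField he hy v) hfield,
    connection_coordFrame D he₀ hy1 (c := fun z => (α z).inverse v) (hcd _ hy2)]
  set u := mvfderiv (𝓡 n) e₀ y w
  -- This comes from differentiating α(z) (α(z)⁻¹ v) = v, then cancelling the invertible α.
  have key : fderiv ℝ (fun z => (α z).inverse v) (e₀ y) u
      + christoffel D e₀ (e₀ y) ((α (e₀ y)).inverse v) u = 0 := by
    refine (hα _ hy2).2.1.injective ?_
    have hαd : HasFDerivAt α (fderiv ℝ α (e₀ y)) (e₀ y) :=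
      ((hαs.contDiffAt (h.open_source.mem_nhds hy2)).differentiableAt (by simp)).hasFDerivAt
    have h4 := hαd.clm_apply (hcd _ hy2).hasFDerivAt
    have h5 : (fun z => α z ((α z).inverse v)) =ᶠ[𝓝 (e₀ y)] fun _ => v := by
      filter_upwards [h.open_source.mem_nhds hy2] with z hz
      exact (hα z hz).2.1.self_apply_inverse v
    have h6 := (h4.congr_of_eventuallyEq h5.symm).unique (hasFDerivAt_const v (e₀ y))
    have h7 := DFunLike.congr_fun h6 u
    simp only [add_apply, ContinuousLinearMap.comp_apply, ContinuousLinearMap.flip_apply,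
      (hα _ hy2).2.2, zero_apply] at h7
    rw [map_add, h7, map_zero]
  rw [key, map_zero]
  rfl

end Affine

end DuallyFlat

/-! ### Convexity from a positive Hessian, and potentials of Codazzi fields -/

section Hessian

set_option maxSynthPendingDepth 3

variable {E : Type*} [NormedAddCommGroup E] [NormedSpace ℝ E]

theorem strictConvexOn_of_hessian_pos {f : E → ℝ} {P : E → E →L[ℝ] ℝ} {G : E → E →L[ℝ] E →L[ℝ] ℝ}
    {s : Set E} (hs : IsOpen s) (hc : Convex ℝ s) (hf : ∀ x ∈ s, HasFDerivAt f (P x) x)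
    (hP : ∀ x ∈ s, HasFDerivAt P (G x) x) (hG : ∀ x ∈ s, ∀ v, v ≠ 0 → 0 < G x v v) :
    StrictConvexOn ℝ s f := by
  refine ⟨hc, fun x hx y hy hxy a b ha hb hab => ?_⟩
  set d := y - x with hd
  have hd0 : d ≠ 0 := sub_ne_zero.2 hxy.symm
  let l : ℝ → E := fun t => x + t • d
  have hl : ∀ t, HasDerivAt l d t := fun t => by
    have h := ((hasDerivAt_id t).smul_const d).const_add x
    rw [one_smul] at h
    exact h
  have hls : ∀ t ∈ Icc (0 : ℝ) 1, l t ∈ s := fun t ht => by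
    have := hc.add_smul_sub_mem hx hy ht
    simpa [l, hd] using this
  have hcont : Continuous l := continuous_iff_continuousAt.2 fun t => (hl t).continuousAt
  have h1 : ∀ t, l t ∈ s → HasDerivAt (f ∘ l) (P (l t) d) t := fun t ht =>
    (hf _ ht).comp_hasDerivAt t (hl t)
  have h2 : ∀ t, l t ∈ s → HasDerivAt (fun t => P (l t) d) (G (l t) d d) t := fun t ht => by
    have h3 : HasDerivAt (P ∘ l) (G (l t) d) t := (hP _ ht).comp_hasDerivAt t (hl t)
    simpa using h3.clm_apply (hasDerivAt_const t d)
  have hsc : StrictConvexOn ℝ (Icc (0 : ℝ) 1) (f ∘ l) := by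
    refine strictConvexOn_of_deriv2_pos' (convex_Icc 0 1)
      (fun t ht => (h1 t (hls t ht)).continuousAt.continuousWithinAt) fun t ht => ?_
    have h4 : deriv (f ∘ l) =ᶠ[𝓝 t] fun t => P (l t) d := by
      filter_upwards [hcont.continuousAt.eventually (hs.mem_nhds (hls t ht))] with t' ht'
      exact (h1 t' ht').deriv
    rw [Function.iterate_succ, Function.iterate_one, Function.comp, h4.deriv_eq,
      (h2 t (hls t ht)).deriv]
    exact hG _ (hls t ht) d hd0
  have h5 := hsc.2 (x := 0) (by simp) (y := 1) (by simp) (by simp) ha hb hab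
  have e0 : l 0 = x := by simp [l]
  have e1 : l 1 = y := by simp [l, hd]
  have e2 : l (a • 0 + b • 1) = a • x + b • y := by
    have ha' : a = 1 - b := by linarith
    simp only [smul_eq_mul, mul_zero, mul_one, zero_add, l, hd, ha']
    module
  simpa only [Function.comp, e0, e1, e2] using h5

theorem StrictConvexOn.add_fderiv_lt {f : E → ℝ} {s : Set E} (hf : StrictConvexOn ℝ s f) {x y : E}
    (hx : x ∈ s) (hy : y ∈ s) (hxy : x ≠ y) {P : E →L[ℝ] ℝ} (hP : HasFDerivAt f P x) :
    f x + P (y - x) < f y := by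
  let l : ℝ → E := fun t => x + t • (y - x)
  have hl : ∀ t, HasDerivAt l (y - x) t := fun t => by
    have h := ((hasDerivAt_id t).smul_const (y - x)).const_add x
    rw [one_smul] at h
    exact h
  have e0 : l 0 = x := by simp [l]
  have e1 : l 1 = y := by simp [l]
  have hsc : StrictConvexOn ℝ (Icc (0 : ℝ) 1) (f ∘ l) := by
    refine ⟨convex_Icc 0 1, fun t ht u hu htu a b ha hb hab => ?_⟩
    have hlt : l t ∈ s := hf.1.add_smul_sub_mem hx hy ht
    have hlu : l u ∈ s := hf.1.add_smul_sub_mem hx hy hu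
    have hne : l t ≠ l u := by
      intro h
      have h' : (t - u) • (y - x) = 0 := by
        simp only [l, add_right_inj] at h
        rw [sub_smul, h, sub_self]
      rcases smul_eq_zero.1 h' with h' | h'
      · exact htu (sub_eq_zero.1 h')
      · exact hxy (sub_eq_zero.1 h').symm
    have h := hf.2 hlt hlu hne ha hb hab
    have e : l (a • t + b • u) = a • l t + b • l u := by
      have ha' : a = 1 - b := by linarith
      simp only [l, smul_eq_mul, ha']
      module
    simpa only [Function.comp, e] using h
  have hd : HasDerivAt (f ∘ l) (P (y - x)) 0 :=
    HasFDerivAt.comp_hasDerivAt 0 (by rwa [e0]) (hl 0)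
  have h := hsc.lt_slope_of_hasDerivAt (x := 0) (y := 1) (by simp) (by simp) one_pos hd
  simp only [slope_def_field, Function.comp, e0, e1, sub_zero, div_one] at h
  linarith

/-- A symmetric bilinear field with totally symmetric derivative is locally a Hessian. -/
theorem exists_potential [FiniteDimensional ℝ E] {G : E → E →L[ℝ] E →L[ℝ] ℝ} {U : Set E}
    (hU : IsOpen U) (hG : ContDiffOn ℝ ∞ G U) (symm : ∀ z ∈ U, ∀ u v, G z u v = G z v u)
    (codazzi : ∀ z ∈ U, ∀ u v w, fderiv ℝ G z u v w = fderiv ℝ G z v u w) {z₀ : E} (hz₀ : z₀ ∈ U) :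
    ∃ r > 0, Metric.ball z₀ r ⊆ U ∧ ∃ (ψ : E → ℝ) (P : E → E →L[ℝ] ℝ),
      ContDiffOn ℝ ∞ ψ (Metric.ball z₀ r) ∧ ContDiffOn ℝ ∞ P (Metric.ball z₀ r) ∧
      ∀ z ∈ Metric.ball z₀ r, HasFDerivAt ψ (P z) z ∧ HasFDerivAt P (G z) z := by
  have := FiniteDimensional.complete ℝ E
  -- The system ψ' = P, P' = G is affine in (ψ, P). An auxiliary scalar c makes it linear: ψ' = P,
  -- P' = c G, c' = 0. Integrability for ψ is the symmetry of G, for P the symmetry of its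
  -- derivative.
  let L₁ : E →L[ℝ] (ℝ × (E →L[ℝ] ℝ) × ℝ) →L[ℝ] (ℝ × (E →L[ℝ] ℝ) × ℝ) :=
    LinearMap.toContinuousLinearMap
    { toFun := fun u => ContinuousLinearMap.inl ℝ ℝ ((E →L[ℝ] ℝ) × ℝ) ∘L
        (ContinuousLinearMap.apply ℝ ℝ u) ∘L ContinuousLinearMap.fst ℝ (E →L[ℝ] ℝ) ℝ ∘L
          ContinuousLinearMap.snd ℝ ℝ ((E →L[ℝ] ℝ) × ℝ)
      map_add' := fun u v => ContinuousLinearMap.ext fun p => by simp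
      map_smul' := fun c u => ContinuousLinearMap.ext fun p => by simp }
  let L₂ : (E →L[ℝ] ℝ) →L[ℝ] (ℝ × (E →L[ℝ] ℝ) × ℝ) →L[ℝ] (ℝ × (E →L[ℝ] ℝ) × ℝ) :=
    LinearMap.toContinuousLinearMap
    { toFun := fun q => (ContinuousLinearMap.snd ℝ (E →L[ℝ] ℝ) ℝ ∘L
          ContinuousLinearMap.snd ℝ ℝ ((E →L[ℝ] ℝ) × ℝ)).smulRight (0, q, 0)
      map_add' := fun u v => ContinuousLinearMap.ext fun p => by simp
      map_smul' := fun c u => ContinuousLinearMap.ext fun p => by simp [smul_smul, mul_comm] }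
  have hL₁ : ∀ u p, L₁ u p = (p.2.1 u, 0, 0) := fun u p => by simp [L₁]; rfl
  have hL₂ : ∀ q p, L₂ q p = (0, p.2.2 • q, 0) := fun q p => by simp [L₂]
  let Φ := ContinuousLinearMap.compL ℝ E (E →L[ℝ] ℝ)
    ((ℝ × (E →L[ℝ] ℝ) × ℝ) →L[ℝ] (ℝ × (E →L[ℝ] ℝ) × ℝ)) L₂
  have hΦ : ∀ T u p, Φ T u p = (0, p.2.2 • T u, 0) := fun T u p => by simp [Φ, hL₂]
  let B : E → E →L[ℝ] (ℝ × (E →L[ℝ] ℝ) × ℝ) →L[ℝ] (ℝ × (E →L[ℝ] ℝ) × ℝ) := fun z => L₁ + Φ (G z)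
  have hB : ContDiffOn ℝ ∞ B U := contDiffOn_const.add (Φ.contDiff.comp_contDiffOn hG)
  have hBv : ∀ z u p, B z u p = (p.2.1 u, p.2.2 • G z u, 0) := fun z u p => by
    simp [B, hL₁, hΦ]
  have hBd : ∀ z ∈ U, fderiv ℝ B z = Φ ∘L fderiv ℝ G z := fun z hz =>
    ((Φ.hasFDerivAt.comp z ((hG.contDiffAt (hU.mem_nhds hz)).differentiableAt
      (by simp)).hasFDerivAt).const_add L₁).fderiv
  obtain ⟨r₁, hr₁, hsol⟩ := exists_hasFDerivAt_of_integrable (B := B) (x₀ := z₀)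
    ((hB.contDiffAt (hU.mem_nhds hz₀)).of_le (WithTop.coe_le_coe.2 (le_top : (2 : ℕ∞) ≤ ⊤))) (by
      filter_upwards [hU.mem_nhds hz₀] with z hz u v p
      rw [hBd z hz]
      simp only [ContinuousLinearMap.comp_apply, hΦ, hBv]
      have h1 : fderiv ℝ G z u v = fderiv ℝ G z v u := by ext w; exact codazzi z hz u v w
      simp [symm z hz u v, h1])
  obtain ⟨r₂, hr₂, hball⟩ := Metric.isOpen_iff.1 hU z₀ hz₀
  obtain ⟨f, hf0, hf⟩ := hsol (0, 0, 1)
  set r := min r₁ r₂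
  have hr : 0 < r := lt_min hr₁ hr₂
  have hsub : Metric.ball z₀ r ⊆ U := (Metric.ball_subset_ball (min_le_right _ _)).trans hball
  have hf' : ∀ z ∈ Metric.ball z₀ r, HasFDerivAt f ((B z).flip (f z)) z := fun z hz =>
    hf z (Metric.ball_subset_ball (min_le_left _ _) hz)
  have hfs : ContDiffOn ℝ ∞ f (Metric.ball z₀ r) :=
    contDiffOn_of_hasFDerivAt_flip Metric.isOpen_ball (hB.mono hsub) hf'
  -- The auxiliary scalar is constant and starts at 1, so the original affine system is recovered.
  have hc : ∀ z ∈ Metric.ball z₀ r, (f z).2.2 = 1 := by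
    intro z hz
    have hd : ∀ z ∈ Metric.ball z₀ r, HasFDerivAt (fun z => (f z).2.2) (0 : E →L[ℝ] ℝ) z := by
      intro z hz
      refine (hf' z hz).snd.snd.congr_fderiv ?_
      ext u
      simp [hBv]
    have := Metric.isOpen_ball.is_const_of_fderiv_eq_zero (𝕜 := ℝ)
      (convex_ball z₀ r).isPreconnected
      (fun z hz => (hd z hz).differentiableAt.differentiableWithinAt)
      (fun z hz => (hd z hz).fderiv) hz (Metric.mem_ball_self hr)
    rw [this, hf0]
  refine ⟨r, hr, hsub, fun z => (f z).1, fun z => (f z).2.1, hfs.fst, hfs.snd.fst,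
    fun z hz => ⟨?_, ?_⟩⟩
  · refine (hf' z hz).fst.congr_fderiv ?_
    ext u
    simp [hBv]
  · refine (hf' z hz).snd.fst.congr_fderiv ?_
    ext u
    simp [hBv, hc z hz]

end Hessian

/-! ### Legendre pairs on strictly convex domains -/

section Legendre

set_option maxSynthPendingDepth 3
set_option linter.unusedSectionVars false

variable {E : Type*} [NormedAddCommGroup E] [InnerProductSpace ℝ E] [FiniteDimensional ℝ E]

/-- A smooth bounded potential with gradient `N` and positive definite Hessian, on a bounded
strictly convex domain. -/
structure ConvexPotential [CompleteSpace E] (V : Set E) (ψ : E → ℝ) (N : E → E) : Prop where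
  isOpen : IsOpen V
  bounded : Bornology.IsBounded V
  convex : Convex ℝ V
  strictConvex_closure : StrictConvex ℝ (closure V)
  smooth : ContDiffOn ℝ ∞ ψ V
  smooth_gradient : ContDiffOn ℝ ∞ N V
  gradient : ∀ z ∈ V, HasGradientAt ψ (N z) z
  pos : ∀ z ∈ V, ∀ v, v ≠ 0 → 0 < inner ℝ (fderiv ℝ N z v) v
  bdd : ∃ C, ∀ z ∈ V, |ψ z| ≤ C

/-- Two convex potentials that are Legendre transforms of each other, with mutually inverse
gradient maps. -/
structure LegendrePair [CompleteSpace E] (h : OpenPartialHomeomorph E E) (ψ ψs : E → ℝ) : Prop where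
  left : ConvexPotential h.source ψ h
  right : ConvexPotential h.target ψs h.symm
  legendre : ∀ z ∈ h.source, ψ z + ψs (h z) = inner ℝ z (h z)

theorem LegendrePair.symm [CompleteSpace E] {h : OpenPartialHomeomorph E E} {ψ ψs : E → ℝ}
    (H : LegendrePair h ψ ψs) : LegendrePair h.symm ψs ψ where
  left := H.right
  right := H.left
  legendre := fun w hw => by
    have := H.legendre _ (h.map_target hw)
    rw [h.right_inv hw] at this
    rw [real_inner_comm, ← this, add_comm]

/-- If the derivative of `S` at `w₀` has a left inverse, then the squared distance from `S w` to
`S w₀` is a strictly convex function of `w` near `w₀`. -/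
theorem exists_strictConvexOn_sq_dist {S : E → E} {T : Set E} (hT : IsOpen T)
    (hS : ContDiffOn ℝ ∞ S T) {w₀ : E} (hw₀ : w₀ ∈ T) {A : E →L[ℝ] E}
    (hA : ∀ v, A (fderiv ℝ S w₀ v) = v) :
    ∃ ε > 0, Metric.ball w₀ ε ⊆ T ∧
      StrictConvexOn ℝ (Metric.ball w₀ ε) fun w => ‖S w - S w₀‖ ^ 2 := by
  set q : E → ℝ := fun w => ‖S w - S w₀‖ ^ 2 with hq
  have hqs : ContDiffOn ℝ ∞ q T := (hS.sub contDiffOn_const).norm_sq ℝ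
  have hSd : ∀ w ∈ T, HasFDerivAt S (fderiv ℝ S w) w := fun w hw =>
    ((hS.contDiffAt (hT.mem_nhds hw)).differentiableAt (by simp)).hasFDerivAt
  have hq1 : ∀ w ∈ T, ∀ v, fderiv ℝ q w v = 2 * inner ℝ (S w - S w₀) (fderiv ℝ S w v) :=
    fun w hw v => by
      have h := ((hSd w hw).sub_const (S w₀)).norm_sq
      rw [h.fderiv]
      simp [inner_sub_left]
  have hdq : ContDiffOn ℝ ∞ (fderiv ℝ q) T := hqs.fderiv_of_isOpen hT (by simp)
  have hdS : ContDiffOn ℝ ∞ (fderiv ℝ S) T := hS.fderiv_of_isOpen hT (by simp)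
  have hddq : ∀ w ∈ T, HasFDerivAt (fderiv ℝ q) (fderiv ℝ (fderiv ℝ q) w) w := fun w hw =>
    ((hdq.contDiffAt (hT.mem_nhds hw)).differentiableAt (by simp)).hasFDerivAt
  -- At w₀ the term with the second derivative of S is multiplied by S w₀ − S w₀ = 0, so only the
  -- square of the first derivative survives.
  have hq2 : ∀ v, fderiv ℝ (fderiv ℝ q) w₀ v v = 2 * ‖fderiv ℝ S w₀ v‖ ^ 2 := fun v => by
    have h1 : HasFDerivAt (fun w => fderiv ℝ q w v) ((fderiv ℝ (fderiv ℝ q) w₀).flip v) w₀ := by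
      simpa using (hddq w₀ hw₀).clm_apply (hasFDerivAt_const v w₀)
    have h2 : DifferentiableAt ℝ (fun w => fderiv ℝ S w v) w₀ :=
      ((hdS.contDiffAt (hT.mem_nhds hw₀)).differentiableAt (by simp)).clm_apply
        (differentiableAt_const v)
    have h3 := (((hSd w₀ hw₀).sub_const (S w₀)).inner ℝ h2.hasFDerivAt).const_mul 2
    have h4 := h1.congr_of_eventuallyEq (f₁ := fun w => 2 * inner ℝ (S w - S w₀) (fderiv ℝ S w v))
      (by filter_upwards [hT.mem_nhds hw₀] with w hw using (hq1 w hw v).symm)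
    have h5 := DFunLike.congr_fun (h4.unique h3) v
    simpa [fderivInnerCLM_apply, real_inner_self_eq_norm_sq] using h5
  -- The left inverse A bounds S' from below; adding 1 only keeps K positive.
  set K := ‖A‖ + 1 with hK
  have hK0 : 0 < K := by positivity
  have hlow : ∀ v, 2 / K ^ 2 * ‖v‖ ^ 2 ≤ fderiv ℝ (fderiv ℝ q) w₀ v v := fun v => by
    rw [hq2]
    have h1 : ‖v‖ ≤ K * ‖fderiv ℝ S w₀ v‖ := by
      calc ‖v‖ = ‖A (fderiv ℝ S w₀ v)‖ := by rw [hA]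
        _ ≤ ‖A‖ * ‖fderiv ℝ S w₀ v‖ := A.le_opNorm _
        _ ≤ K * ‖fderiv ℝ S w₀ v‖ := by gcongr; linarith
    have h2 : ‖v‖ ^ 2 ≤ K ^ 2 * ‖fderiv ℝ S w₀ v‖ ^ 2 := by
      rw [← mul_pow]; gcongr
    rw [div_mul_eq_mul_div, div_le_iff₀ (by positivity)]
    nlinarith
  have hcont : ContinuousAt (fderiv ℝ (fderiv ℝ q)) w₀ :=
    ((hdq.fderiv_of_isOpen (m := 0) hT (by simp)).continuousOn.continuousAt (hT.mem_nhds hw₀))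
  have hnear : ∀ᶠ w in 𝓝 w₀, w ∈ T ∧
      ‖fderiv ℝ (fderiv ℝ q) w - fderiv ℝ (fderiv ℝ q) w₀‖ < 2 / K ^ 2 := by
    refine (show ∀ᶠ w in 𝓝 w₀, w ∈ T from hT.mem_nhds hw₀).and ?_
    have := Metric.tendsto_nhds.1 hcont.tendsto (2 / K ^ 2) (by positivity)
    simpa only [dist_eq_norm] using this
  obtain ⟨ε, hε, hball⟩ := Metric.eventually_nhds_iff_ball.1 hnear
  refine ⟨ε, hε, fun w hw => (hball w hw).1, ?_⟩
  refine strictConvexOn_of_hessian_pos (P := fderiv ℝ q) (G := fderiv ℝ (fderiv ℝ q))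
    Metric.isOpen_ball (convex_ball _ _)
    (fun w hw => ((hqs.contDiffAt (hT.mem_nhds (hball w hw).1)).differentiableAt
      (by simp)).hasFDerivAt) (fun w hw => hddq w (hball w hw).1) fun w hw v hv => ?_
  have hv' : 0 < ‖v‖ ^ 2 := by positivity
  have h1 : |(fderiv ℝ (fderiv ℝ q) w - fderiv ℝ (fderiv ℝ q) w₀) v v|
      ≤ ‖fderiv ℝ (fderiv ℝ q) w - fderiv ℝ (fderiv ℝ q) w₀‖ * ‖v‖ ^ 2 := by
    have := ContinuousLinearMap.le_opNorm₂
      (fderiv ℝ (fderiv ℝ q) w - fderiv ℝ (fderiv ℝ q) w₀) v v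
    rwa [Real.norm_eq_abs, mul_assoc, ← sq] at this
  have h2 := mul_lt_mul_of_pos_right (hball w hw).2 hv'
  have h3 := (abs_le.1 h1).1
  simp only [sub_apply] at h3
  linarith [hlow v]

theorem isInvertible_of_injective {A : E →L[ℝ] E} (hA : ∀ v, A v = 0 → v = 0) : A.IsInvertible := by
  have hi : Function.Injective (A : E →ₗ[ℝ] E) :=
    LinearMap.ker_eq_bot.1 (LinearMap.ker_eq_bot'.2 hA)
  exact ⟨(LinearEquiv.ofInjectiveEndo (A : E →ₗ[ℝ] E) hi).toContinuousLinearEquiv, by ext v; rfl⟩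

/-- The Riesz isomorphism of a real inner product space, as a linear map. -/
def rieszInv [CompleteSpace E] : (E →L[ℝ] ℝ) →L[ℝ] E :=
  LinearMap.toContinuousLinearMap
    { toFun := fun p => (InnerProductSpace.toDual ℝ E).symm p
      map_add' := fun p q => map_add _ p q
      map_smul' := fun c p => by simp }

theorem inner_rieszInv [CompleteSpace E] (p : E →L[ℝ] ℝ) (v : E) : inner ℝ (rieszInv p) v = p v :=
  InnerProductSpace.toDual_symm_apply

/-- A positive definite symmetric bilinear field with totally symmetric derivative is locally the
Hessian of a potential that belongs to a Legendre pair. -/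
theorem exists_legendrePair [CompleteSpace E] {G : E → E →L[ℝ] E →L[ℝ] ℝ} {U : Set E}
    (hU : IsOpen U) (hG : ContDiffOn ℝ ∞ G U) (symm : ∀ z ∈ U, ∀ u v, G z u v = G z v u)
    (codazzi : ∀ z ∈ U, ∀ u v w, fderiv ℝ G z u v w = fderiv ℝ G z v u w)
    (pos : ∀ z ∈ U, ∀ v, v ≠ 0 → 0 < G z v v) {z₀ : E} (hz₀ : z₀ ∈ U) :
    ∃ (h : OpenPartialHomeomorph E E) (ψ ψs : E → ℝ), LegendrePair h ψ ψs ∧ z₀ ∈ h.source ∧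
      h.source ⊆ U ∧ ∀ z ∈ h.source, ∀ u v, inner ℝ (fderiv ℝ h z u) v = G z u v := by
  obtain ⟨r, hr, hrU, ψ, P, hψ, hP, hψP⟩ := exists_potential hU hG symm codazzi hz₀
  set B := Metric.ball z₀ r with hB
  set N : E → E := fun z => rieszInv (P z) with hN
  have hNs : ContDiffOn ℝ ∞ N B := rieszInv.contDiff.comp_contDiffOn hP
  have hNd : ∀ z ∈ B, HasFDerivAt N (rieszInv ∘L G z) z := fun z hz =>
    rieszInv.hasFDerivAt.comp z (hψP z hz).2
  have hNG : ∀ z ∈ B, ∀ u v, inner ℝ (fderiv ℝ N z u) v = G z u v := fun z hz u v => by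
    rw [(hNd z hz).fderiv, ContinuousLinearMap.comp_apply, inner_rieszInv]
  obtain ⟨h₀, hh₀, hz₀s, hsB, hinv, -⟩ := exists_openPartialHomeomorph_of_contDiffOn
    -- The derivative of the gradient map is injective because its associated bilinear form is
    -- positive definite.
    Metric.isOpen_ball hNs (Metric.mem_ball_self hr) (isInvertible_of_injective fun v hv => by
      by_contra hne
      have h1 := pos z₀ hz₀ v hne
      rw [← hNG z₀ (Metric.mem_ball_self hr), hv, inner_zero_left] at h1
      exact h1.false)
  have hSd : ∀ w ∈ h₀.target, HasFDerivAt h₀.symm (fderiv ℝ h₀.symm w) w := fun w hw =>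
    ((hinv.contDiffAt (h₀.open_target.mem_nhds hw)).differentiableAt (by simp)).hasFDerivAt
  have hAS : ∀ w ∈ h₀.target, ∀ v, fderiv ℝ N (h₀.symm w) (fderiv ℝ h₀.symm w v) = v :=
    fun w hw v => by
      have h1 := ((hNd _ (hsB (h₀.map_target hw))).differentiableAt.hasFDerivAt).comp w (hSd w hw)
      have h2 := (hasFDerivAt_id (𝕜 := ℝ) w).congr_of_eventuallyEq (f₁ := N ∘ h₀.symm) (by
        filter_upwards [h₀.open_target.mem_nhds hw] with w' hw'
        rw [← hh₀]
        exact h₀.right_inv hw')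
      exact DFunLike.congr_fun (h1.unique h2) v
  set w₀ := h₀ z₀ with hw₀
  have hw₀t : w₀ ∈ h₀.target := h₀.map_source hz₀s
  have hSw₀ : h₀.symm w₀ = z₀ := h₀.left_inv hz₀s
  obtain ⟨ε, hε, hεT, hq⟩ := exists_strictConvexOn_sq_dist h₀.open_target hinv hw₀t (hAS w₀ hw₀t)
  rw [hSw₀] at hq
  -- The closed ball must lie in the source and map into the region where the squared distance is
  -- strictly convex: the compact image then controls the closure of the target.
  obtain ⟨ρ, hρ, hρs⟩ := Metric.nhds_basis_closedBall.mem_iff.1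
    (Filter.inter_mem (h₀.open_source.mem_nhds hz₀s)
      ((h₀.continuousAt hz₀s).preimage_mem_nhds (Metric.ball_mem_nhds w₀ hε)))
  have hbs : Metric.ball z₀ ρ ⊆ h₀.source := fun z hz => (hρs (Metric.ball_subset_closedBall hz)).1
  set h := h₀.restrOpen (Metric.ball z₀ ρ) Metric.isOpen_ball with hh
  have hsrc : h.source = Metric.ball z₀ ρ := by
    rw [hh, OpenPartialHomeomorph.restrOpen_source, inter_eq_right.2 hbs]
  have hhN : (h : E → E) = N := by rw [← hh₀]; rfl
  have hhs : (h.symm : E → E) = h₀.symm := rfl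
  -- The image of the ball is a strict sublevel set of a strictly convex function, hence convex.
  have htgt : h.target = {w ∈ Metric.ball w₀ ε | ‖h₀.symm w - z₀‖ ^ 2 < ρ ^ 2} := by
    have h1 : h.target = h₀.target ∩ h₀.symm ⁻¹' Metric.ball z₀ ρ := rfl
    rw [h1]
    ext w
    simp only [mem_inter_iff, mem_preimage, mem_ball_iff_norm (a := z₀), mem_ofPred_eq]
    rw [pow_lt_pow_iff_left₀ (norm_nonneg _) hρ.le two_ne_zero]
    refine and_congr_left fun hw => ⟨fun ht => ?_, fun ht => hεT ht⟩
    have h2 := (hρs (Metric.ball_subset_closedBall (mem_ball_iff_norm.2 hw))).2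
    rwa [mem_preimage, h₀.right_inv ht] at h2
  have hsB' : h.source ⊆ B := hsrc ▸ hbs.trans hsB
  have htT : h.target ⊆ h₀.target := by
    rw [htgt]; exact fun w hw => hεT hw.1
  have hgrad : ∀ z ∈ h.source, HasGradientAt ψ (h z) z := fun z hz => by
    rw [hhN, hasGradientAt_iff_hasFDerivAt]
    refine (hψP z (hsB' hz)).1.congr_fderiv ?_
    ext v
    rw [InnerProductSpace.toDual_apply_apply, inner_rieszInv]
  have hψb : ∃ C, ∀ z ∈ h.source, |ψ z| ≤ C := by
    obtain ⟨C, hC⟩ := (isCompact_closedBall z₀ ρ).exists_bound_of_continuousOn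
      (hψ.continuousOn.mono fun z hz => hsB (hρs hz).1)
    refine ⟨C, fun z hz => hC z ?_⟩
    rw [hsrc] at hz
    exact Metric.ball_subset_closedBall hz
  obtain ⟨C, hC⟩ := hψb
  have hsmooth : ContDiffOn ℝ ∞ h.symm h.target := hinv.mono htT
  -- The second potential is the Legendre transform written through the inverse gradient map.
  refine ⟨h, ψ, fun w => inner ℝ (h.symm w) w - ψ (h.symm w), ⟨?_, ?_, fun z hz => ?_⟩, ?_, ?_, ?_⟩
  · refine ⟨h.open_source, ?_, ?_, ?_, hψ.mono hsB', hhN ▸ hNs.mono hsB', hgrad, fun z hz v hv => ?_,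
      C, hC⟩
    · rw [hsrc]; exact Metric.isBounded_ball
    · rw [hsrc]; exact convex_ball _ _
    · rw [hsrc, closure_ball _ hρ.ne']; exact strictConvex_closedBall ℝ _ _
    · rw [hhN, hNG z (hsB' hz)]
      exact pos z (hrU (hsB' hz)) v hv
  · refine ⟨h.open_target, ?_, ?_, ?_, ?_, hsmooth, fun w hw => ?_, fun w hw v hv => ?_, ?_⟩
    · rw [htgt]; exact Metric.isBounded_ball.subset fun w hw => hw.1
    · rw [htgt]; exact hq.convexOn.convex_lt _
    · have hcl : closure h.target ⊆ {w ∈ Metric.ball w₀ ε | ‖h₀.symm w - z₀‖ ^ 2 ≤ ρ ^ 2} := by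
        have hK : IsClosed (h₀ '' Metric.closedBall z₀ ρ) :=
          ((isCompact_closedBall z₀ ρ).image_of_continuousOn
            (h₀.continuousOn.mono fun z hz => (hρs hz).1)).isClosed
        have h1 : h.target ⊆ h₀ '' Metric.closedBall z₀ ρ := fun w hw =>
          ⟨h.symm w, Metric.ball_subset_closedBall (hsrc ▸ h.map_target hw), h.right_inv hw⟩
        refine (closure_minimal h1 hK).trans ?_
        rintro _ ⟨z, hz, rfl⟩
        refine ⟨(hρs hz).2, ?_⟩
        rw [h₀.left_inv (hρs hz).1]
        exact pow_le_pow_left₀ (norm_nonneg _) (mem_closedBall_iff_norm.1 hz) 2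
      intro x hx y hy hxy a b ha hb hab
      refine interior_mono subset_closure ?_
      rw [h.open_target.interior_eq, htgt]
      refine ⟨convex_ball _ _ (hcl hx).1 (hcl hy).1 ha.le hb.le hab, ?_⟩
      have h1 := hq.2 (hcl hx).1 (hcl hy).1 hxy ha hb hab
      have h2 := mul_le_mul_of_nonneg_left (hcl hx).2 ha.le
      have h3 := mul_le_mul_of_nonneg_left (hcl hy).2 hb.le
      simp only [smul_eq_mul] at h1
      have h4 : a * ρ ^ 2 + b * ρ ^ 2 = ρ ^ 2 := by rw [← add_mul, hab, one_mul]
      exact h1.trans_le (by linarith)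
    · exact (hsmooth.inner ℝ contDiffOn_id).sub
        ((hψ.mono hsB').comp hsmooth fun w hw => h.map_target hw)
    · have h1 := ((hSd w (htT hw)).inner ℝ (hasFDerivAt_id w)).sub
        ((hasGradientAt_iff_hasFDerivAt.1 (hgrad _ (h.map_target hw))).comp w (hSd w (htT hw)))
      rw [hasGradientAt_iff_hasFDerivAt]
      refine h1.congr_fderiv ?_
      ext v
      have h2 : h (h₀.symm w) = w := h.right_inv hw
      simp [fderivInnerCLM_apply, hhs, h2, real_inner_comm]
    · have h1 := hAS w (htT hw) v
      set u := fderiv ℝ h₀.symm w v with hu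
      have hu0 : u ≠ 0 := fun h0 => hv (by rw [← h1, h0, map_zero])
      have hm := hsB (h₀.map_target (htT hw))
      have h2 := pos _ (hrU hm) u hu0
      rw [← hNG _ hm, h1, real_inner_comm] at h2
      exact h2
    · obtain ⟨R, hR⟩ := (Metric.isBounded_ball (x := z₀) (r := ρ)).exists_norm_le
      obtain ⟨R', hR'⟩ := (Metric.isBounded_ball (x := w₀) (r := ε)).exists_norm_le
      refine ⟨R * R' + C, fun w hw => ?_⟩
      have hz : h.symm w ∈ h.source := h.map_target hw
      have h1 := hR _ (hsrc ▸ hz)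
      have h2 : ‖w‖ ≤ R' := hR' _ (by rw [htgt] at hw; exact hw.1)
      calc |inner ℝ (h.symm w) w - ψ (h.symm w)| ≤ |inner ℝ (h.symm w) w| + |ψ (h.symm w)| :=
            abs_sub _ _
        _ ≤ ‖h.symm w‖ * ‖w‖ + C := add_le_add (abs_real_inner_le_norm _ _) (hC _ hz)
        _ ≤ R * R' + C := by
          gcongr
          exact (norm_nonneg _).trans h1
  · simp only [h.left_inv hz]
    ring
  · rw [hsrc]; exact Metric.mem_ball_self hρ
  · exact hsB'.trans hrU
  · intro z hz
    rw [hhN]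
    exact hNG z (hsB' hz)

end Legendre

/-! ### Fenchel–Young inequality and inverse Hessians -/

section LegendreConsequences

set_option maxSynthPendingDepth 3
set_option linter.unusedSectionVars false

variable {E : Type*} [NormedAddCommGroup E] [InnerProductSpace ℝ E] [FiniteDimensional ℝ E]
  [CompleteSpace E]

/-- The inner product of a real inner product space, as a bilinear map. -/
def rieszMap : E →L[ℝ] E →L[ℝ] ℝ :=
  LinearMap.toContinuousLinearMap
    { toFun := fun x => innerSL ℝ x
      map_add' := fun p q => map_add _ p q
      map_smul' := fun c p => by ext; simp }

theorem rieszMap_apply (x v : E) : rieszMap x v = inner ℝ x v := rfl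

namespace ConvexPotential

variable {V : Set E} {ψ : E → ℝ} {N : E → E}

theorem hasFDerivAt (H : ConvexPotential V ψ N) {z : E} (hz : z ∈ V) :
    HasFDerivAt ψ (rieszMap (N z)) z :=
  (hasGradientAt_iff_hasFDerivAt.1 (H.gradient z hz)).congr_fderiv (by
    ext v; rw [InnerProductSpace.toDual_apply_apply, rieszMap_apply])

theorem hasFDerivAt_gradient (H : ConvexPotential V ψ N) {z : E} (hz : z ∈ V) :
    HasFDerivAt N (fderiv ℝ N z) z :=
  ((H.smooth_gradient.contDiffAt (H.isOpen.mem_nhds hz)).differentiableAt (by simp)).hasFDerivAt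

theorem hasFDerivAt_rieszMap (H : ConvexPotential V ψ N) {z : E} (hz : z ∈ V) :
    HasFDerivAt (fun z => rieszMap (N z)) (rieszMap ∘L fderiv ℝ N z) z :=
  (rieszMap (E := E)).hasFDerivAt.comp z (H.hasFDerivAt_gradient hz)

theorem fderiv_fderiv (H : ConvexPotential V ψ N) {z : E} (hz : z ∈ V) (u v : E) :
    fderiv ℝ (fderiv ℝ ψ) z u v = inner ℝ (fderiv ℝ N z u) v := by
  have h1 : fderiv ℝ ψ =ᶠ[𝓝 z] fun z => rieszMap (N z) := by
    filter_upwards [H.isOpen.mem_nhds hz] with y hy using (H.hasFDerivAt hy).fderiv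
  rw [h1.fderiv_eq, (H.hasFDerivAt_rieszMap hz).fderiv]
  rfl

theorem inner_fderiv_symm (H : ConvexPotential V ψ N) {z : E} (hz : z ∈ V) (u v : E) :
    inner ℝ (fderiv ℝ N z u) v = inner ℝ (fderiv ℝ N z v) u := by
  rw [← H.fderiv_fderiv hz, ← H.fderiv_fderiv hz]
  exact ((H.smooth.contDiffAt (H.isOpen.mem_nhds hz)).isSymmSndFDerivAt (by
    rw [minSmoothness_of_isRCLikeNormedField]
    exact WithTop.coe_le_coe.2 (le_top : (2 : ℕ∞) ≤ ⊤))).eq u v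

theorem strictConvexOn (H : ConvexPotential V ψ N) : StrictConvexOn ℝ V ψ :=
  strictConvexOn_of_hessian_pos H.isOpen H.convex (fun _ hz => H.hasFDerivAt hz)
    (fun _ hz => H.hasFDerivAt_rieszMap hz) fun z hz v hv => H.pos z hz v hv

theorem add_inner_lt (H : ConvexPotential V ψ N) {x y : E} (hx : x ∈ V) (hy : y ∈ V)
    (hxy : x ≠ y) : ψ x + inner ℝ (N x) (y - x) < ψ y :=
  H.strictConvexOn.add_fderiv_lt hx hy hxy (H.hasFDerivAt hx)

end ConvexPotential

namespace LegendrePair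

variable {h : OpenPartialHomeomorph E E} {ψ ψs : E → ℝ}

/-- The Legendre identity at z' turns this into the strict first-order convexity inequality for ψ at
z'. -/
theorem sub_pos_of_ne (H : LegendrePair h ψ ψs) {z z' : E} (hz : z ∈ h.source) (hz' : z' ∈ h.source)
    (hne : z ≠ z') : 0 < ψ z + ψs (h z') - inner ℝ z (h z') := by
  have h1 := H.legendre z' hz'
  have h2 := H.left.add_inner_lt hz' hz hne.symm
  rw [inner_sub_right, real_inner_comm, real_inner_comm z'] at h2
  linarith

/-- Every w in the target is the gradient of ψ at some point of the source, so Fenchel–Young is the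
gradient inequality at that point. -/
theorem inner_le (H : LegendrePair h ψ ψs) {z w : E} (hz : z ∈ h.source) (hw : w ∈ h.target) :
    inner ℝ z w ≤ ψ z + ψs w := by
  rcases eq_or_ne z (h.symm w) with rfl | hne
  · have := H.legendre _ (h.map_target hw)
    rw [h.right_inv hw] at this
    exact this.ge
  · have := H.sub_pos_of_ne hz (h.map_target hw) hne
    rw [h.right_inv hw] at this
    linarith

theorem fderiv_symm_fderiv (H : LegendrePair h ψ ψs) {z : E} (hz : z ∈ h.source) (v : E) :
    fderiv ℝ h.symm (h z) (fderiv ℝ h z v) = v := by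
  have h1 := (H.right.hasFDerivAt_gradient (h.map_source hz)).comp z (H.left.hasFDerivAt_gradient hz)
  have h2 := (hasFDerivAt_id (𝕜 := ℝ) z).congr_of_eventuallyEq (f₁ := h.symm ∘ h) (by
    filter_upwards [h.open_source.mem_nhds hz] with y hy using h.left_inv hy)
  exact DFunLike.congr_fun (h1.unique h2) v

theorem fderiv_fderiv_symm (H : LegendrePair h ψ ψs) {z : E} (hz : z ∈ h.source) (v : E) :
    fderiv ℝ h z (fderiv ℝ h.symm (h z) v) = v := by
  have := H.symm.fderiv_symm_fderiv (h.map_source hz) v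
  rwa [OpenPartialHomeomorph.symm_symm, h.left_inv hz] at this

end LegendrePair

end LegendreConsequences

namespace DuallyFlat

set_option maxSynthPendingDepth 3
set_option linter.unusedSectionVars false

/-! ### The Monge–Ampère operator as a Jacobian determinant -/

section PotentialHessian

variable {n : ℕ} {V : Set (Coord n)} {ψ : Coord n → ℝ} {N : Coord n → Coord n}

theorem hessian_apply (H : ConvexPotential V ψ N) {z : Coord n} (hz : z ∈ V) (i j : Fin n) :
    hessian ψ z i j = inner ℝ (fderiv ℝ N z (stdVec i)) (stdVec j) :=
  H.fderiv_fderiv hz _ _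

theorem inner_stdVec (v : Coord n) (i : Fin n) : inner ℝ v (stdVec i) = v i := by
  rw [stdVec, real_inner_comm, EuclideanSpace.inner_single_left]
  simp

/-- By definition the Hessian is the transpose of the matrix of N'; symmetry of second derivatives
removes the transpose. -/
theorem hessian_eq_toMatrix (H : ConvexPotential V ψ N) {z : Coord n} (hz : z ∈ V) :
    hessian ψ z = LinearMap.toMatrix (EuclideanSpace.basisFun (Fin n) ℝ).toBasis
      (EuclideanSpace.basisFun (Fin n) ℝ).toBasis (fderiv ℝ N z : Coord n →ₗ[ℝ] Coord n) := by
  ext i j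
  rw [hessian_apply H hz, H.inner_fderiv_symm hz, inner_stdVec, LinearMap.toMatrix_apply]
  simp [stdVec]

theorem mongeAmpere_eq_det (H : ConvexPotential V ψ N) {z : Coord n} (hz : z ∈ V) :
    mongeAmpere ψ z = (fderiv ℝ N z).det := by
  rw [mongeAmpere, hessian_eq_toMatrix H hz, LinearMap.det_toMatrix]

theorem posDef_of_bilinear {A : Matrix (Fin n) (Fin n) ℝ} {B : Coord n →L[ℝ] Coord n →L[ℝ] ℝ}
    (hA : ∀ i j, A i j = B (stdVec i) (stdVec j)) (symm : ∀ u v, B u v = B v u)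
    (pos : ∀ v, v ≠ 0 → 0 < B v v) : A.PosDef := by
  refine Matrix.PosDef.of_dotProduct_mulVec_pos ?_ fun x hx => ?_
  · ext i j
    simp [hA, symm (stdVec j)]
  · have h1 := pos (WithLp.toLp 2 x) (by simpa using hx)
    have h2 : (WithLp.toLp 2 x : Coord n) = ∑ i, x i • stdVec i :=
      (sum_smul_stdVec (WithLp.toLp 2 x)).symm
    rw [h2] at h1
    simp only [map_sum, map_smul, sum_apply, smul_apply, smul_eq_mul] at h1
    refine h1.trans_eq ?_
    simp only [dotProduct, Matrix.mulVec, hA, Finset.mul_sum, star_trivial]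
    rw [Finset.sum_comm]
    exact Finset.sum_congr rfl fun i _ => Finset.sum_congr rfl fun j _ => by ring

theorem mongeAmpere_pos (H : ConvexPotential V ψ N) {z : Coord n} (hz : z ∈ V) :
    0 < mongeAmpere ψ z :=
  (posDef_of_bilinear (B := rieszMap ∘L fderiv ℝ N z) (fun i j => hessian_apply H hz i j)
    (fun u v => H.inner_fderiv_symm hz u v) (fun v hv => H.pos z hz v hv)).det_pos

theorem solvesMongeAmpere (H : ConvexPotential V ψ N) {f : Coord n → ℝ}
    (hf : ∀ z ∈ V, mongeAmpere ψ z = f z) : SolvesMongeAmpere V ψ f where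
  isOpen := H.isOpen
  bounded := H.bounded
  convex := H.convex
  strictConvex_closure := H.strictConvex_closure
  smooth := H.smooth
  strictConvexOn := H.strictConvexOn
  pos := fun z hz => hf z hz ▸ mongeAmpere_pos H hz
  equation := hf

end PotentialHessian

/-! ### Optimality of the gradient maps -/

section Transport

variable {n : ℕ} {h : OpenPartialHomeomorph (Coord n) (Coord n)} {ψ ψs : Coord n → ℝ}

/-- The two Hessians are the Jacobian matrices of mutually inverse maps. -/
theorem hessian_star_eq_inv (H : LegendrePair h ψ ψs) {z : Coord n} (hz : z ∈ h.source) :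
    hessian ψs (h z) = (hessian ψ z)⁻¹ := by
  refine (Matrix.inv_eq_left_inv ?_).symm
  rw [hessian_eq_toMatrix H.left hz, hessian_eq_toMatrix H.right (h.map_source hz),
    ← LinearMap.toMatrix_comp,
    ← LinearMap.toMatrix_id (EuclideanSpace.basisFun (Fin n) ℝ).toBasis]
  congr 1
  ext1 v
  exact H.fderiv_symm_fderiv hz v

/-- The measure that the gradient map transports Lebesgue measure to. -/
def transportTarget (V : Set (Coord n)) (φ : Coord n → ℝ) : Measure (Coord n) :=
  (volume.restrict V).withDensity fun z => ENNReal.ofReal (mongeAmpere φ z)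

theorem transportTarget_absolutelyContinuous (V : Set (Coord n)) (φ : Coord n → ℝ) :
    transportTarget V φ ≪ volume.restrict V := withDensity_absolutelyContinuous _ _

theorem ae_mem_transportTarget {V : Set (Coord n)} (hV : IsOpen V) (φ : Coord n → ℝ) :
    ∀ᵐ y ∂(transportTarget V φ), y ∈ V :=
  (transportTarget_absolutelyContinuous V φ).ae_le (ae_restrict_mem hV.measurableSet)

/-- Change of variables for `h.symm`: its Jacobian determinant is the Monge–Ampère density of ψ*,
and positivity removes the absolute value. -/
theorem map_symm_transportTarget (H : LegendrePair h ψ ψs) :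
    (transportTarget h.target ψs).map h.symm = volume.restrict h.source := by
  have h1 := map_withDensity_abs_det_fderiv_eq_addHaar (μ := (volume : Measure (Coord n)))
    (f := h.symm) (f' := fderiv ℝ h.symm) h.open_target.measurableSet.nullMeasurableSet
    (fun w hw => (H.right.hasFDerivAt_gradient hw).hasFDerivWithinAt) h.symm.injOn
  rw [h.symm_image_target_eq_source] at h1
  rw [← h1, transportTarget]
  congr 1
  refine withDensity_congr_ae ?_
  filter_upwards [ae_restrict_mem h.open_target.measurableSet] with w hw
  rw [← mongeAmpere_eq_det H.right hw, abs_of_pos (mongeAmpere_pos H.right hw)]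

/-- Lebesgue measure on the source is the image of the target measure under `h.symm`, so pushing it
by `h` gives the target measure back. -/
theorem map_transportTarget (H : LegendrePair h ψ ψs) :
    (volume.restrict h.source).map h = transportTarget h.target ψs := by
  have ha : AEMeasurable h (volume.restrict h.source) :=
    h.continuousOn.aemeasurable h.open_source.measurableSet
  have hb : AEMeasurable h.symm (transportTarget h.target ψs) :=
    (h.continuousOn_symm.aemeasurable h.open_target.measurableSet).mono_ac
      (transportTarget_absolutelyContinuous _ _)
  rw [← map_symm_transportTarget H] at ha ⊢
  rw [AEMeasurable.map_map_of_aemeasurable ha hb]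
  conv_rhs => rw [← Measure.map_id (μ := transportTarget h.target ψs)]
  refine Measure.map_congr ?_
  filter_upwards [ae_mem_transportTarget h.open_target ψs] with w hw using h.right_inv hw

/-- Kantorovich duality: with a(x) = |x|² − 2ψ(x) and b(y) = |y|² − 2ψ*(y), Fenchel–Young reads |x −
y|² ≥ a(x) + b(y), with equality for y = h(x). The integral of a + b ∘ S depends only on the two
marginals, so it is the same for every transport map S. -/
theorem isOptimalTransport_gradient (H : LegendrePair h ψ ψs) :
    IsOptimalTransport (volume.restrict h.source) (transportTarget h.target ψs) (gradient ψ) := by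
  set μ := (volume : Measure (Coord n)).restrict h.source with hμ
  have hgrad : gradient ψ =ᵐ[μ] h := by
    filter_upwards [ae_restrict_mem h.open_source.measurableSet] with z hz
    exact (H.left.gradient z hz).gradient
  have ha : AEMeasurable h μ := h.continuousOn.aemeasurable h.open_source.measurableSet
  have hfin : IsFiniteMeasure μ := ⟨by
    rw [hμ, Measure.restrict_apply_univ]; exact H.left.bounded.measure_lt_top⟩
  have hmap : μ.map (gradient ψ) = transportTarget h.target ψs :=
    (Measure.map_congr hgrad).trans (map_transportTarget H)
  have hfin' : IsFiniteMeasure (transportTarget h.target ψs) := by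
    rw [← hmap]; infer_instance
  have hmem : ∀ᵐ z ∂μ, z ∈ h.source := ae_restrict_mem h.open_source.measurableSet
  obtain ⟨C, hC⟩ := H.left.bdd
  obtain ⟨Cs, hCs⟩ := H.right.bdd
  obtain ⟨R, hR⟩ := H.left.bounded.exists_norm_le
  obtain ⟨Rs, hRs⟩ := H.right.bounded.exists_norm_le
  set a : Coord n → ℝ := fun z => ‖z‖ ^ 2 - 2 * ψ z with ha_def
  set b : Coord n → ℝ := fun w => ‖w‖ ^ 2 - 2 * ψs w with hb_def
  have hai : Integrable a μ := by
    refine Integrable.of_bound (C := R ^ 2 + 2 * C) (ContinuousOn.aestronglyMeasurable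
      ((continuous_norm.pow 2).continuousOn.sub
        (continuousOn_const.mul H.left.smooth.continuousOn)) h.open_source.measurableSet) ?_
    filter_upwards [hmem] with z hz
    have h1 : ‖z‖ ^ 2 ≤ R ^ 2 := pow_le_pow_left₀ (norm_nonneg _) (hR z hz) 2
    have h2 := abs_le.1 (hC z hz)
    rw [Real.norm_eq_abs, abs_le]
    constructor <;> nlinarith [sq_nonneg ‖z‖]
  have hbi : Integrable b (transportTarget h.target ψs) := by
    refine Integrable.of_bound (C := Rs ^ 2 + 2 * Cs) ((ContinuousOn.aestronglyMeasurable
      ((continuous_norm.pow 2).continuousOn.sub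
        (continuousOn_const.mul H.right.smooth.continuousOn))
          h.open_target.measurableSet).mono_ac (transportTarget_absolutelyContinuous _ _)) ?_
    filter_upwards [ae_mem_transportTarget h.open_target ψs] with z hz
    have h1 : ‖z‖ ^ 2 ≤ Rs ^ 2 := pow_le_pow_left₀ (norm_nonneg _) (hRs z hz) 2
    have h2 := abs_le.1 (hCs z hz)
    rw [Real.norm_eq_abs, abs_le]
    constructor <;> nlinarith [sq_nonneg ‖z‖]
  have hcost : ∀ S : Coord n → Coord n, AEMeasurable S μ → μ.map S = transportTarget h.target ψs →
      (∀ᵐ z ∂μ, S z ∈ h.target) ∧ Integrable (fun z => ‖z - S z‖ ^ 2) μ ∧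
      Integrable (fun z => a z + b (S z)) μ ∧
      ∫ z, (a z + b (S z)) ∂μ = ∫ z, a z ∂μ + ∫ w, b w ∂(transportTarget h.target ψs) := by
    intro S hS hSm
    have h1 : ∀ᵐ z ∂μ, S z ∈ h.target := by
      refine ae_of_ae_map hS ?_
      rw [hSm]
      exact ae_mem_transportTarget h.open_target ψs
    have h2 : Integrable (fun z => b (S z)) μ :=
      (show Integrable b (μ.map S) by rwa [hSm]).comp_aemeasurable hS
    refine ⟨h1, ?_, hai.add h2, ?_⟩
    · refine Integrable.of_bound (C := (R + Rs) ^ 2)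
        (((aemeasurable_id.sub hS).norm.pow_const 2).aestronglyMeasurable) ?_
      filter_upwards [hmem, h1] with z hz hz'
      rw [Real.norm_eq_abs, abs_of_nonneg (by positivity)]
      exact pow_le_pow_left₀ (norm_nonneg _)
        ((norm_sub_le _ _).trans (add_le_add (hR z hz) (hRs _ hz'))) 2
    · rw [integral_add hai h2, ← hSm, integral_map hS (hSm ▸ hbi.aestronglyMeasurable)]
  -- The cost is an extended nonnegative integral; on bounded domains it is finite and may be
  -- compared as a real integral.
  have hlint : ∀ S : Coord n → Coord n, Integrable (fun z => ‖z - S z‖ ^ 2) μ →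
      ∫⁻ z, ‖z - S z‖ₑ ^ 2 ∂μ = ENNReal.ofReal (∫ z, ‖z - S z‖ ^ 2 ∂μ) := by
    intro S hS
    rw [ofReal_integral_eq_lintegral_ofReal hS (ae_of_all _ fun z => by positivity)]
    refine lintegral_congr fun z => ?_
    rw [ENNReal.ofReal_pow (norm_nonneg _), ofReal_norm]
  have hsq : ∀ z w : Coord n, ‖z - w‖ ^ 2 = ‖z‖ ^ 2 - 2 * inner ℝ z w + ‖w‖ ^ 2 :=
    fun z w => norm_sub_sq_real z w
  refine ⟨ha.congr hgrad.symm, hmap, fun S hS hSm => ?_⟩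
  obtain ⟨-, hT1, hT2, hT3⟩ := hcost _ (ha.congr hgrad.symm) hmap
  obtain ⟨hS0, hS1, hS2, hS3⟩ := hcost S hS hSm
  rw [hlint _ hT1, hlint _ hS1]
  refine ENNReal.ofReal_le_ofReal ?_
  calc ∫ z, ‖z - gradient ψ z‖ ^ 2 ∂μ = ∫ z, (a z + b (gradient ψ z)) ∂μ := by
        refine integral_congr_ae ?_
        filter_upwards [hmem, hgrad] with z hz hz'
        rw [hz', hsq, ← H.legendre z hz]
        simp only [ha_def, hb_def]
        ring
    _ = ∫ z, (a z + b (S z)) ∂μ := by rw [hT3, hS3]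
    _ ≤ ∫ z, ‖z - S z‖ ^ 2 ∂μ := by
        refine integral_mono_ae hS2 hS1 ?_
        filter_upwards [hmem, hS0] with z hz hz'
        have := H.inner_le hz hz'
        simp only [ha_def, hb_def, hsq]
        linarith

end Transport

end DuallyFlat

namespace DuallyFlat

/-! ### Dual affine coordinates on the manifold -/

section DualCoordinates

set_option maxSynthPendingDepth 3
set_option linter.unusedSectionVars false

variable {n : ℕ} {M : Type*} [TopologicalSpace M] [ChartedSpace (Coord n) M]
  [IsManifold (𝓡 n) ∞ M]

theorem coordMetric_apply_self (g : Metric n M) {e : OpenPartialHomeomorph M (Coord n)} {y : M}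
    (hy : y ∈ e.source) (u v : Coord n) :
    coordMetric g e (e y) u v = g.inner y (coordField e u y) (coordField e v y) := by
  rw [coordMetric_apply, e.left_inv hy]

theorem IsAffineCoord.christoffel_eq_zero {D : Connection n M}
    {e : OpenPartialHomeomorph M (Coord n)} (he : IsAffineCoord D e) {z : Coord n}
    (hz : z ∈ e.target) (v u : Coord n) : christoffel D e z v u = 0 := by
  rw [christoffel_stdVec D he.mem_maximalAtlas hz, he.parallel v _ (e.map_target hz)]
  exact map_zero _

/-- In affine coordinates the derivative of the metric is totally symmetric. -/
theorem fderiv_coordMetric_symm [T2Space M] {g : Metric n M} {D Ds : Connection n M}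
    (h : IsDuallyFlat g D Ds) {e : OpenPartialHomeomorph M (Coord n)} (he : IsAffineCoord D e)
    {z : Coord n} (hz : z ∈ e.target) (u v w : Coord n) :
    fderiv ℝ (coordMetric g e) z u v w = fderiv ℝ (coordMetric g e) z v u w := by
  have ha := he.mem_maximalAtlas
  have hd : DifferentiableAt ℝ (coordMetric g e) z :=
    ((contDiffOn_coordMetric g ha).contDiffAt (e.open_target.mem_nhds hz)).differentiableAt
      (by simp)
  have hs : ∀ u v w, fderiv ℝ (coordMetric g e) z u v w = fderiv ℝ (coordMetric g e) z u w v := by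
    intro u v w
    have h1 := ((hd.hasFDerivAt.clm_apply (hasFDerivAt_const v z)).clm_apply
      (hasFDerivAt_const w z))
    have h2 := ((hd.hasFDerivAt.clm_apply (hasFDerivAt_const w z)).clm_apply
      (hasFDerivAt_const v z))
    have h3 := h1.congr_of_eventuallyEq (f₁ := fun z => coordMetric g e z w v)
      (Eventually.of_forall fun z => coordMetric_symm g e z w v)
    simpa using DFunLike.congr_fun (h3.unique h2) u
  have hf : ∀ u v w, fderiv ℝ (coordMetric g e) z u v w
      = coordMetric g e z v (christoffel Ds e z w u) := by
    intro u v w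
    rw [fderiv_coordMetric h ha hz, he.christoffel_eq_zero hz]
    simp
  -- Metric symmetry moves the derivative onto the ∇*-slot, where torsion-freeness of ∇* exchanges
  -- the two entries.
  rw [hs u v w, hf, christoffel_symm h.flat_star.torsion_eq_zero ha hz, ← hf, hs]

/-- Affine coordinates `η` on which the metric is the Hessian of `ψ`, with the coordinates `ηs` and
the potential `ψs` given by the Legendre transform `h`. -/
structure IsLegendreChart (g : Metric n M) (D : Connection n M) (C : CoordPair n M)
    (h : OpenPartialHomeomorph (Coord n) (Coord n)) : Prop where
  pair : LegendrePair h C.ψ C.ψs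
  affine : IsAffineCoord D C.η
  target_eq : C.η.target = h.source
  star_eq : C.ηs = C.η.trans h
  metric_eq : ∀ z ∈ h.source, ∀ u v,
    inner ℝ (fderiv ℝ h z u) v = coordMetric g C.η z u v

theorem exists_isLegendreChart [T2Space M] {g : Metric n M} {D Ds : Connection n M}
    (hflat : IsDuallyFlat g D Ds) (x : M) :
    ∃ (C : CoordPair n M) (h : OpenPartialHomeomorph (Coord n) (Coord n)),
      x ∈ C.dom ∧ IsLegendreChart g D C h := by
  obtain ⟨e, hx, he⟩ := exists_isAffineCoord hflat.flat x
  obtain ⟨h, ψ, ψs, H, hz, hsub, hG⟩ := exists_legendrePair e.open_target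
    (contDiffOn_coordMetric g he.mem_maximalAtlas) (fun z _ => coordMetric_symm g e z)
    (fun z hz => fderiv_coordMetric_symm hflat he hz)
    (fun z hz v hv => coordMetric_pos g he.mem_maximalAtlas hz hv) (e.map_source hx)
  -- The gradient map lives only on a small ball, so the affine chart is cut down to have that ball
  -- as its target.
  let i := OpenPartialHomeomorph.ofSet h.source h.open_source
  refine ⟨⟨e.trans i, (e.trans i).trans h, ψ, ψs⟩, h, ⟨hx, hz⟩, H,
    ⟨trans_mem_maximalAtlas he.mem_maximalAtlas contDiffOn_id contDiffOn_id,
      fun v y hy => he.parallel v y hy.1⟩, ?_, rfl, hG⟩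
  exact inter_eq_left.2 hsub

namespace IsLegendreChart

variable {g : Metric n M} {D : Connection n M} {C : CoordPair n M}
  {h : OpenPartialHomeomorph (Coord n) (Coord n)}

theorem map_mem (H : IsLegendreChart g D C h) {y : M} (hy : y ∈ C.dom) : C.η y ∈ h.source :=
  H.target_eq ▸ C.η.map_source hy

theorem star_apply (H : IsLegendreChart g D C h) (y : M) : C.ηs y = h (C.η y) := by
  rw [H.star_eq]; rfl

theorem star_source (H : IsLegendreChart g D C h) : C.ηs.source = C.dom := by
  rw [H.star_eq]
  exact inter_eq_left.2 fun y hy => H.map_mem hy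

theorem star_target (H : IsLegendreChart g D C h) : C.ηs.target = h.target := by
  rw [H.star_eq]
  exact inter_eq_left.2 fun w hw => by
    rw [mem_preimage, H.target_eq]; exact h.map_target hw

theorem star_mem_maximalAtlas (H : IsLegendreChart g D C h) :
    C.ηs ∈ IsManifold.maximalAtlas (𝓡 n) ∞ M := by
  rw [H.star_eq]
  exact trans_mem_maximalAtlas H.affine.mem_maximalAtlas H.pair.left.smooth_gradient
    H.pair.right.smooth_gradient

theorem mvfderiv_star (H : IsLegendreChart g D C h) {y : M} (hy : y ∈ C.dom)
    (w : TangentSpace (𝓡 n) y) :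
    mvfderiv (𝓡 n) C.ηs y w = fderiv ℝ h (C.η y) (mvfderiv (𝓡 n) C.η y w) := by
  rw [H.star_eq]
  exact mvfderiv_trans H.affine.mem_maximalAtlas hy
    (H.pair.left.hasFDerivAt_gradient (H.map_mem hy)) w

theorem coordField_star (H : IsLegendreChart g D C h) {y : M} (hy : y ∈ C.dom) (v : Coord n) :
    coordField C.ηs v y = coordFrame C.η y (fderiv ℝ h.symm (h (C.η y)) v) := by
  have h1 := H.mvfderiv_star hy (coordField C.ηs v y)
  rw [coordField_eq, mvfderiv_coordFrame H.star_mem_maximalAtlas (H.star_source ▸ hy)] at h1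
  have h2 := congrArg (fderiv ℝ h.symm (h (C.η y))) h1
  rw [H.pair.fderiv_symm_fderiv (H.map_mem hy)] at h2
  rw [h2, coordFrame_mvfderiv H.affine.mem_maximalAtlas hy, coordField_eq]

theorem inner_coordFrame (H : IsLegendreChart g D C h) {y : M} (hy : y ∈ C.dom) (u v : Coord n) :
    g.inner y (coordFrame C.η y u) (coordFrame C.η y v) = inner ℝ (fderiv ℝ h (C.η y) u) v := by
  rw [H.metric_eq _ (H.map_mem hy), coordMetric_apply_self g hy]
  rfl

/-- The derivative of h is the metric, so it can be absorbed into dη*. This mixed form identifies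
differentials of the losses with metric gradients. -/
theorem inner_eq (H : IsLegendreChart g D C h) {y : M} (hy : y ∈ C.dom)
    (v w : TangentSpace (𝓡 n) y) :
    g.inner y v w = inner ℝ (mvfderiv (𝓡 n) C.ηs y v) (mvfderiv (𝓡 n) C.η y w) := by
  rw [H.mvfderiv_star hy, ← H.inner_coordFrame hy,
    coordFrame_mvfderiv H.affine.mem_maximalAtlas hy, coordFrame_mvfderiv H.affine.mem_maximalAtlas hy]

theorem inner_star_coordFrame (H : IsLegendreChart g D C h) {y : M} (hy : y ∈ C.dom)
    (u v : Coord n) :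
    g.inner y (coordField C.η u y) (coordField C.ηs v y) = inner ℝ u v := by
  rw [H.coordField_star hy, coordField_eq, H.inner_coordFrame hy,
    H.pair.left.inner_fderiv_symm (H.map_mem hy), H.pair.fderiv_fderiv_symm (H.map_mem hy),
    real_inner_comm]

theorem hessian_eq_gram (H : IsLegendreChart g D C h) {y : M} (hy : y ∈ C.dom) :
    hessian C.ψ (C.η y) = gram g C.η y := by
  ext i j
  rw [hessian_apply H.pair.left (H.map_mem hy), ← H.inner_coordFrame hy]
  rfl

theorem hessian_star_eq_gram (H : IsLegendreChart g D C h) {y : M} (hy : y ∈ C.dom) :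
    hessian C.ψs (C.ηs y) = gram g C.ηs y := by
  ext i j
  have hm := H.map_mem hy
  have h1 : gram g C.ηs y i j
      = g.inner y (coordField C.ηs (stdVec i) y) (coordField C.ηs (stdVec j) y) := rfl
  rw [h1, H.coordField_star hy, H.coordField_star hy, H.inner_coordFrame hy,
    H.pair.fderiv_fderiv_symm hm, H.star_apply,
    hessian_apply H.pair.right (h.map_source hm), H.pair.right.inner_fderiv_symm (h.map_source hm),
    real_inner_comm]

/-- A dual coordinate field has constant product with each ∇-parallel field of η. Differentiating
this product, duality leaves g(a, ∇*∂^v) = 0 for all a, and g is nondegenerate. -/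
theorem affine_star [T2Space M] {Ds : Connection n M} (H : IsLegendreChart g D C h)
    (hflat : IsDuallyFlat g D Ds) : IsAffineCoord Ds C.ηs := by
  refine ⟨H.star_mem_maximalAtlas, fun v y hy => ?_⟩
  have ha := H.affine.mem_maximalAtlas
  have hy' : y ∈ C.dom := H.star_source ▸ hy
  have hfield : ∀ᶠ y' in 𝓝 y, coordField C.ηs v y'
      = coordFrame C.η y' (fderiv ℝ h.symm (h (C.η y')) v) := by
    filter_upwards [C.η.open_source.mem_nhds hy'] with x hx using H.coordField_star hx v
  set c : Coord n → Coord n := fun z => fderiv ℝ h.symm (h z) v with hc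
  have hz := H.map_mem hy'
  set z := C.η y
  have hzt : z ∈ C.η.target := C.η.map_source hy'
  have hcd : DifferentiableAt ℝ c z := by
    have h1 : ContDiffOn ℝ ∞ (fderiv ℝ h.symm) h.target :=
      H.pair.right.smooth_gradient.fderiv_of_isOpen h.open_target (by simp)
    have h2 := (h1.contDiffAt (h.open_target.mem_nhds (h.map_source hz))).differentiableAt (by simp)
    exact (h2.comp z (H.pair.left.hasFDerivAt_gradient hz).differentiableAt).clm_apply
      (differentiableAt_const v)
  have hGd : DifferentiableAt ℝ (coordMetric g C.η) z :=
    ((contDiffOn_coordMetric g ha).contDiffAt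
      (C.η.open_target.mem_nhds hzt)).differentiableAt (by simp)
  ext w
  rw [connection_congr Ds (mdifferentiableAt_coordField H.star_mem_maximalAtlas hy v) hfield,
    connection_coordFrame Ds ha hy' (c := c) hcd]
  set u := mvfderiv (𝓡 n) C.η y w
  set k := fderiv ℝ c z u + christoffel Ds C.η z (c z) u with hk
  have hconst : ∀ a, coordMetric g C.η z a k = 0 := by
    intro a
    have h1 := (hGd.hasFDerivAt.clm_apply (hasFDerivAt_const a z)).clm_apply hcd.hasFDerivAt
    have h2 : (fun z => coordMetric g C.η z a (c z)) =ᶠ[𝓝 z] fun _ => inner ℝ v a := by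
      filter_upwards [h.open_source.mem_nhds hz] with z' hz'
      rw [← H.metric_eq z' hz', H.pair.left.inner_fderiv_symm hz', H.pair.fderiv_fderiv_symm hz']
    have h3 := DFunLike.congr_fun ((h1.congr_of_eventuallyEq h2.symm).unique
      (hasFDerivAt_const (inner ℝ v a : ℝ) z)) u
    have h4 := fderiv_coordMetric hflat ha hzt u a (c z)
    rw [H.affine.christoffel_eq_zero hzt] at h4
    simp only [map_zero, zero_apply, zero_add] at h4
    simp only [add_apply, ContinuousLinearMap.comp_apply, ContinuousLinearMap.flip_apply,
      zero_apply, map_zero, zero_add, h4] at h3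
    rw [hk, map_add, h3]
  have hk0 : k = 0 := by
    by_contra hne
    exact (coordMetric_pos g ha hzt hne).ne' (hconst k)
  rw [hk0, map_zero]
  rfl

theorem isDualMongeAmperePair [T2Space M] {Ds : Connection n M} (H : IsLegendreChart g D C h)
    (hflat : IsDuallyFlat g D Ds) : IsDualMongeAmperePair g D Ds C where
  source_eq := H.star_source
  affine := H.affine
  affine_star := H.affine_star hflat
  biorthogonal := fun y hy i j => by
    rw [H.inner_star_coordFrame hy, inner_stdVec]
    simp [stdVec, eq_comm]
  hessian_eq := fun y hy => H.hessian_eq_gram hy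
  hessian_star_eq := fun y hy => by
    rw [H.star_apply, hessian_star_eq_inv H.pair (H.map_mem hy), H.hessian_eq_gram hy]
  gradient_eq := fun y hy => by
    rw [H.star_apply]; exact H.pair.left.gradient _ (H.map_mem hy)
  gradient_star_eq := fun y hy => by
    have h1 := H.map_mem hy
    have h2 := H.pair.right.gradient _ (h.map_source h1)
    rwa [h.left_inv h1, ← H.star_apply] at h2
  legendre := fun y hy => by
    rw [H.star_apply]; exact H.pair.legendre _ (H.map_mem hy)
  solves := by
    rw [H.target_eq]
    refine solvesMongeAmpere H.pair.left fun z hz => ?_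
    have hz' : z ∈ C.η.target := H.target_eq ▸ hz
    have h1 := H.hessian_eq_gram (C.η.map_target hz')
    rw [C.η.right_inv hz'] at h1
    rw [mongeAmpere, h1]
  solves_star := by
    rw [H.star_target]
    refine solvesMongeAmpere H.pair.right fun z hz => ?_
    have hz' : z ∈ C.ηs.target := H.star_target ▸ hz
    have h1 := H.hessian_star_eq_gram (H.star_source ▸ C.ηs.map_target hz')
    rw [C.ηs.right_inv hz'] at h1
    rw [mongeAmpere, h1]
  transport := by
    rw [H.target_eq, H.star_target]; exact isOptimalTransport_gradient H.pair
  transport_star := by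
    rw [H.target_eq, H.star_target]; exact isOptimalTransport_gradient H.pair.symm

theorem divergence_pos (H : IsLegendreChart g D C h) {r q : M} (hr : r ∈ C.dom) (hq : q ∈ C.dom)
    (hne : r ≠ q) : 0 < divergence C r q := by
  rw [divergence, H.star_apply]
  exact H.pair.sub_pos_of_ne (H.map_mem hr) (H.map_mem hq) fun h1 => hne (C.η.injOn hr hq h1)

theorem divergence_self (H : IsLegendreChart g D C h) {r : M} (hr : r ∈ C.dom) :
    divergence C r r = 0 := by
  rw [divergence, H.star_apply, H.pair.legendre _ (H.map_mem hr), sub_self]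

end IsLegendreChart

end DualCoordinates

end DuallyFlat

namespace DuallyFlat

/-! ### Straight segments as optimal learning procedures -/

section Learning

set_option maxSynthPendingDepth 3
set_option linter.unusedSectionVars false

variable {n : ℕ} {M : Type*} [TopologicalSpace M] [ChartedSpace (Coord n) M]
  [IsManifold (𝓡 n) ∞ M] {e : OpenPartialHomeomorph M (Coord n)}

theorem mvfderiv_comp_coord {F : Type*} [NormedAddCommGroup F] [NormedSpace ℝ F]
    (he : e ∈ IsManifold.maximalAtlas (𝓡 n) ∞ M) {y : M} (hy : y ∈ e.source) {f : Coord n → F}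
    {f' : Coord n →L[ℝ] F} (hf : HasFDerivAt f f' (e y)) (v : TangentSpace (𝓡 n) y) :
    mvfderiv (𝓡 n) (fun x => f (e x)) y v = f' (mvfderiv (𝓡 n) e y v) := by
  have hme : MDifferentiableAt (𝓡 n) 𝓘(ℝ, Coord n) e y :=
    (mdifferentiable_of_mem_maximalAtlas he).mdifferentiableAt hy
  rw [mvfderiv_eq_fderiv_comp_symm he hy (f := fun x => f (e x))
    (hf.differentiableAt.mdifferentiableAt.comp y hme)]
  have : (fun x => f (e x)) ∘ e.symm =ᶠ[𝓝 (e y)] f := by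
    filter_upwards [e.open_target.mem_nhds (e.map_source hy)] with z hz
    simp [e.right_inv hz]
  rw [this.fderiv_eq, hf.fderiv]

theorem contDiffOn_coord_comp (he : e ∈ IsManifold.maximalAtlas (𝓡 n) ∞ M) {p q : M} {γ : ℝ → M}
    {k : ℕ∞ω} (hk : k ≤ (∞ : ℕ∞ω)) (hγ : IsCurve (n := n) k e.source p q γ) :
    ContDiffOn ℝ k (fun t => e (γ t)) (Icc 0 1) :=
  contMDiffOn_iff_contDiffOn.1
    (((contMDiffOn_of_mem_maximalAtlas he).of_le hk).comp hγ.contMDiffOn hγ.mapsTo)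

theorem mvfderiv_velocity (he : e ∈ IsManifold.maximalAtlas (𝓡 n) ∞ M) {p q : M} {γ : ℝ → M}
    {k : ℕ∞ω} (hk : 1 ≤ k) (hγ : IsCurve (n := n) k e.source p q γ) {t : ℝ}
    (ht : t ∈ Icc (0 : ℝ) 1) :
    mvfderiv (𝓡 n) e (γ t) (velocity γ t) = derivWithin (fun s => e (γ s)) (Icc 0 1) t := by
  have hu : UniqueMDiffWithinAt 𝓘(ℝ, ℝ) (Icc (0 : ℝ) 1) t :=
    (uniqueDiffOn_Icc one_pos t ht).uniqueMDiffWithinAt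
  have h1 : MDifferentiableWithinAt 𝓘(ℝ, ℝ) (𝓡 n) γ (Icc 0 1) t :=
    (hγ.contMDiffOn t ht).mdifferentiableWithinAt (by
      rintro rfl; simp at hk)
  have h2 : MDifferentiableAt (𝓡 n) 𝓘(ℝ, Coord n) e (γ t) :=
    (mdifferentiable_of_mem_maximalAtlas he).mdifferentiableAt (hγ.mapsTo ht)
  have h3 := mfderiv_comp_mfderivWithin t h2 h1 hu
  have h4 := DFunLike.congr_fun h3 (1 : ℝ)
  rw [mfderivWithin_eq_fderivWithin] at h4
  exact h4.symm

/-- Cauchy–Schwarz in integrated form: with d the displacement, |u'|² ≥ 2⟨d, u'⟩ − |d|², and the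
right side integrates to |d|². -/
theorem sq_norm_sub_le_flatEnergy (he : e ∈ IsManifold.maximalAtlas (𝓡 n) ∞ M) {p q : M}
    {c : ℝ → M} (hc : IsCurve (n := n) 1 e.source p q c) :
    ‖e q - e p‖ ^ 2 ≤ flatEnergy e c := by
  set u : ℝ → Coord n := fun t => e (c t) with hu
  have hu1 : ContDiffOn ℝ 1 u (Icc 0 1) :=
    contDiffOn_coord_comp he (WithTop.coe_le_coe.2 (le_top : (1 : ℕ∞) ≤ ⊤)) hc
  set u' : ℝ → Coord n := derivWithin u (Icc 0 1) with hu'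
  have hcont : ContinuousOn u' (Icc 0 1) :=
    hu1.continuousOn_derivWithin (uniqueDiffOn_Icc one_pos) le_rfl
  set d := e q - e p with hd
  have hder : ∀ t ∈ Ioo (0 : ℝ) 1, HasDerivAt (fun s => 2 * inner ℝ d (u s) - ‖d‖ ^ 2 * s)
      (2 * inner ℝ d (u' t) - ‖d‖ ^ 2) t := by
    intro t ht
    have h1 : HasDerivAt u (u' t) t :=
      ((hu1.differentiableOn one_ne_zero t (Ioo_subset_Icc_self ht)).hasDerivWithinAt).hasDerivAt
        (Icc_mem_nhds ht.1 ht.2)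
    have h2 := ((hasDerivAt_const t d).inner ℝ h1).const_mul 2
    have h3 := h2.fun_sub ((hasDerivAt_id t).const_mul (‖d‖ ^ 2))
    simpa using h3
  have hci : ContinuousOn (fun t => 2 * inner ℝ d (u' t) - ‖d‖ ^ 2) (Icc (0 : ℝ) 1) :=
    (continuousOn_const.mul (continuousOn_const.inner hcont)).sub continuousOn_const
  have hint : ∫ t in (0 : ℝ)..1, (2 * inner ℝ d (u' t) - ‖d‖ ^ 2) = ‖d‖ ^ 2 := by
    rw [intervalIntegral.integral_eq_sub_of_hasDerivAt_of_le zero_le_one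
      ((continuousOn_const.mul (continuousOn_const.inner hu1.continuousOn)).sub
        (continuousOn_const.mul continuousOn_id)) hder
      (ContinuousOn.intervalIntegrable (by rwa [uIcc_of_le zero_le_one]))]
    have h0 : u 0 = e p := by simp [hu, hc.start]
    have h1 : u 1 = e q := by simp [hu, hc.finish]
    have h2 : inner ℝ d (e q) - inner ℝ d (e p) = ‖d‖ ^ 2 := by
      rw [← inner_sub_right, ← hd, real_inner_self_eq_norm_sq]
    simp only [Pi.sub_apply, Pi.mul_apply, id, h0, h1, mul_one, mul_zero, sub_zero]
    linarith
  calc ‖d‖ ^ 2 = ∫ t in (0 : ℝ)..1, (2 * inner ℝ d (u' t) - ‖d‖ ^ 2) := hint.symm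
    _ ≤ ∫ t in (0 : ℝ)..1, ‖u' t‖ ^ 2 := by
        refine intervalIntegral.integral_mono_on zero_le_one
          (ContinuousOn.intervalIntegrable (by rwa [uIcc_of_le zero_le_one]))
          (ContinuousOn.intervalIntegrable (by
            rw [uIcc_of_le zero_le_one]; exact hcont.norm.pow 2)) fun t _ => ?_
        have h1 := norm_sub_sq_real d (u' t)
        have h2 := sq_nonneg ‖d - u' t‖
        linarith

/-- The straight line in the coordinates `e` is an optimal learning procedure, if its velocity is
proportional to the gradient of the loss. -/
theorem exists_isOptimalLearning (g : Metric n M) (he : e ∈ IsManifold.maximalAtlas (𝓡 n) ∞ M)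
    (hconv : Convex ℝ e.target) {p q : M} (hp : p ∈ e.source) (hq : q ∈ e.source) {L : M → ℝ}
    (hL : ∀ r ∈ e.source, ∀ v w : TangentSpace (𝓡 n) r,
      mvfderiv (𝓡 n) e r w = e q - e r → mvfderiv (𝓡 n) L r v = -g.inner r v w) :
    ∃ γ : ℝ → M, IsOptimalLearning g e L p q γ := by
  let l : ℝ → Coord n := fun t => e p + t • (e q - e p)
  have hl : ∀ t ∈ Icc (0 : ℝ) 1, l t ∈ e.target := fun t ht =>
    hconv.add_smul_sub_mem (e.map_source hp) (e.map_source hq) ht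
  let γ : ℝ → M := fun t => e.symm (l t)
  have heγ : ∀ t ∈ Icc (0 : ℝ) 1, e (γ t) = l t := fun t ht => e.right_inv (hl t ht)
  have hγ : IsCurve (n := n) ∞ e.source p q γ := by
    refine ⟨(contMDiffOn_symm_of_mem_maximalAtlas he).comp ?_ hl,
      fun t ht => e.map_target (hl t ht), ?_, ?_⟩
    · have : ContDiff ℝ ∞ l := by fun_prop
      exact this.contMDiff.contMDiffOn
    · simp [γ, l, e.left_inv hp]
    · simp [γ, l, e.left_inv hq]
  have hld : ∀ t, HasDerivAt l (e q - e p) t := fun t => by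
    have h := ((hasDerivAt_id t).smul_const (e q - e p)).const_add (e p)
    rw [one_smul] at h
    exact h
  have hder : ∀ t ∈ Icc (0 : ℝ) 1, derivWithin (fun s => e (γ s)) (Icc 0 1) t = e q - e p := by
    intro t ht
    rw [derivWithin_congr heγ (heγ t ht)]
    exact (hld t).hasDerivWithinAt.derivWithin (uniqueDiffOn_Icc one_pos t ht)
  have hvel : ∀ t ∈ Icc (0 : ℝ) 1, mvfderiv (𝓡 n) e (γ t) (velocity (n := n) γ t)
      = e q - e p :=
    fun t ht => (mvfderiv_velocity he (by simp) hγ ht).trans (hder t ht)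
  -- The hypothesis on L says that its metric gradient at r is minus the vector with coordinates e q
  -- − e r. At time t of the segment this vector is (1 − t) times the velocity.
  have hdL : ∀ t ∈ Icc (0 : ℝ) 1, ∀ v : TangentSpace (𝓡 n) (γ t),
      mvfderiv (𝓡 n) L (γ t) v = -((1 - t) * g.inner (γ t) v (velocity (n := n) γ t)) := by
    intro t ht v
    rw [hL _ (hγ.mapsTo ht) v ((1 - t) • velocity γ t) (by
      rw [map_smul, hvel t ht, heγ t ht]
      simp only [l]
      module), map_smul, smul_eq_mul]
  refine ⟨γ, hγ, fun t ht v hv => ?_, fun hpq t ht => ?_, fun c hc => ?_⟩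
  · have ht' := Ico_subset_Icc_self ht
    rw [hdL t ht', hdL t ht']
    set w := velocity (n := n) γ t
    -- From g(v − w, v − w) ≥ 0 and g(v, v) ≤ g(w, w) follows g(v, w) ≤ g(w, w).
    have h1 : 0 ≤ g.inner (γ t) (v - w) (v - w) := by
      rcases eq_or_ne (v - w) 0 with h0 | h0
      · rw [h0, map_zero]
      · exact (g.pos _ _ h0).le
    rw [map_sub, map_sub, sub_apply, sub_apply, g.symm _ w v] at h1
    have h2 : g.inner (γ t) v w ≤ g.inner (γ t) w w := by linarith
    exact neg_le_neg (mul_le_mul_of_nonneg_left h2 (by linarith [ht.2]))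
  · have ht' := Ico_subset_Icc_self ht
    rw [hdL t ht']
    have hne : velocity (n := n) γ t ≠ 0 := fun h0 => by
      have h1 := hvel t ht'
      rw [h0, map_zero] at h1
      exact hpq (e.injOn hp hq (sub_eq_zero.1 h1.symm).symm)
    have := mul_pos (sub_pos.2 ht.2) (g.pos (γ t) _ hne)
    linarith
  · refine le_trans (le_of_eq ?_) (sq_norm_sub_le_flatEnergy he hc)
    have : ∫ t in (0 : ℝ)..1, ‖derivWithin (fun s => e (γ s)) (Icc 0 1) t‖ ^ 2
        = ∫ t in (0 : ℝ)..1, ‖e q - e p‖ ^ 2 :=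
      intervalIntegral.integral_congr fun t ht => by
        rw [uIcc_of_le zero_le_one] at ht
        simp only [hder t ht]
    rw [flatEnergy, this]
    simp

namespace IsLegendreChart

variable {g : Metric n M} {D : Connection n M} {C : CoordPair n M}
  {h : OpenPartialHomeomorph (Coord n) (Coord n)}

/-- Since ∇ψ*(η*) = η, the differential of D(q, ·) at r is ⟨η(r) − η(q), dη*⟩, which is a metric
product with a vector whose η-coordinates point from r to q. -/
theorem exists_isOptimalLearning (H : IsLegendreChart g D C h) {p q : M} (hp : p ∈ C.dom)
    (hq : q ∈ C.dom) :
    ∃ γ : ℝ → M, IsOptimalLearning g C.η (fun r => divergence C q r) p q γ := by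
  refine DuallyFlat.exists_isOptimalLearning g H.affine.mem_maximalAtlas
    (H.target_eq ▸ H.pair.left.convex) hp hq fun r hr v w hw => ?_
  have hm := H.map_mem hr
  have h1 : HasFDerivAt (fun z => C.ψ (C.η q) + C.ψs z - inner ℝ (C.η q) z)
      (rieszMap (h.symm (C.ηs r)) - rieszMap (C.η q)) (C.ηs r) := by
    rw [H.star_apply]
    exact ((H.pair.right.hasFDerivAt (h.map_source hm)).const_add _).sub
      (rieszMap (C.η q)).hasFDerivAt
  have h2 := mvfderiv_comp_coord H.star_mem_maximalAtlas (H.star_source ▸ hr) h1 v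
  rw [H.star_apply r, h.left_inv hm] at h2
  refine h2.trans ?_
  rw [H.inner_eq hr, hw, sub_apply, rieszMap_apply, rieszMap_apply, inner_sub_right,
    real_inner_comm, real_inner_comm (C.η q)]
  ring

/-- The mirror case: the differential of D(·, q) at r is ⟨η*(r) − η*(q), dη⟩. -/
theorem exists_isOptimalLearning_star (H : IsLegendreChart g D C h) {p q : M} (hp : p ∈ C.dom)
    (hq : q ∈ C.dom) :
    ∃ γ : ℝ → M, IsOptimalLearning g C.ηs (fun r => divergence C r q) p q γ := by
  refine DuallyFlat.exists_isOptimalLearning g H.star_mem_maximalAtlas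
    (H.star_target ▸ H.pair.right.convex) (H.star_source ▸ hp) (H.star_source ▸ hq)
    fun r hr v w hw => ?_
  rw [H.star_source] at hr
  have hm := H.map_mem hr
  have h1 : HasFDerivAt (fun z => C.ψ z + C.ψs (C.ηs q) - inner ℝ z (C.ηs q))
      (rieszMap (h (C.η r)) - rieszMap.flip (C.ηs q)) (C.η r) :=
    ((H.pair.left.hasFDerivAt hm).add_const _).sub (rieszMap.flip (C.ηs q)).hasFDerivAt
  have h2 := mvfderiv_comp_coord H.affine.mem_maximalAtlas hr h1 v
  refine h2.trans ?_
  rw [g.symm, H.inner_eq hr, hw, sub_apply, rieszMap_apply, ContinuousLinearMap.flip_apply,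
    rieszMap_apply, inner_sub_left, H.star_apply r, real_inner_comm (C.ηs q)]
  ring

end IsLegendreChart

end Learning

end DuallyFlat

namespace DuallyFlat

/-! ### Exponential families of measures -/

section ExponentialMeasure

set_option maxSynthPendingDepth 3
set_option linter.unusedSectionVars false

variable {n : ℕ} {Ω : Type*} [MeasurableSpace Ω] {ν : Measure Ω} {T : Ω → Coord n}

theorem measurable_inner_statistic (hT : Measurable T) (s : Coord n) :
    Measurable fun z => (inner ℝ s (T z) : ℝ) :=
  (measurable_const (a := s)).inner hT

theorem integrable_exp_and_integral_eq (hT : Measurable T) {s : Coord n} {α : ℝ}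
    (hP : IsProbabilityMeasure (expMeasure ν T s α)) :
    Integrable (fun z => Real.exp (inner ℝ s (T z))) ν ∧
      ∫ z, Real.exp (inner ℝ s (T z)) ∂ν = Real.exp α := by
  have hm : Measurable fun z => Real.exp (inner ℝ s (T z) - α) :=
    Real.measurable_exp.comp ((measurable_inner_statistic hT s).sub_const α)
  have h1 : ∫⁻ z, ENNReal.ofReal (Real.exp (inner ℝ s (T z) - α)) ∂ν = 1 := by
    have := hP.measure_univ
    rwa [expMeasure, withDensity_apply _ MeasurableSet.univ, Measure.restrict_univ] at this
  have h2 : Integrable (fun z => Real.exp (inner ℝ s (T z) - α)) ν := by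
    refine ⟨hm.aestronglyMeasurable, ?_⟩
    rw [hasFiniteIntegral_iff_ofReal (ae_of_all _ fun z => (Real.exp_pos _).le), h1]
    exact ENNReal.one_lt_top
  have h3 : ∫ z, Real.exp (inner ℝ s (T z) - α) ∂ν = 1 := by
    rw [integral_eq_lintegral_of_nonneg_ae (ae_of_all _ fun z => (Real.exp_pos _).le)
      hm.aestronglyMeasurable, h1, ENNReal.toReal_one]
  have h4 : (fun z => Real.exp (inner ℝ s (T z)))
      = fun z => Real.exp α * Real.exp (inner ℝ s (T z) - α) := by
    funext z
    rw [← Real.exp_add]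
    ring_nf
  rw [h4, integral_const_mul, h3, mul_one]
  exact ⟨h2.const_mul _, rfl⟩

/-- Rebasing at a member of the family turns all other members into exponential tilts of one
probability measure. -/
theorem expMeasure_expMeasure (hT : Measurable T) (s u : Coord n) (α β : ℝ) :
    expMeasure (expMeasure ν T s α) T u β = expMeasure ν T (s + u) (α + β) := by
  have hm : ∀ s α, Measurable fun z => ENNReal.ofReal (Real.exp (inner ℝ s (T z) - α)) :=
    fun s α => ENNReal.measurable_ofReal.comp
      (Real.measurable_exp.comp ((measurable_inner_statistic hT s).sub_const α))
  rw [expMeasure, expMeasure, expMeasure, ← withDensity_mul _ (hm s α) (hm u β)]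
  congr 1
  funext z
  rw [Pi.mul_apply, ← ENNReal.ofReal_mul (Real.exp_pos _).le, ← Real.exp_add, inner_add_left]
  ring_nf

theorem expMeasure_eq_tilted (hT : Measurable T) {u : Coord n} {β : ℝ}
    (hP : IsProbabilityMeasure (expMeasure ν T u β)) :
    expMeasure ν T u β = ν.tilted fun z => inner ℝ u (T z) := by
  rw [expMeasure, Measure.tilted, (integrable_exp_and_integral_eq hT hP).2]
  simp only [Real.exp_sub]

/-- The log-likelihood ratio of ν to its tilt is β − ⟨u, T⟩, so the information is the mean of this
statistic. -/
theorem klDiv_expMeasure [IsProbabilityMeasure ν] (hT : Measurable T) {u : Coord n} {β : ℝ}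
    (hP : IsProbabilityMeasure (expMeasure ν T u β))
    (hi : Integrable (fun z => (inner ℝ u (T z) : ℝ)) ν) :
    InformationTheory.klDiv ν (expMeasure ν T u β)
      = ENNReal.ofReal (β - ∫ z, inner ℝ u (T z) ∂ν) := by
  obtain ⟨h1, h2⟩ := integrable_exp_and_integral_eq hT hP
  have hself : Integrable (llr ν ν) ν :=
    (integrable_congr (llr_self ν)).2 (integrable_zero _ _ _)
  have hac : ν ≪ expMeasure ν T u β := by
    rw [expMeasure_eq_tilted hT hP]
    exact absolutelyContinuous_tilted h1
  have hint : Integrable (llr ν (expMeasure ν T u β)) ν := by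
    rw [expMeasure_eq_tilted hT hP]
    exact integrable_llr_tilted_right Measure.AbsolutelyContinuous.rfl hi hself h1
  have hval : ∫ z, llr ν (expMeasure ν T u β) z ∂ν = β - ∫ z, inner ℝ u (T z) ∂ν := by
    rw [expMeasure_eq_tilted hT hP,
      integral_llr_tilted_right Measure.AbsolutelyContinuous.rfl hi h1 hself, h2, Real.log_exp,
      integral_congr_ae (llr_self ν)]
    simp only [Pi.zero_apply, integral_zero]
    ring
  rw [InformationTheory.klDiv_of_ac_of_integrable hac hint, hval]
  simp

/-- The norm is at most (n + 1) times the largest coordinate modulus, so finitely many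
one-dimensional exponentials dominate. With ε = δ / (2(n + 1)), one factor exp(ε‖y‖) absorbs ‖y‖ and
the other is the given one; n + 1 instead of n avoids division by zero. -/
theorem norm_mul_exp_norm_le {δ : ℝ} (hδ : 0 < δ) (y : Coord n) :
    ‖y‖ * Real.exp (δ / (2 * (n + 1)) * ‖y‖) ≤
      2 * (n + 1) / δ * ∑ i, (Real.exp (δ * y i) + Real.exp (-(δ * y i))) := by
  rcases isEmpty_or_nonempty (Fin n) with hn | hn
  · have : y = 0 := by ext i; exact isEmptyElim i
    simp [this]
  obtain ⟨i, hi⟩ := Finite.exists_max fun i => |y i|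
  set ε := δ / (2 * (n + 1)) with hε
  have hε0 : 0 < ε := by positivity
  have h1 : ‖y‖ ≤ (n + 1) * |y i| := by
    have h2 : ‖y‖ ≤ ∑ j, ‖y j • (stdVec j : Coord n)‖ := by
      conv_lhs => rw [← sum_smul_stdVec y]
      exact norm_sum_le _ _
    refine h2.trans ?_
    calc ∑ j, ‖y j • (stdVec j : Coord n)‖ ≤ ∑ _j : Fin n, |y i| :=
          Finset.sum_le_sum fun j _ => by
            rw [norm_smul, stdVec, PiLp.norm_single, norm_one, mul_one]
            exact hi j
      _ = n * |y i| := by simp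
      _ ≤ (n + 1) * |y i| := by gcongr; linarith
  have h2 : 2 * ε * ‖y‖ ≤ δ * |y i| := by
    calc 2 * ε * ‖y‖ ≤ 2 * ε * ((n + 1) * |y i|) := by gcongr
      _ = δ * |y i| := by rw [hε]; field_simp
  have h3 : Real.exp (δ * |y i|) ≤ Real.exp (δ * y i) + Real.exp (-(δ * y i)) := by
    rcases abs_cases (y i) with ⟨h, -⟩ | ⟨h, -⟩ <;> rw [h]
    · exact le_add_of_nonneg_right (Real.exp_pos _).le
    · rw [mul_neg]
      exact le_add_of_nonneg_left (Real.exp_pos _).le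
  have h4 : Real.exp (δ * y i) + Real.exp (-(δ * y i))
      ≤ ∑ i, (Real.exp (δ * y i) + Real.exp (-(δ * y i))) :=
    Finset.single_le_sum (f := fun i => Real.exp (δ * y i) + Real.exp (-(δ * y i)))
      (fun j _ => by positivity) (Finset.mem_univ i)
  have h5 : ε * ‖y‖ ≤ Real.exp (ε * ‖y‖) := by
    linarith [Real.add_one_le_exp (ε * ‖y‖)]
  have h6 : ε * (‖y‖ * Real.exp (ε * ‖y‖)) ≤ Real.exp (2 * ε * ‖y‖) := by
    calc ε * (‖y‖ * Real.exp (ε * ‖y‖)) = (ε * ‖y‖) * Real.exp (ε * ‖y‖) := by ring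
      _ ≤ Real.exp (ε * ‖y‖) * Real.exp (ε * ‖y‖) := by gcongr
      _ = Real.exp (2 * ε * ‖y‖) := by rw [← Real.exp_add]; ring_nf
  have h7 := (h6.trans (Real.exp_le_exp.2 h2)).trans (h3.trans h4)
  have h8 : 2 * ((n : ℝ) + 1) / δ = ε⁻¹ := by rw [hε, inv_div]
  rw [h8, ← div_eq_inv_mul, le_div_iff₀ hε0]
  linarith

/-- The partition function of an exponential family is differentiable in the interior of the set of
natural parameters. -/
theorem differentiableAt_partitionFunction (hT : Measurable T) {S : Set (Coord n)}
    (hi : ∀ s ∈ S, Integrable (fun z => Real.exp (inner ℝ s (T z))) ν) {s₀ : Coord n}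
    (hS : S ∈ 𝓝 s₀) :
    DifferentiableAt ℝ (fun s => ∫ z, Real.exp (inner ℝ s (T z)) ∂ν) s₀ := by
  obtain ⟨δ, hδ, hball⟩ := Metric.nhds_basis_closedBall.mem_iff.1 hS
  set ε := δ / (2 * (n + 1)) with hε
  have hε0 : 0 < ε := by positivity
  have hmeas : ∀ s, AEStronglyMeasurable (fun z => Real.exp (inner ℝ s (T z))) ν := fun s =>
    (Real.measurable_exp.comp (measurable_inner_statistic hT s)).aestronglyMeasurable
  -- The dominating function uses only the exponential moments at s₀ ± δ eᵢ, which lie in the closed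
  -- ball inside S.
  set bound : Ω → ℝ := fun z => 2 * (n + 1) / δ *
    ∑ i, (Real.exp (inner ℝ (s₀ + δ • stdVec i) (T z))
      + Real.exp (inner ℝ (s₀ - δ • stdVec i) (T z))) with hbound
  refine (hasFDerivAt_integral_of_dominated_of_fderiv_le (𝕜 := ℝ) (bound := bound)
    (F' := fun s z => Real.exp (inner ℝ s (T z)) • rieszMap (T z))
    (Metric.ball_mem_nhds s₀ hε0) (Eventually.of_forall hmeas) (hi s₀ (mem_of_mem_nhds hS)) ?_ ?_ ?_
    ?_).differentiableAt
  · exact (hmeas s₀).smul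
      ((rieszMap (E := Coord n)).continuous.measurable.comp hT).aestronglyMeasurable
  · refine ae_of_all _ fun z s hs => ?_
    have h1 : ‖rieszMap (T z)‖ = ‖T z‖ := innerSL_apply_norm ℝ (T z)
    have h2 : inner ℝ s (T z) ≤ inner ℝ s₀ (T z) + ε * ‖T z‖ := by
      have h3 : inner ℝ (s - s₀) (T z) ≤ ‖s - s₀‖ * ‖T z‖ := real_inner_le_norm _ _
      have h4 : ‖s - s₀‖ ≤ ε := (mem_ball_iff_norm.1 hs).le
      have h5 := mul_le_mul_of_nonneg_right h4 (norm_nonneg (T z))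
      rw [inner_sub_left] at h3
      linarith
    rw [norm_smul, h1, Real.norm_eq_abs, abs_of_pos (Real.exp_pos _)]
    calc Real.exp (inner ℝ s (T z)) * ‖T z‖
        ≤ Real.exp (inner ℝ s₀ (T z) + ε * ‖T z‖) * ‖T z‖ := by gcongr
      _ = Real.exp (inner ℝ s₀ (T z)) * (‖T z‖ * Real.exp (ε * ‖T z‖)) := by
          rw [Real.exp_add]; ring
      _ ≤ Real.exp (inner ℝ s₀ (T z)) * (2 * (n + 1) / δ *
          ∑ i, (Real.exp (δ * T z i) + Real.exp (-(δ * T z i)))) :=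
          mul_le_mul_of_nonneg_left (norm_mul_exp_norm_le hδ (T z)) (Real.exp_pos _).le
      _ = bound z := by
          rw [hbound, mul_left_comm, Finset.mul_sum]
          congr 1
          refine Finset.sum_congr rfl fun i _ => ?_
          have h5 : inner ℝ (δ • stdVec i) (T z) = δ * T z i := by
            rw [real_inner_smul_left, real_inner_comm, inner_stdVec]
          rw [mul_add, ← Real.exp_add, ← Real.exp_add, inner_add_left, inner_sub_left, h5,
            sub_eq_add_neg]
  · refine Integrable.const_mul (integrable_finsetSum _ fun i _ => ?_) _
    have hnorm : ‖δ • (stdVec i : Coord n)‖ = δ := by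
      rw [norm_smul, stdVec, PiLp.norm_single, norm_one, mul_one, Real.norm_eq_abs,
        abs_of_pos hδ]
    refine (hi _ (hball ?_)).add (hi _ (hball ?_))
    · rw [mem_closedBall_iff_norm, add_sub_cancel_left, hnorm]
    · rw [mem_closedBall_iff_norm, sub_sub_cancel_left, norm_neg, hnorm]
  · refine ae_of_all _ fun z s _ => ?_
    have h1 : HasFDerivAt (fun s : Coord n => (inner ℝ s (T z) : ℝ)) (rieszMap (T z)) s := by
      have h2 : (fun s : Coord n => (inner ℝ s (T z) : ℝ)) = fun s => rieszMap (T z) s := by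
        funext s
        rw [rieszMap_apply, real_inner_comm]
      rw [h2]
      exact (rieszMap (T z)).hasFDerivAt
    exact h1.exp

end ExponentialMeasure

end DuallyFlat

namespace DuallyFlat

/-! ### The loss as Kullback information -/

section KullbackLink

set_option maxSynthPendingDepth 3
set_option linter.unusedSectionVars false

variable {n : ℕ} {M : Type*} [TopologicalSpace M] [ChartedSpace (Coord n) M]
  [IsManifold (𝓡 n) ∞ M] {g : Metric n M} {D : Connection n M}
  {Ω : Type*} [MeasurableSpace Ω] {ν : Measure Ω} {T : Ω → Coord n} {θ : M → Coord n} {Ψ : M → ℝ}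

namespace IsExponentialFamily

theorem mdifferentiable_parameter (F : IsExponentialFamily g D ν T θ Ψ) :
    MDifferentiable (𝓡 n) 𝓘(ℝ, Coord n) θ :=
  F.coord.mdifferentiable (by simp)

/-- No regularity of Ψ is assumed. Normalization makes it the logarithm of the partition function at
θ, and θ has open range because it is a local diffeomorphism, so its values are interior natural
parameters. -/
theorem mdifferentiable_logPartition (F : IsExponentialFamily g D ν T θ Ψ) :
    MDifferentiable (𝓡 n) 𝓘(ℝ, ℝ) Ψ := by
  intro r
  have hi : ∀ r, Integrable (fun z => Real.exp (inner ℝ (θ r) (T z))) ν ∧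
      ∫ z, Real.exp (inner ℝ (θ r) (T z)) ∂ν = Real.exp (Ψ r) := fun r =>
    integrable_exp_and_integral_eq F.measurable (F.normalized r)
  have h1 : DifferentiableAt ℝ (fun s => ∫ z, Real.exp (inner ℝ s (T z)) ∂ν) (θ r) :=
    differentiableAt_partitionFunction F.measurable (S := range θ)
      (by rintro _ ⟨r', rfl⟩; exact (hi r').1) (F.coord.isOpen_range.mem_nhds (mem_range_self r))
  have h2 : DifferentiableAt ℝ (fun s => Real.log (∫ z, Real.exp (inner ℝ s (T z)) ∂ν)) (θ r) :=
    h1.log (by rw [(hi r).2]; exact (Real.exp_pos _).ne')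
  have h3 : Ψ = (fun s => Real.log (∫ z, Real.exp (inner ℝ s (T z)) ∂ν)) ∘ θ := by
    funext r'
    rw [Function.comp, (hi r').2, Real.log_exp]
  rw [h3]
  exact h2.mdifferentiableAt.comp r (F.mdifferentiable_parameter r)

/-- In affine coordinates the parallelism of dθ says that the second derivative of θ vanishes; on a
convex domain θ is then an affine map. -/
theorem parameter_coord [T2Space M] (F : IsExponentialFamily g D ν T θ Ψ)
    {e : OpenPartialHomeomorph M (Coord n)} (he : IsAffineCoord D e) (hc : Convex ℝ e.target)
    {z z' : Coord n} (hz : z ∈ e.target) (hz' : z' ∈ e.target) :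
    θ (e.symm z') = θ (e.symm z) + fderiv ℝ (θ ∘ e.symm) z (z' - z) := by
  have ha := he.mem_maximalAtlas
  have hΘ : ContDiffOn ℝ ∞ (θ ∘ e.symm) e.target := fun z hz =>
    (contDiffAt_comp_symm ha hz (F.coord.contMDiff _)).contDiffWithinAt
  have hΘd : ∀ z ∈ e.target, HasFDerivAt (θ ∘ e.symm) (fderiv ℝ (θ ∘ e.symm) z) z := fun z hz =>
    ((hΘ.contDiffAt (e.open_target.mem_nhds hz)).differentiableAt (by simp)).hasFDerivAt
  have hΘ' : ∀ z ∈ e.target, DifferentiableAt ℝ (fderiv ℝ (θ ∘ e.symm)) z := fun z hz =>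
    ((hΘ.fderiv_of_isOpen (m := ∞) e.open_target (by simp)).contDiffAt
      (e.open_target.mem_nhds hz)).differentiableAt (by simp)
  have hzero : ∀ z ∈ e.target, fderiv ℝ (fderiv ℝ (θ ∘ e.symm)) z = 0 := by
    intro z hz
    ext1 u
    ext1 d
    set y := e.symm z with hy
    have hys : y ∈ e.source := e.map_target hz
    have hey : e y = z := e.right_inv hz
    obtain ⟨X, hX, hXe⟩ := exists_smoothField_eventuallyEq e.open_source hys
      (contMDiffOn_coordField ha d)
    have h1 := F.affine X hX y (coordFrame e y u)
    have hDX : D X y = 0 := by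
      rw [← he.parallel d y hys]
      exact (connection_congr D (mdifferentiableAt_coordField ha hys d)
        (hXe.mono fun _ h => h.symm)).symm
    have h2 : (fun x => mvfderiv (𝓡 n) θ x (X x))
        =ᶠ[𝓝 y] fun x => fderiv ℝ (θ ∘ e.symm) (e x) d := by
      filter_upwards [hXe, e.open_source.mem_nhds hys] with x hx hxs
      rw [hx, coordField_eq, mvfderiv_coordFrame_apply ha hxs (F.mdifferentiable_parameter x)]
    have h3 : mvfderiv (𝓡 n) (fun x => mvfderiv (𝓡 n) θ x (X x)) y (coordFrame e y u)
        = mvfderiv (𝓡 n) (fun x => fderiv ℝ (θ ∘ e.symm) (e x) d) y (coordFrame e y u) :=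
      DFunLike.congr_fun h2.mfderiv_eq (coordFrame e y u)
    have h4 : HasFDerivAt (fun z => fderiv ℝ (θ ∘ e.symm) z d)
        ((fderiv ℝ (fderiv ℝ (θ ∘ e.symm)) z).flip d) (e y) := by
      rw [hey]
      simpa using (hΘ' z hz).hasFDerivAt.clm_apply (hasFDerivAt_const d z)
    rw [h3, mvfderiv_comp_coord ha hys h4, mvfderiv_coordFrame ha hys, hDX] at h1
    exact h1.trans (map_zero _)
  have hconst : ∀ w ∈ e.target, fderiv ℝ (θ ∘ e.symm) w = fderiv ℝ (θ ∘ e.symm) z := fun w hw =>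
    e.open_target.is_const_of_fderiv_eq_zero (𝕜 := ℝ) hc.isPreconnected
      (fun w hw => (hΘ' w hw).differentiableWithinAt) hzero hw hz
  set A := fderiv ℝ (θ ∘ e.symm) z with hA
  have hsub : ∀ w ∈ e.target, HasFDerivAt (fun w => (θ ∘ e.symm) w - A w) (0 : Coord n →L[ℝ] Coord n) w :=
    fun w hw => by
      have h1 := (hΘd w hw).sub A.hasFDerivAt
      rwa [hconst w hw, sub_self] at h1
  have h1 := e.open_target.is_const_of_fderiv_eq_zero (𝕜 := ℝ) hc.isPreconnected
    (fun w hw => (hsub w hw).differentiableAt.differentiableWithinAt)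
    (fun w hw => (hsub w hw).fderiv) hz' hz
  simp only [Function.comp] at h1
  rw [map_sub, ← sub_eq_iff_eq_add', ← sub_eq_zero, ← sub_eq_zero.2 h1]
  abel

/-- Along a segment in affine coordinates, the log-partition function is the cumulant generating
function of a linear statistic, and its second derivative is the metric. -/
theorem cgf_line [T2Space M] (F : IsExponentialFamily g D ν T θ Ψ)
    {e : OpenPartialHomeomorph M (Coord n)} (he : IsAffineCoord D e) (hc : Convex ℝ e.target)
    {q : M} (hq : q ∈ e.source) (d : Coord n) {t : ℝ} (ht : e q + t • d ∈ e.target) :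
    let μ := expMeasure ν T (θ q) (Ψ q)
    let τ := fderiv ℝ (θ ∘ e.symm) (e q) d
    let X : Ω → ℝ := fun z => inner ℝ τ (T z)
    expMeasure ν T (θ (e.symm (e q + t • d))) (Ψ (e.symm (e q + t • d)))
        = expMeasure μ T (t • τ) (Ψ (e.symm (e q + t • d)) - Ψ q) ∧
      t ∈ interior (ProbabilityTheory.integrableExpSet X μ) ∧
      ProbabilityTheory.cgf X μ t = Ψ (e.symm (e q + t • d)) - Ψ q ∧
      iteratedDeriv 2 (ProbabilityTheory.cgf X μ) t = coordMetric g e (e q + t • d) d d := by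
  intro μ τ X
  have ha := he.mem_maximalAtlas
  let l : ℝ → Coord n := fun t => e q + t • d
  have hld : ∀ t, HasDerivAt l d t := fun t => by
    have h := ((hasDerivAt_id t).smul_const d).const_add (e q)
    rw [one_smul] at h
    exact h
  have hlc : Continuous l := continuous_iff_continuousAt.2 fun t => (hld t).continuousAt
  have hJ : IsOpen (l ⁻¹' e.target) := e.open_target.preimage hlc
  have hθ : ∀ s ∈ l ⁻¹' e.target, θ (e.symm (l s)) = θ q + s • τ := by
    intro s hs
    rw [F.parameter_coord he hc (e.map_source hq) hs, e.left_inv hq]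
    simp only [l, add_sub_cancel_left, map_smul, τ]
  have hP : ∀ s ∈ l ⁻¹' e.target, expMeasure ν T (θ (e.symm (l s))) (Ψ (e.symm (l s)))
      = expMeasure μ T (s • τ) (Ψ (e.symm (l s)) - Ψ q) := by
    intro s hs
    rw [expMeasure_expMeasure F.measurable, hθ s hs, add_sub_cancel]
  have hprob : ∀ s ∈ l ⁻¹' e.target,
      IsProbabilityMeasure (expMeasure μ T (s • τ) (Ψ (e.symm (l s)) - Ψ q)) := fun s hs => by
    rw [← hP s hs]; exact F.normalized _
  have hX : ∀ s : ℝ, (fun z => (inner ℝ (s • τ) (T z) : ℝ)) = fun z => s * X z := fun s => by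
    funext z
    rw [real_inner_smul_left]
  -- The parameter set of the segment is open, so integrability on it already places it in the
  -- interior, where the cumulant generating function is analytic.
  have hint : l ⁻¹' e.target ⊆ interior (ProbabilityTheory.integrableExpSet X μ) :=
    interior_maximal (fun s hs => by
      have h1 := (integrable_exp_and_integral_eq F.measurable (hprob s hs)).1
      simp only [real_inner_smul_left] at h1
      exact h1) hJ
  have hcgf : ∀ s ∈ l ⁻¹' e.target, ProbabilityTheory.cgf X μ s = Ψ (e.symm (l s)) - Ψ q := by
    intro s hs
    have h1 := (integrable_exp_and_integral_eq F.measurable (hprob s hs)).2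
    simp only [real_inner_smul_left] at h1
    rw [ProbabilityTheory.cgf, ProbabilityTheory.mgf, h1, Real.log_exp]
  refine ⟨hP t ht, hint ht, hcgf t ht, ?_⟩
  set y := e.symm (l t) with hy
  have hys : y ∈ e.source := e.map_target ht
  have hey : e y = l t := e.right_inv ht
  -- The score in the direction of the segment is the statistic X centred by the derivative of the
  -- cumulant generating function, that is, by its mean under the tilted measure.
  have hscore : ∀ z, mvfderiv (𝓡 n) (fun s => inner ℝ (θ s) (T z) - Ψ s) y (coordFrame e y d)
      = X z - deriv (ProbabilityTheory.cgf X μ) t := by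
    intro z
    have hin : MDifferentiableAt (𝓡 n) 𝓘(ℝ, ℝ) (fun s => (inner ℝ (θ s) (T z) : ℝ)) y :=
      ((rieszMap.flip (T z)).differentiableAt (x := θ y)).mdifferentiableAt.comp y
        (F.mdifferentiable_parameter y)
    have hm : MDifferentiableAt (𝓡 n) 𝓘(ℝ, ℝ) (fun s => inner ℝ (θ s) (T z) - Ψ s) y :=
      hin.sub (F.mdifferentiable_logPartition y)
    rw [mvfderiv_coordFrame_apply ha hys hm, hey]
    have h1 : DifferentiableAt ℝ ((fun s => inner ℝ (θ s) (T z) - Ψ s) ∘ e.symm) (l t) :=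
      (hm.comp (l t) ((mdifferentiable_of_mem_maximalAtlas ha).mdifferentiableAt_symm
        ht)).differentiableAt
    have h2 := h1.hasFDerivAt.comp_hasDerivAt t (hld t)
    have h3 : ((fun s => inner ℝ (θ s) (T z) - Ψ s) ∘ e.symm) ∘ l =ᶠ[𝓝 t]
        fun s => inner ℝ (θ q) (T z) + s * X z - (ProbabilityTheory.cgf X μ s + Ψ q) := by
      filter_upwards [hJ.mem_nhds ht] with s hs
      simp only [Function.comp]
      rw [hcgf s hs, hθ s hs, inner_add_left, real_inner_smul_left]
      ring
    have h4 : HasDerivAt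
        (fun s => inner ℝ (θ q) (T z) + s * X z - (ProbabilityTheory.cgf X μ s + Ψ q))
        (1 * X z - deriv (ProbabilityTheory.cgf X μ) t) t :=
      (((hasDerivAt_id t).mul_const (X z)).const_add _).sub
        (((ProbabilityTheory.analyticAt_cgf (hint ht)).differentiableAt.hasDerivAt).add_const _)
    rw [one_mul] at h4
    exact h2.unique (h4.congr_of_eventuallyEq h3)
  have htilt : expMeasure ν T (θ y) (Ψ y) = μ.tilted (t * X ·) := by
    rw [hP t ht, expMeasure_eq_tilted F.measurable (hprob t ht), hX]
  have hXm : Measurable X := measurable_inner_statistic F.measurable τ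
  have hfin : coordMetric g e (l t) d d
      = g.inner y (coordFrame e y d) (coordFrame e y d) := rfl
  change iteratedDeriv 2 (ProbabilityTheory.cgf X μ) t = coordMetric g e (l t) d d
  -- The Fisher metric is the variance of X under the tilted measure, and this variance is the
  -- second derivative of the cumulant generating function.
  rw [hfin, F.fisher, htilt, ← ProbabilityTheory.variance_tilted_mul (hint ht),
    ProbabilityTheory.variance_eq_integral hXm.aemeasurable,
    ProbabilityTheory.integral_tilted_mul_self (hint ht)]
  simp only [hscore, ← sq]

end IsExponentialFamily

theorem eq_add_of_second_deriv_eq_zero {J : Set ℝ} (hJ : IsOpen J) (hc : Convex ℝ J)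
    {K k : ℝ → ℝ} (hK : ∀ t ∈ J, HasDerivAt K (k t) t) (hk : ∀ t ∈ J, HasDerivAt k 0 t)
    (h0 : (0 : ℝ) ∈ J) (h1 : (1 : ℝ) ∈ J) : K 1 = K 0 + k 0 := by
  have hk0 : ∀ t ∈ J, k t = k 0 := fun t ht =>
    hJ.is_const_of_deriv_eq_zero hc.isPreconnected
      (fun t ht => (hk t ht).differentiableAt.differentiableWithinAt)
      (fun t ht => (hk t ht).deriv) ht h0
  have hd : ∀ t ∈ J, HasDerivAt (fun t => K t - t * k 0) 0 t := fun t ht => by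
    have h := (hK t ht).sub ((hasDerivAt_id t).mul_const (k 0))
    rwa [hk0 t ht, one_mul, sub_self] at h
  have h := hJ.is_const_of_deriv_eq_zero hc.isPreconnected
      (fun t ht => (hd t ht).differentiableAt.differentiableWithinAt)
      (fun t ht => (hd t ht).deriv) h1 h0
  simp only [one_mul, zero_mul, sub_zero] at h
  linarith

/-- Along the η-segment from q to r, the cumulant generating function of X under P_q and ψ have the
same second derivative, so their difference is affine. Comparing values at times 0 and 1 gives
cgf(1) − E[X] = ψ(η(r)) − ψ(η(q)) − ⟨η*(q), η(r) − η(q)⟩. The left side is the Kullback information,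
and the right side is D(r, q) by the Legendre identity at q. -/
theorem IsLegendreChart.klDiv_eq_divergence [T2Space M] {C : CoordPair n M}
    {h : OpenPartialHomeomorph (Coord n) (Coord n)} (H : IsLegendreChart g D C h)
    (F : IsExponentialFamily g D ν T θ Ψ) {r q : M} (hr : r ∈ C.dom) (hq : q ∈ C.dom) :
    InformationTheory.klDiv (expMeasure ν T (θ q) (Ψ q)) (expMeasure ν T (θ r) (Ψ r))
      = ENNReal.ofReal (divergence C r q) := by
  have hconv : Convex ℝ C.η.target := H.target_eq ▸ H.pair.left.convex
  set d := C.η r - C.η q with hd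
  let l : ℝ → Coord n := fun t => C.η q + t • d
  have hld : ∀ t, HasDerivAt l d t := fun t => by
    have h := ((hasDerivAt_id t).smul_const d).const_add (C.η q)
    rw [one_smul] at h
    exact h
  have hlc : Continuous l := continuous_iff_continuousAt.2 fun t => (hld t).continuousAt
  set J := l ⁻¹' C.η.target with hJdef
  have hJ : IsOpen J := C.η.open_target.preimage hlc
  have hJc : Convex ℝ J := by
    intro s hs t ht a b ha hb hab
    have h1 := hconv hs ht ha hb hab
    have h2 : l (a • s + b • t) = a • l s + b • l t := by
      have ha' : a = 1 - b := by linarith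
      simp only [l, smul_eq_mul, ha']
      module
    rw [hJdef, mem_preimage, h2]
    exact h1
  have l0 : l 0 = C.η q := by simp [l]
  have l1 : l 1 = C.η r := by simp [l, hd]
  have h0 : (0 : ℝ) ∈ J := by rw [hJdef, mem_preimage, l0]; exact C.η.map_source hq
  have h1 : (1 : ℝ) ∈ J := by rw [hJdef, mem_preimage, l1]; exact C.η.map_source hr
  set μ := expMeasure ν T (θ q) (Ψ q) with hμ
  have hprob : IsProbabilityMeasure μ := F.normalized q
  set τ := fderiv ℝ (θ ∘ C.η.symm) (C.η q) d with hτ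
  set X : Ω → ℝ := fun z => inner ℝ τ (T z) with hX
  have hmain := fun t (ht : t ∈ J) => F.cgf_line H.affine hconv hq d (t := t) ht
  have hcd : ∀ t ∈ J, HasDerivAt (ProbabilityTheory.cgf X μ)
      (deriv (ProbabilityTheory.cgf X μ) t) t := fun t ht =>
    (ProbabilityTheory.analyticAt_cgf (hmain t ht).2.1).differentiableAt.hasDerivAt
  have hcdd : ∀ t ∈ J, HasDerivAt (deriv (ProbabilityTheory.cgf X μ))
      (coordMetric g C.η (l t) d d) t := fun t ht => by
    have h2 := (ProbabilityTheory.analyticAt_cgf (hmain t ht).2.1).deriv.differentiableAt.hasDerivAt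
    have h3 := (hmain t ht).2.2.2
    rw [iteratedDeriv_succ, iteratedDeriv_one] at h3
    exact h3 ▸ h2
  have hsrc : ∀ t ∈ J, l t ∈ h.source := fun t ht => H.target_eq ▸ ht
  have hFd : ∀ t ∈ J, HasDerivAt (fun t => C.ψ (l t)) (inner ℝ (h (l t)) d) t := fun t ht =>
    (H.pair.left.hasFDerivAt (hsrc t ht)).comp_hasDerivAt t (hld t)
  have hFdd : ∀ t ∈ J, HasDerivAt (fun t => (inner ℝ (h (l t)) d : ℝ))
      (coordMetric g C.η (l t) d d) t := fun t ht => by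
    rw [← H.metric_eq _ (hsrc t ht)]
    have h2 := ((H.pair.left.hasFDerivAt_gradient (hsrc t ht)).comp_hasDerivAt t (hld t)).inner ℝ
      (hasDerivAt_const t d)
    simpa using h2
  have key := eq_add_of_second_deriv_eq_zero hJ hJc
    (K := fun t => ProbabilityTheory.cgf X μ t - C.ψ (l t))
    (k := fun t => deriv (ProbabilityTheory.cgf X μ) t - inner ℝ (h (l t)) d)
    (fun t ht => (hcd t ht).sub (hFd t ht))
    (fun t ht => by simpa using (hcdd t ht).fun_sub (hFdd t ht)) h0 h1
  obtain ⟨hP1, hm1, hc1, -⟩ := hmain 1 h1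
  have hm0 := (hmain 0 h0).2.1
  have hr1 : C.η.symm (C.η q + (1 : ℝ) • d) = r := by
    change C.η.symm (l 1) = r
    rw [l1, C.η.left_inv hr]
  rw [hr1] at hP1 hc1
  rw [one_smul] at hP1
  have hXi : Integrable X μ := ProbabilityTheory.integrable_of_mem_interior_integrableExpSet hm0
  rw [hP1, klDiv_expMeasure F.measurable (hP1 ▸ F.normalized r) hXi]
  congr 1
  have hd0 : deriv (ProbabilityTheory.cgf X μ) 0 = ∫ z, X z ∂μ := by
    rw [ProbabilityTheory.deriv_cgf_zero hm0, probReal_univ, div_one]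
  have hleg := H.pair.legendre _ (H.map_mem hq)
  simp only [l0, l1, hd0, ProbabilityTheory.cgf_zero, hd, inner_sub_right] at key
  rw [divergence, H.star_apply, ← hc1]
  rw [real_inner_comm] at hleg
  rw [real_inner_comm (h (C.η q)) (C.η r)]
  change ProbabilityTheory.cgf X μ 1 - ∫ z, X z ∂μ = _
  linarith

end KullbackLink

end DuallyFlat
end

/-! ### The main theorem -/

theorem corollaryC {n : ℕ} {M : Type*} [TopologicalSpace M] [T2Space M]
    [ChartedSpace (DuallyFlat.Coord n) M] [IsManifold (𝓡 n) ∞ M]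
    (g : DuallyFlat.Metric n M) (D Ds : DuallyFlat.Connection n M)
    (hflat : DuallyFlat.IsDuallyFlat g D Ds) (x : M) :
    ∃ C : DuallyFlat.CoordPair n M,
      x ∈ C.dom ∧
      DuallyFlat.IsDualMongeAmperePair g D Ds C ∧
      (∀ r ∈ C.dom, ∀ q ∈ C.dom, 0 ≤ DuallyFlat.divergence C r q ∧
        (DuallyFlat.divergence C r q = 0 ↔ r = q)) ∧
      (∀ p ∈ C.dom, ∀ q ∈ C.dom,
        (∃ γ : ℝ → M, DuallyFlat.IsOptimalLearning g C.η
          (fun r => DuallyFlat.divergence C q r) p q γ) ∧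
        (∃ γ : ℝ → M, DuallyFlat.IsOptimalLearning g C.ηs
          (fun r => DuallyFlat.divergence C r q) p q γ)) ∧
      (∀ (Ω : Type*) [MeasurableSpace Ω] (ν : Measure Ω) (T : Ω → DuallyFlat.Coord n)
        (θ : M → DuallyFlat.Coord n) (Ψ : M → ℝ),
        DuallyFlat.IsExponentialFamily g D ν T θ Ψ →
        ∀ r ∈ C.dom, ∀ q ∈ C.dom,
          InformationTheory.klDiv (DuallyFlat.expMeasure ν T (θ q) (Ψ q))
              (DuallyFlat.expMeasure ν T (θ r) (Ψ r))
            = ENNReal.ofReal (DuallyFlat.divergence C r q)) := by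
  obtain ⟨C, h, hx, H⟩ := DuallyFlat.exists_isLegendreChart hflat x
  refine ⟨C, hx, H.isDualMongeAmperePair hflat, fun r hr q hq => ?_,
    fun p hp q hq => ⟨H.exists_isOptimalLearning hp hq, H.exists_isOptimalLearning_star hp hq⟩,
    fun Ω _ ν T θ Ψ F r hr q hq => H.klDiv_eq_divergence F hr hq⟩
  rcases eq_or_ne r q with rfl | hne
  · exact ⟨(H.divergence_self hr).ge, fun _ => rfl, fun _ => H.divergence_self hr⟩
  · have hpos := H.divergence_pos hr hq hne
    exact ⟨hpos.le, fun h0 => absurd h0 hpos.ne', fun h0 => absurd h0 hne⟩
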